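/- Let $n\ge 1$, $0\le\varrho\le 1$, $2\le p\le\infty$, $m\in\mathbb R$, and define $r$ by $\frac1r=\frac1p+\frac12$ (that is, $r=\frac{2p}{p+2}$, with $r=2$ if $p=\infty$). Write $\langle\xi\rangle=(1+|\xi|^2)^{1/2}$. *Amplitudes.* A function $a:\mathbb R^n\times\mathbb R^n\to\mathbb C$ belongs to $L^pS^m_\varrho$ if $a(\cdot,\xi)$ is measurable for every $\xi$, $a(x,\cdot)\in C^\infty(\mathbb R^n)$ for almost every $x$, and for each multi-index $\alpha$ there is a constant $C_\alpha$ with $\|\partial_\xi^\alpha a(\cdot,\xi)\|_{L^p(\mathbb R^n)}\le C_\alpha\langle\xi\rangle^{m-\varrho|\alpha|}$ for all $\xi$. For $s\in\mathbb N$ put $|a|_{p,m,s}=\sum_{|\alpha|\le s}\sup_{\xi}\langle\xi\rangle^{\varrho|\alpha|-m}\|\partial_\xi^\alpha a(\cdot,\xi)\|_{L^p}$. *Phases.* A real function $\varphi$ belongs to $\Phi^2$ with constants $(B_{\alpha,\beta})$ if $\varphi\in C^\infty(\mathbb R^n\times(\mathbb R^n\setminus 0))$, $\varphi(x,t\xi)=t\varphi(x,\xi)$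 for $t>0$, $\xi\neq0$, and $|\xi|^{-1+|\alpha|}|\partial_\xi^\alpha\partial_x^\beta\varphi(x,\xi)|\le B_{\alpha,\beta}$ for all $x$, all $\xi\ne0$ and all multi-indices with $|\alpha|+|\beta|\ge2$. It is strongly non-degenerate (SND) with constant $c>0$ if $\bigl|\det\bigl(\partial^2\varphi(x,\xi)/\partial x_j\partial\xi_k\bigr)\bigr|\ge c$ for all $x$ and all $\xi\neq0$. *Operator.* For $u$ in the Schwartz space $\mathscr S(\mathbb R^n)$ let $\widehat u(\xi)=\int e^{-i\langle y,\xi\rangle}u(y)\,dy$ and $$T_au(x)=(2\pi)^{-n}\int_{\mathbb R^n}e^{i\varphi(x,\xi)}a(x,\xi)\,\widehat u(\xi)\,d\xi .$$ **Theorem.** If $m<\frac{n(\varrho-1)}2$, there is an integer $N$ depending only on $n,m,\varrho,p$, and for every $c>0$ and every family $(B_{\alpha,\beta})$ there is a constant $C$ depending only on $n,m,\varrho,p,c,(B_{\alpha,\beta})$, such that the following holds. Let $\varphi\in\Phi^2$ with constants $(B_{\alpha,\beta})$ satisfy SND with constant $c$, and let $a\in L^pS^m_\varrho$. Then $|a|_{p,m,N}<\infty$,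 for every $u\in\mathscr S$ the integral defining $T_au(x)$ converges absolutely for almost every $x$, and $T_a$ extends from $\mathscr S$ to a bounded linear operator from $L^2(\mathbb R^n)$ to $L^r(\mathbb R^n)$ with $$\|T_af\|_{L^r}\le C\,|a|_{p,m,N}\,\|f\|_{L^2}\qquad(f\in L^2).$$ -/

import Mathlib

open MeasureTheory
open scoped ENNReal NNReal ContDiff SchwartzMap

noncomputable section

namespace RoughFIO

/-- The Euclidean space `ℝⁿ`. -/
abbrev E (n : ℕ) : Type := EuclideanSpace ℝ (Fin n)

/-- The partial derivative `∂_j f`. -/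
def pderiv {n : ℕ} {F : Type*} [NormedAddCommGroup F] [NormedSpace ℝ F]
    (j : Fin n) (f : E n → F) : E n → F :=
  fun x => fderiv ℝ f x (EuclideanSpace.single j 1)

/-- The length `|α| = α₁ + ⋯ + αₙ` of a multi-index. -/
def order {n : ℕ} (α : Fin n → ℕ) : ℕ := ∑ j, α j

/-- The multi-index derivative `∂^α f = ∂₁^{α₁} ⋯ ∂ₙ^{αₙ} f`. -/
def mderiv {n : ℕ} {F : Type*} [NormedAddCommGroup F] [NormedSpace ℝ F]
    (α : Fin n → ℕ) (f : E n → F) : E n → F :=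
  (List.finRange n).foldr (fun j g => (pderiv j)^[α j] g) f

/-- The mixed derivative `∂_ξ^α ∂_x^β φ (x, ξ)`. -/
def mixedDeriv {n : ℕ} (α β : Fin n → ℕ) (φ : E n → E n → ℝ) (x ξ : E n) : ℝ :=
  mderiv α (fun ζ => mderiv β (fun y => φ y ζ) x) ξ

/-- The Japanese bracket `⟨ξ⟩ = (1 + |ξ|²)^{1/2}`. -/
def bracket {n : ℕ} (ξ : E n) : ℝ := Real.sqrt (1 + ‖ξ‖ ^ 2)

/-- The amplitude `a` belongs to the class `L^p S^m_ρ`. -/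
structure IsAmplitude {n : ℕ} (p : ℝ≥0∞) (m ρ : ℝ) (a : E n → E n → ℂ) : Prop where
  measurable : ∀ ξ, AEStronglyMeasurable (fun x => a x ξ) volume
  smooth : ∀ᵐ x, ContDiff ℝ ∞ (a x)
  bound : ∀ α : Fin n → ℕ, ∃ C : ℝ, ∀ ξ : E n,
    eLpNorm (fun x => mderiv α (a x) ξ) p volume
      ≤ ENNReal.ofReal (C * bracket ξ ^ (m - ρ * (order α : ℝ)))

/-- The seminorm
`|a|_{p,m,s} = ∑_{|α| ≤ s} sup_ξ ⟨ξ⟩^{ρ|α| - m} ‖∂_ξ^α a(·, ξ)‖_{L^p}` of the class `L^p S^m_ρ`. -/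
def ampSeminorm {n : ℕ} (p : ℝ≥0∞) (m ρ : ℝ) (s : ℕ) (a : E n → E n → ℂ) : ℝ≥0∞ :=
  ∑ k ∈ Finset.range (s + 1), ∑ α ∈ Finset.piAntidiag (Finset.univ : Finset (Fin n)) k,
    ⨆ ξ : E n, ENNReal.ofReal (bracket ξ ^ (ρ * (order α : ℝ) - m)) *
      eLpNorm (fun x => mderiv α (a x) ξ) p volume

/-- The phase `φ` belongs to the class `Φ^k` with constants `B α β`, that is, `φ` is smooth on
`ℝⁿ × (ℝⁿ ∖ 0)`, positively homogeneous of degree one in `ξ`, and satisfies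
`|ξ|^{-1+|α|} |∂_ξ^α ∂_x^β φ(x, ξ)| ≤ B α β` whenever `|α| + |β| ≥ k`.
The class `Φ^k` itself is the union of these sets over all families `B`.
The values `φ x 0` play no role. -/
structure IsPhaseWith {n : ℕ} (k : ℕ) (B : (Fin n → ℕ) → (Fin n → ℕ) → ℝ)
    (φ : E n → E n → ℝ) : Prop where
  smooth : ContDiffOn ℝ ∞ (fun z : E n × E n => φ z.1 z.2) {z | z.2 ≠ 0}
  homogeneous : ∀ x ξ : E n, ξ ≠ 0 → ∀ t : ℝ, 0 < t → φ x (t • ξ) = t * φ x ξ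
  bound : ∀ α β : Fin n → ℕ, k ≤ order α + order β → ∀ x ξ : E n, ξ ≠ 0 →
    ‖ξ‖ ^ (-1 + (order α : ℤ)) * |mixedDeriv α β φ x ξ| ≤ B α β

/-- The strong non-degeneracy bound `|det (∂²φ / ∂x_j ∂ξ_k)| ≥ c` on `ℝⁿ × (ℝⁿ ∖ 0)`.
The strong non-degeneracy condition says that this holds for some `c > 0`. -/
def SNDWith {n : ℕ} (c : ℝ) (φ : E n → E n → ℝ) : Prop :=
  ∀ x ξ : E n, ξ ≠ 0 →
    c ≤ |(Matrix.of fun j k : Fin n => pderiv j (fun y => pderiv k (φ y) ξ) x).det|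

/-- The Fourier transform `û(ξ) = ∫ e^{-i⟨y, ξ⟩} u(y) dy`. -/
def fourierHat {n : ℕ} (u : E n → ℂ) (ξ : E n) : ℂ :=
  ∫ y, Complex.exp (-Complex.I * ((inner ℝ y ξ : ℝ) : ℂ)) * u y

/-- The integrand `e^{iφ(x, ξ)} a(x, ξ) û(ξ)` of the Fourier integral operator. -/
def fioIntegrand {n : ℕ} (φ : E n → E n → ℝ) (a : E n → E n → ℂ) (u : E n → ℂ)
    (x ξ : E n) : ℂ :=
  Complex.exp (Complex.I * (φ x ξ : ℂ)) * a x ξ * fourierHat u ξ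

/-- The Fourier integral operator
`T_a u(x) = (2π)^{-n} ∫ e^{iφ(x, ξ)} a(x, ξ) û(ξ) dξ`. -/
def fio {n : ℕ} (φ : E n → E n → ℝ) (a : E n → E n → ℂ) (u : E n → ℂ) (x : E n) : ℂ :=
  (((2 * Real.pi) ^ n : ℝ) : ℂ)⁻¹ * ∫ ξ, fioIntegrand φ a u x ξ

end RoughFIO

end

noncomputable section

namespace RoughFIO

/-! ### Iterated directional derivatives on open sets -/

section DirDeriv

variable {V V' F : Type*} [NormedAddCommGroup V] [NormedSpace ℝ V]
  [NormedAddCommGroup V'] [NormedSpace ℝ V'] [NormedAddCommGroup F] [NormedSpace ℝ F]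

/-! Let F v(x) = ∫ e^{iφ(x,ξ)} v(ξ) dξ be the operator with amplitude 1. The proof bounds F on a
weighted L² and transfers the bound to rough amplitudes by expanding a(x, ·) in ξ.

Transfer. No regularity of a in x is available, but in ξ it varies at scale ⟨ξ⟩^ρ.
`eq_sum_integral_cube` writes a(x, ξ) exactly as a sum over α ∈ {0,1}ⁿ of weighted integrals of
∂_ξ^α a(x, ·) over a cube of side about ⟨ξ⟩^ρ with a corner at ξ. Each term has the form ∫ K(ξ,η)
b(x,η) dμ(η), where b is a normalised derivative, bounded in L^p_x uniformly in η, and μ =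
⟨η⟩^{-n-γ} dη is finite. The operator becomes ∫ b(x,η) F(K(·,η) û)(x) dμ(η). Cauchy–Schwarz in η
separates the factors: the one from b is in L^p because p ≥ 2 and μ is finite, the other is in L² by
the bound for F, and Hölder gives L^r (`amplitude_bound_of_measurable`, `amplitude_bound_of_cube`).
If F loses ⟨ξ⟩^γ, what is needed is that ⟨ξ⟩^γ ∫ |K(ξ,η)|² dμ(η) stay bounded. Its order in ⟨ξ⟩ is
2γ + 2m + n(1-ρ), which vanishes for γ = n(ρ-1)/2 - m; the hypothesis on m says that this γ is
positive.

High frequencies. On a shell |ξ| ~ t the T T* kernel is an oscillatory integral with phase φ(x,ξ) -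
φ(y,ξ). Non-degeneracy makes the Jacobian of x ↦ ∇_ξφ(x,ξ) uniformly invertible, and Hadamard's
global inverse theorem upgrades this to |∇_ξφ(x,ξ) - ∇_ξφ(y,ξ)| ≥ c|x-y|
(`exists_gradient_bound_below`). Integration by parts bounds the kernel by tⁿ(1 + t|x-y|)^{-n-1},
and Schur's test gives a constant independent of t (`exists_shell_bound`). Summing the shells by
Cauchy–Schwarz costs the factor ⟨ξ⟩^γ (`exists_global_bound`).

Low frequencies. At ξ = 0 the phase is singular, and Φ² gives no bound for ∇_ξφ itself. In a cone
around a unit vector u one has e^{iφ} = e^{i⟨∇_ξφ(x,u),ξ⟩}(1 + Θ) with Θ a symbol of order 1 in |ξ|.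
The linear phase is smooth through 0 and yields to T T*; the term with Θ follows from it by the same
cube expansion with p = ∞, cubes of side about |ξ| and density |η|^{2-n} (`exists_cone_bound`). -/

/-- The iterated directional derivative of `f` along the vectors of the list `l`. -/
def dirDeriv (l : List V) (f : V → F) : V → F :=
  l.foldr (fun v g x => fderiv ℝ g x v) f

@[simp] theorem dirDeriv_nil (f : V → F) : dirDeriv [] f = f := rfl

theorem dirDeriv_cons (v : V) (l : List V) (f : V → F) :
    dirDeriv (v :: l) f = fun x => fderiv ℝ (dirDeriv l f) x v := rfl

theorem dirDeriv_append (l l' : List V) (f : V → F) :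
    dirDeriv (l ++ l') f = dirDeriv l (dirDeriv l' f) := by
  simp [dirDeriv, List.foldr_append]

theorem fderiv_eqOn_of_eqOn {s : Set V} (hs : IsOpen s) {f g : V → F} (h : Set.EqOn f g s)
    {x : V} (hx : x ∈ s) : fderiv ℝ f x = fderiv ℝ g x :=
  Filter.EventuallyEq.fderiv_eq (h.eventuallyEq_of_mem (hs.mem_nhds hx))

theorem dirDeriv_congr {s : Set V} (hs : IsOpen s) {f g : V → F} (h : Set.EqOn f g s)
    (l : List V) : Set.EqOn (dirDeriv l f) (dirDeriv l g) s := by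
  induction l with
  | nil => exact h
  | cons v l ih =>
    intro x hx
    simp only [dirDeriv_cons]
    rw [fderiv_eqOn_of_eqOn hs ih hx]

theorem contDiffOn_fderiv_apply {s : Set V} (hs : IsOpen s) {f : V → F}
    (hf : ContDiffOn ℝ ∞ f s) (v : V) : ContDiffOn ℝ ∞ (fun x => fderiv ℝ f x v) s :=
  (hf.fderiv_of_isOpen hs (m := ∞) (by simp)).clm_apply contDiffOn_const

theorem contDiffOn_dirDeriv {s : Set V} (hs : IsOpen s) {f : V → F}
    (hf : ContDiffOn ℝ ∞ f s) (l : List V) : ContDiffOn ℝ ∞ (dirDeriv l f) s := by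
  induction l with
  | nil => exact hf
  | cons v l ih => exact contDiffOn_fderiv_apply hs ih v

theorem fderiv_fderiv_comm {s : Set V} (hs : IsOpen s) {f : V → F}
    (hf : ContDiffOn ℝ ∞ f s) (v w : V) {x : V} (hx : x ∈ s) :
    fderiv ℝ (fun y => fderiv ℝ f y v) x w = fderiv ℝ (fun y => fderiv ℝ f y w) x v := by
  have h1 : DifferentiableAt ℝ (fderiv ℝ f) x :=
    ((hf.fderiv_of_isOpen hs (m := ∞) (by simp)).contDiffAt (hs.mem_nhds hx)).differentiableAt
      (by simp)
  have h2 : IsSymmSndFDerivAt ℝ f x :=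
    (hf.contDiffAt (hs.mem_nhds hx)).isSymmSndFDerivAt
      (by simpa using (WithTop.coe_le_coe.2 le_top : ((2 : ℕ∞) : WithTop ℕ∞) ≤ ((⊤ : ℕ∞) : WithTop ℕ∞)))
  have h3 : ∀ u : V, fderiv ℝ (fun y => fderiv ℝ f y u) x = (fderiv ℝ (fderiv ℝ f) x).flip u := by
    intro u
    rw [fderiv_clm_apply h1 (differentiableAt_const u)]
    simp
  rw [h3, h3]
  simpa using h2 w v

/-- Each adjacent swap is the symmetry of second derivatives. An open set is carried along because
the phase is smooth only off ξ = 0. -/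
theorem dirDeriv_perm {s : Set V} (hs : IsOpen s) {f : V → F} (hf : ContDiffOn ℝ ∞ f s)
    {l l' : List V} (h : l.Perm l') : Set.EqOn (dirDeriv l f) (dirDeriv l' f) s := by
  induction h with
  | nil => exact fun _ _ => rfl
  | cons v _ ih =>
    intro x hx
    simp only [dirDeriv_cons]
    rw [fderiv_eqOn_of_eqOn hs ih hx]
  | swap v w l =>
    intro x hx
    simp only [dirDeriv_cons]
    exact fderiv_fderiv_comm hs (contDiffOn_dirDeriv hs hf l) v w hx
  | trans _ _ ih1 ih2 => exact ih1.trans ih2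

/-- Applied to the inclusions of the slices {x} × ℝⁿ and ℝⁿ × {ξ}, this turns derivatives in one
variable into joint derivatives of a function of (x, ξ). -/
theorem dirDeriv_comp_affine {s : Set V'} (hs : IsOpen s) {f : V' → F} (hf : ContDiffOn ℝ ∞ f s)
    (L : V →L[ℝ] V') (c : V') (l : List V) :
    ∀ x, L x + c ∈ s → dirDeriv l (fun y => f (L y + c)) x = dirDeriv (l.map L) f (L x + c) := by
  have ho : IsOpen ((fun x => L x + c) ⁻¹' s) := hs.preimage (by fun_prop)
  induction l with
  | nil => intro x _; rfl
  | cons v l ih =>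
    intro x hx
    simp only [List.map_cons, dirDeriv_cons]
    rw [fderiv_eqOn_of_eqOn ho (g := fun x => dirDeriv (l.map L) f (L x + c))
      (fun y hy => ih y hy) hx]
    have h1 : HasFDerivAt (dirDeriv (l.map L) f) (fderiv ℝ (dirDeriv (l.map L) f) (L x + c))
        (L x + c) :=
      (((contDiffOn_dirDeriv hs hf _).contDiffAt (hs.mem_nhds hx)).differentiableAt
        (by simp)).hasFDerivAt
    have h2 : HasFDerivAt (fun x => L x + c) L x := L.hasFDerivAt.add_const c
    exact congrArg (fun A => A v) (h1.comp x h2).fderiv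

end DirDeriv

/-! ### Partial derivatives indexed by lists, and multi-indices -/

section MultiIndex

variable {n : ℕ} {F : Type*} [NormedAddCommGroup F] [NormedSpace ℝ F]

/-- The standard basis vector `e_j`. -/
abbrev basisVec (j : Fin n) : E n := EuclideanSpace.single j 1

/-- The partial derivative `∂_{j₁} ⋯ ∂_{j_k} f` for a list `[j₁, …, j_k]` of coordinates. -/
def wderiv (l : List (Fin n)) (f : E n → F) : E n → F := dirDeriv (l.map basisVec) f

@[simp] theorem wderiv_nil (f : E n → F) : wderiv [] f = f := rfl

theorem wderiv_cons (j : Fin n) (l : List (Fin n)) (f : E n → F) :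
    wderiv (j :: l) f = pderiv j (wderiv l f) := rfl

theorem wderiv_append (l l' : List (Fin n)) (f : E n → F) :
    wderiv (l ++ l') f = wderiv l (wderiv l' f) := by
  simp [wderiv, dirDeriv_append]

/-- The sorted list of coordinates in which `j` occurs `α j` times. -/
def wordOf (α : Fin n → ℕ) : List (Fin n) :=
  (List.finRange n).flatMap fun j => List.replicate (α j) j

theorem mderiv_eq_wderiv (α : Fin n → ℕ) (f : E n → F) : mderiv α f = wderiv (wordOf α) f := by
  unfold mderiv wordOf
  induction List.finRange n with
  | nil => rfl
  | cons j t ih =>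
    rw [List.foldr_cons, ih, List.flatMap_cons, wderiv_append]
    generalize wderiv (t.flatMap fun j => List.replicate (α j) j) f = g
    induction α j with
    | zero => rfl
    | succ k ihk =>
      rw [Function.iterate_succ_apply', ihk, List.replicate_succ, wderiv_cons]

theorem count_wordOf (α : Fin n → ℕ) (j : Fin n) : (wordOf α).count j = α j := by
  unfold wordOf
  rw [List.count_flatMap]
  have : (List.count j ∘ fun i => List.replicate (α i) i) = fun i => if i = j then α i else 0 := by
    funext i
    simp [List.count_replicate]
  rw [this, ← Fin.sum_univ_def]
  simp

theorem wordOf_count_perm (l : List (Fin n)) : (wordOf fun j => l.count j).Perm l := by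
  rw [List.perm_iff_count]
  intro j
  rw [count_wordOf]

theorem order_count (l : List (Fin n)) : order (fun j => l.count j) = l.length := by
  unfold order
  induction l with
  | nil => simp
  | cons a t ih =>
    simp only [List.count_cons, Finset.sum_add_distrib, ih, List.length_cons]
    simp

theorem wderiv_perm {s : Set (E n)} (hs : IsOpen s) {f : E n → F} (hf : ContDiffOn ℝ ∞ f s)
    {l l' : List (Fin n)} (h : l.Perm l') : Set.EqOn (wderiv l f) (wderiv l' f) s :=
  dirDeriv_perm hs hf (h.map _)

/-- Lists suit induction, multi-indices occur in the hypotheses; symmetry of derivatives makes them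
interchangeable. -/
theorem wderiv_eq_mderiv {s : Set (E n)} (hs : IsOpen s) {f : E n → F} (hf : ContDiffOn ℝ ∞ f s)
    (l : List (Fin n)) : Set.EqOn (wderiv l f) (mderiv (fun j => l.count j) f) s := by
  rw [mderiv_eq_wderiv]
  exact wderiv_perm hs hf (wordOf_count_perm l).symm

theorem wderiv_congr {s : Set (E n)} (hs : IsOpen s) {f g : E n → F} (h : Set.EqOn f g s)
    (l : List (Fin n)) : Set.EqOn (wderiv l f) (wderiv l g) s := dirDeriv_congr hs h _

theorem contDiffOn_wderiv {s : Set (E n)} (hs : IsOpen s) {f : E n → F}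
    (hf : ContDiffOn ℝ ∞ f s) (l : List (Fin n)) : ContDiffOn ℝ ∞ (wderiv l f) s :=
  contDiffOn_dirDeriv hs hf _

theorem contDiffOn_pderiv {s : Set (E n)} (hs : IsOpen s) {f : E n → F}
    (hf : ContDiffOn ℝ ∞ f s) (j : Fin n) : ContDiffOn ℝ ∞ (pderiv j f) s :=
  contDiffOn_fderiv_apply hs hf _

theorem pderiv_congr {s : Set (E n)} (hs : IsOpen s) {f g : E n → F} (h : Set.EqOn f g s)
    (j : Fin n) : Set.EqOn (pderiv j f) (pderiv j g) s := wderiv_congr hs h [j]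

end MultiIndex

/-! ### Calculus rules for partial derivatives -/

section PderivRules

variable {n : ℕ} {A : Type*} [NormedField A] [NormedAlgebra ℝ A]

theorem pderiv_add {f g : E n → A} {x : E n} (hf : DifferentiableAt ℝ f x)
    (hg : DifferentiableAt ℝ g x) (j : Fin n) :
    pderiv j (fun y => f y + g y) x = pderiv j f x + pderiv j g x := by
  simp [pderiv, fderiv_fun_add hf hg]

theorem pderiv_mul {f g : E n → A} {x : E n} (hf : DifferentiableAt ℝ f x)
    (hg : DifferentiableAt ℝ g x) (j : Fin n) :
    pderiv j (fun y => f y * g y) x = pderiv j f x * g x + f x * pderiv j g x := by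
  simp only [pderiv]
  rw [(show HasFDerivAt (fun y => f y * g y) _ x from hf.hasFDerivAt.mul hg.hasFDerivAt).fderiv]
  simp only [add_apply, smul_apply, smul_eq_mul]
  ring

theorem pderiv_const (c : A) (j : Fin n) : pderiv j (fun _ : E n => c) = fun _ => 0 := by
  funext x
  simp [pderiv]

theorem pderiv_sub_const (f : E n → A) (c : A) (j : Fin n) :
    pderiv j (fun y => f y - c) = pderiv j f := by
  funext x
  simp only [pderiv, fderiv_sub_const]

theorem pderiv_inv {f : E n → A} {x : E n} (hf : DifferentiableAt ℝ f x) (hx : f x ≠ 0)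
    (j : Fin n) : pderiv j (fun y => (f y)⁻¹) x = -(pderiv j f x * ((f x)⁻¹ * (f x)⁻¹)) := by
  have hi : DifferentiableAt ℝ (fun y => (f y)⁻¹) x := hf.inv hx
  have h1 := pderiv_mul hf hi j
  have h2 : pderiv j (fun y => f y * (f y)⁻¹) x = 0 := by
    have h3 : (fun y => f y * (f y)⁻¹) =ᶠ[nhds x] fun _ => 1 := by
      filter_upwards [hf.continuousAt.eventually_ne hx] with y hy
      exact mul_inv_cancel₀ hy
    simp only [pderiv]
    rw [h3.fderiv_eq]
    simp
  rw [h2] at h1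
  have h4 : f x * pderiv j (fun y => (f y)⁻¹) x = -(pderiv j f x * (f x)⁻¹) := by
    linear_combination -h1
  have h5 : pderiv j (fun y => (f y)⁻¹) x = (f x)⁻¹ * (f x * pderiv j (fun y => (f y)⁻¹) x) := by
    field_simp
  rw [h5, h4]
  ring

theorem pderiv_ofReal {f : E n → ℝ} {x : E n} (hf : DifferentiableAt ℝ f x) (j : Fin n) :
    pderiv j (fun y => (f y : ℂ)) x = ((pderiv j f x : ℝ) : ℂ) := by
  simp only [pderiv]
  have h := (Complex.ofRealCLM.hasFDerivAt (x := f x)).comp x hf.hasFDerivAt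
  exact congrArg (fun B => B (EuclideanSpace.single j 1)) h.fderiv

theorem pderiv_cexp {f : E n → ℂ} {x : E n} (hf : DifferentiableAt ℝ f x) (j : Fin n) :
    pderiv j (fun y => Complex.exp (f y)) x = Complex.exp (f x) * pderiv j f x := by
  simp only [pderiv]
  rw [hf.hasFDerivAt.cexp.fderiv]
  rfl

end PderivRules

/-! ### Uniform symbol estimates and their calculus -/

section SymbolClass

variable {n : ℕ} {ι : Type*} {A : Type*} [NormedField A] [NormedAlgebra ℝ A]
  {s : Set (E n)} {W : E n → ℝ}

/-- A family `g` of functions on `s` obeys symbol estimates of order `e` with respect to the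
weight `W`, uniformly in the index, for all derivatives of order at most `k`: each derivative of
order `l ≤ k` is bounded by a constant multiple of `W ^ (e - l)`. -/
def SymbolBound (s : Set (E n)) (W : E n → ℝ) : ℕ → ℤ → (ι → E n → A) → Prop
  | 0, e, g => ∃ C : ℝ, ∀ i, ∀ ξ ∈ s, ‖g i ξ‖ ≤ C * W ξ ^ e
  | k + 1, e, g => (∃ C : ℝ, ∀ i, ∀ ξ ∈ s, ‖g i ξ‖ ≤ C * W ξ ^ e) ∧
      (∀ i, DifferentiableOn ℝ (g i) s) ∧
      ∀ j, SymbolBound s W k (e - 1) (fun i => pderiv j (g i))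

namespace SymbolBound

theorem bound {k : ℕ} {e : ℤ} {g : ι → E n → A} (h : SymbolBound s W k e g) :
    ∃ C : ℝ, ∀ i, ∀ ξ ∈ s, ‖g i ξ‖ ≤ C * W ξ ^ e := by
  cases k with
  | zero => exact h
  | succ k => exact h.1

theorem bound_nonneg (hW : ∀ ξ ∈ s, 0 < W ξ) {k : ℕ} {e : ℤ} {g : ι → E n → A}
    (h : SymbolBound s W k e g) :
    ∃ C : ℝ, 0 ≤ C ∧ ∀ i, ∀ ξ ∈ s, ‖g i ξ‖ ≤ C * W ξ ^ e := by
  obtain ⟨C, hC⟩ := h.bound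
  refine ⟨|C|, abs_nonneg C, fun i ξ hξ => (hC i ξ hξ).trans ?_⟩
  have := hW ξ hξ
  gcongr
  exact le_abs_self C

theorem congr (hs : IsOpen s) {k : ℕ} : ∀ {e : ℤ} {g g' : ι → E n → A},
    (∀ i, Set.EqOn (g i) (g' i) s) → SymbolBound s W k e g → SymbolBound s W k e g' := by
  induction k with
  | zero =>
    rintro e g g' he ⟨C, hC⟩
    exact ⟨C, fun i ξ hξ => he i hξ ▸ hC i ξ hξ⟩
  | succ k ih =>
    rintro e g g' he ⟨⟨C, hC⟩, hd, hj⟩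
    exact ⟨⟨C, fun i ξ hξ => he i hξ ▸ hC i ξ hξ⟩,
      fun i => (hd i).congr fun ξ hξ => (he i hξ).symm,
      fun j => ih (fun i => pderiv_congr hs (he i) j) (hj j)⟩

theorem of_succ {k : ℕ} : ∀ {e : ℤ} {g : ι → E n → A},
    SymbolBound s W (k + 1) e g → SymbolBound s W k e g := by
  induction k with
  | zero => exact fun h => h.1
  | succ k ih => exact fun h => ⟨h.1, h.2.1, fun j => ih (h.2.2 j)⟩

theorem differentiableAt (hs : IsOpen s) {k : ℕ} {e : ℤ} {g : ι → E n → A}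
    (h : SymbolBound s W (k + 1) e g) (i : ι) {ξ : E n} (hξ : ξ ∈ s) :
    DifferentiableAt ℝ (g i) ξ := (h.2.1 i).differentiableAt (hs.mem_nhds hξ)

theorem add (hs : IsOpen s) {k : ℕ} : ∀ {e : ℤ} {g h : ι → E n → A}, SymbolBound s W k e g →
    SymbolBound s W k e h → SymbolBound s W k e (fun i ξ => g i ξ + h i ξ) := by
  have key : ∀ {e : ℤ} {g h : ι → E n → A}, (∃ C : ℝ, ∀ i, ∀ ξ ∈ s, ‖g i ξ‖ ≤ C * W ξ ^ e) →
      (∃ C : ℝ, ∀ i, ∀ ξ ∈ s, ‖h i ξ‖ ≤ C * W ξ ^ e) →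
      ∃ C : ℝ, ∀ i, ∀ ξ ∈ s, ‖g i ξ + h i ξ‖ ≤ C * W ξ ^ e := by
    rintro e g h ⟨C, hC⟩ ⟨D, hD⟩
    refine ⟨C + D, fun i ξ hξ => (norm_add_le _ _).trans ?_⟩
    rw [add_mul]
    exact add_le_add (hC i ξ hξ) (hD i ξ hξ)
  induction k with
  | zero => exact fun h1 h2 => key h1 h2
  | succ k ih =>
    intro e g h h1 h2
    refine ⟨key h1.1 h2.1, fun i => (h1.2.1 i).add (h2.2.1 i), fun j => ?_⟩
    exact (ih (h1.2.2 j) (h2.2.2 j)).congr hs fun i ξ hξ =>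
      (pderiv_add (h1.differentiableAt hs i hξ) (h2.differentiableAt hs i hξ) j).symm

theorem mul (hs : IsOpen s) (hW : ∀ ξ ∈ s, 0 < W ξ) {k : ℕ} : ∀ {e e' : ℤ} {g h : ι → E n → A},
    SymbolBound s W k e g → SymbolBound s W k e' h →
    SymbolBound s W k (e + e') (fun i ξ => g i ξ * h i ξ) := by
  have key : ∀ {k : ℕ} {e e' : ℤ} {g h : ι → E n → A}, SymbolBound s W k e g →
      SymbolBound s W k e' h →
      ∃ C : ℝ, ∀ i, ∀ ξ ∈ s, ‖g i ξ * h i ξ‖ ≤ C * W ξ ^ (e + e') := by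
    intro k e e' g h h1 h2
    obtain ⟨C, hC0, hC⟩ := h1.bound_nonneg hW
    obtain ⟨D, hD0, hD⟩ := h2.bound_nonneg hW
    refine ⟨C * D, fun i ξ hξ => ?_⟩
    have hw := hW ξ hξ
    rw [norm_mul, zpow_add₀ hw.ne']
    calc ‖g i ξ‖ * ‖h i ξ‖ ≤ (C * W ξ ^ e) * (D * W ξ ^ e') :=
          mul_le_mul (hC i ξ hξ) (hD i ξ hξ) (norm_nonneg _) (by positivity)
      _ = _ := by ring
  induction k with
  | zero => exact fun h1 h2 => key h1 h2
  | succ k ih =>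
    intro e e' g h h1 h2
    refine ⟨key h1 h2, fun i => (h1.2.1 i).mul (h2.2.1 i), fun j => ?_⟩
    have a1 := ih (h1.2.2 j) h2.of_succ
    have a2 := ih h1.of_succ (h2.2.2 j)
    rw [show e - 1 + e' = e + e' - 1 by ring] at a1
    rw [show e + (e' - 1) = e + e' - 1 by ring] at a2
    exact (a1.add hs a2).congr hs fun i ξ hξ =>
      (pderiv_mul (h1.differentiableAt hs i hξ) (h2.differentiableAt hs i hξ) j).symm

theorem zero (k : ℕ) : ∀ e : ℤ, SymbolBound s W k e (fun (_ : ι) (_ : E n) => (0 : A)) := by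
  induction k with
  | zero => exact fun e => ⟨0, fun i ξ _ => by simp⟩
  | succ k ih =>
    refine fun e => ⟨⟨0, fun i ξ _ => by simp⟩, fun i => differentiableOn_const _, fun j => ?_⟩
    simp only [pderiv_const]
    exact ih _

theorem const (k : ℕ) (c : A) : SymbolBound s W k 0 (fun (_ : ι) (_ : E n) => c) := by
  cases k with
  | zero => exact ⟨‖c‖, fun i ξ _ => by simp⟩
  | succ k =>
    refine ⟨⟨‖c‖, fun i ξ _ => by simp⟩, fun i => differentiableOn_const _, fun j => ?_⟩
    simp only [pderiv_const]
    exact zero k _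

theorem const_mul (hs : IsOpen s) (hW : ∀ ξ ∈ s, 0 < W ξ) {k : ℕ} {e : ℤ} {g : ι → E n → A}
    (h : SymbolBound s W k e g) (c : A) : SymbolBound s W k e (fun i ξ => c * g i ξ) := by
  have := (const (ι := ι) (s := s) (W := W) k c).mul hs hW h
  rwa [zero_add] at this

theorem sum (hs : IsOpen s) {κ : Type*} (t : Finset κ) {k : ℕ} {e : ℤ} {g : κ → ι → E n → A}
    (h : ∀ a ∈ t, SymbolBound s W k e (g a)) :
    SymbolBound s W k e (fun i ξ => ∑ a ∈ t, g a i ξ) := by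
  classical
  induction t using Finset.induction_on with
  | empty => simpa using zero k e
  | insert a t ha ih =>
    have := (h a (Finset.mem_insert_self a t)).add hs
      (ih fun b hb => h b (Finset.mem_insert_of_mem hb))
    simpa only [Finset.sum_insert ha] using this

/-- The derivative of 1/g is -g' g⁻², of order (e - 1) - 2e = -e - 1, so the claim for k derivatives
feeds the one for k + 1; the lower bound on |g| starts the induction. -/
theorem inv (hs : IsOpen s) (hW : ∀ ξ ∈ s, 0 < W ξ) {e : ℤ} {g : ι → E n → A} {c : ℝ}
    (hc : 0 < c) (hg : ∀ i, ∀ ξ ∈ s, c * W ξ ^ e ≤ ‖g i ξ‖) {k : ℕ}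
    (h : SymbolBound s W k e g) : SymbolBound s W k (-e) (fun i ξ => (g i ξ)⁻¹) := by
  have hne : ∀ i, ∀ ξ ∈ s, g i ξ ≠ 0 := fun i ξ hξ => by
    have hw := hW ξ hξ
    exact norm_pos_iff.1 (lt_of_lt_of_le (by positivity) (hg i ξ hξ))
  have key : ∃ C : ℝ, ∀ i, ∀ ξ ∈ s, ‖(g i ξ)⁻¹‖ ≤ C * W ξ ^ (-e) := by
    refine ⟨c⁻¹, fun i ξ hξ => ?_⟩
    have hw := hW ξ hξ
    rw [norm_inv, zpow_neg, ← mul_inv]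
    exact inv_anti₀ (by positivity) (hg i ξ hξ)
  induction k with
  | zero => exact key
  | succ k ih =>
    refine ⟨key, fun i => (h.2.1 i).inv (hne i), fun j => ?_⟩
    have h1 := ih h.of_succ
    have h2 := (((h.2.2 j).mul hs hW (h1.mul hs hW h1))).const_mul hs hW (-1)
    rw [show e - 1 + (-e + -e) = -e - 1 by ring] at h2
    refine h2.congr hs fun i ξ hξ => ?_
    simp only [pderiv_inv (h.differentiableAt hs i hξ) (hne i ξ hξ) j]
    ring

/-- Where W ≤ R one has W^(e+d) ≤ R^d W^e, and every derivative inherits the same shift d. -/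
theorem mono_exponent (hW : ∀ ξ ∈ s, 0 < W ξ) {R : ℝ} (hR : ∀ ξ ∈ s, W ξ ≤ R) {d : ℕ}
    {k : ℕ} : ∀ {e : ℤ} {g : ι → E n → A}, SymbolBound s W k (e + d) g →
      SymbolBound s W k e g := by
  have key : ∀ {k : ℕ} {e : ℤ} {g : ι → E n → A}, SymbolBound s W k (e + d) g →
      ∃ C : ℝ, ∀ i, ∀ ξ ∈ s, ‖g i ξ‖ ≤ C * W ξ ^ e := by
    intro k e g h
    obtain ⟨C, hC0, hC⟩ := h.bound_nonneg hW
    refine ⟨C * R ^ d, fun i ξ hξ => (hC i ξ hξ).trans ?_⟩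
    have hw := hW ξ hξ
    rw [zpow_add₀ hw.ne', zpow_natCast, mul_assoc, mul_comm (W ξ ^ e)]
    gcongr
    exact hR ξ hξ
  induction k with
  | zero => exact fun h => key h
  | succ k ih =>
    intro e g h
    refine ⟨key h, h.2.1, fun j => ih ?_⟩
    have := h.2.2 j
    rwa [show e + (d : ℤ) - 1 = e - 1 + d by ring] at this

theorem ofReal (hs : IsOpen s) {k : ℕ} : ∀ {e : ℤ} {g : ι → E n → ℝ}, SymbolBound s W k e g →
    SymbolBound s W k e (fun i ξ => (g i ξ : ℂ)) := by
  induction k with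
  | zero =>
    rintro e g ⟨C, hC⟩
    exact ⟨C, fun i ξ hξ => by simpa using hC i ξ hξ⟩
  | succ k ih =>
    rintro e g h
    obtain ⟨C, hC⟩ := h.1
    refine ⟨⟨C, fun i ξ hξ => by simpa using hC i ξ hξ⟩,
      fun i => Complex.ofRealCLM.differentiable.comp_differentiableOn (h.2.1 i), fun j => ?_⟩
    exact (ih (h.2.2 j)).congr hs fun i ξ hξ =>
      (pderiv_ofReal (h.differentiableAt hs i hξ) j).symm

theorem of_pderiv {k : ℕ} {e : ℤ} {g : ι → E n → A}
    (h0 : ∃ C : ℝ, ∀ i, ∀ ξ ∈ s, ‖g i ξ‖ ≤ C * W ξ ^ e) (hd : ∀ i, DifferentiableOn ℝ (g i) s)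
    (hj : ∀ j, SymbolBound s W k (e - 1) (fun i => pderiv j (g i))) :
    SymbolBound s W k e g :=
  of_succ ⟨h0, hd, hj⟩

theorem iterated_wderiv {k : ℕ} : ∀ {e : ℤ} {g : ι → E n → A} (l : List (Fin n)), l.length ≤ k →
    SymbolBound s W k e g → SymbolBound s W (k - l.length) (e - l.length)
      (fun i => wderiv l (g i)) := by
  intro e g l
  induction l using List.reverseRecOn generalizing k e g with
  | nil => intro _ h; simpa using h
  | append_singleton l j ih =>
    intro hl h
    simp only [List.length_append, List.length_singleton] at hl ⊢
    obtain ⟨k, rfl⟩ : ∃ k', k = k' + 1 := ⟨k - 1, by omega⟩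
    have h1 := ih (k := k) (by omega) (h.2.2 j)
    simp only [wderiv_append]
    rw [show k + 1 - (l.length + 1) = k - l.length by omega]
    rw [show e - ((l.length + 1 : ℕ) : ℤ) = e - 1 - l.length by push_cast; ring]
    exact h1

theorem of_wderiv (hs : IsOpen s) {k : ℕ} : ∀ {e : ℤ} {g : ι → E n → A},
    (∀ i, ContDiffOn ℝ ∞ (g i) s) → (∀ l : List (Fin n), ∃ C : ℝ, ∀ i, ∀ ξ ∈ s,
      ‖wderiv l (g i) ξ‖ ≤ C * W ξ ^ (e - l.length)) → SymbolBound s W k e g := by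
  induction k with
  | zero =>
    intro e g _ h
    simpa [SymbolBound] using h []
  | succ k ih =>
    intro e g hg h
    refine ⟨by simpa using h [], fun i => (hg i).differentiableOn (by simp), fun j => ?_⟩
    refine ih (fun i => contDiffOn_pderiv hs (hg i) j) fun l => ?_
    obtain ⟨C, hC⟩ := h (l ++ [j])
    refine ⟨C, fun i ξ hξ => ?_⟩
    have := hC i ξ hξ
    rw [wderiv_append, List.length_append, List.length_singleton,
      show e - ((l.length + 1 : ℕ) : ℤ) = e - 1 - l.length by push_cast; ring] at this
    exact this

/-- Only the gradient of h is controlled, never h itself. A derivative of e^{ih} is i h' e^{ih}, of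
order 0 by induction, which is better than the required order -1 because W is bounded. -/
theorem cexp (hs : IsOpen s) (hW : ∀ ξ ∈ s, 0 < W ξ) {R : ℝ} (hR : ∀ ξ ∈ s, W ξ ≤ R)
    {h : ι → E n → ℝ} (hd : ∀ i, DifferentiableOn ℝ (h i) s) {k : ℕ}
    (hj : ∀ j, SymbolBound s W k 0 (fun i => pderiv j (h i))) :
    SymbolBound s W k 0 (fun i ξ => Complex.exp (Complex.I * (h i ξ : ℂ))) := by
  have key : ∃ C : ℝ, ∀ i, ∀ ξ ∈ s, ‖Complex.exp (Complex.I * (h i ξ : ℂ))‖ ≤ C * W ξ ^ (0 : ℤ) :=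
    ⟨1, fun i ξ _ => by rw [mul_comm, Complex.norm_exp_ofReal_mul_I]; simp⟩
  have hdc : ∀ i, ∀ ξ ∈ s, DifferentiableAt ℝ (fun ξ => (h i ξ : ℂ)) ξ := fun i ξ hξ =>
    Complex.ofRealCLM.differentiableAt.comp ξ ((hd i).differentiableAt (hs.mem_nhds hξ))
  induction k with
  | zero => exact key
  | succ k ih =>
    refine ⟨key, fun i ξ hξ => ((hdc i ξ hξ).const_mul _).cexp.differentiableWithinAt,
      fun j => ?_⟩
    have h1 := (((ih fun j => (hj j).of_succ).mul hs hW ((hj j).of_succ.ofReal hs))).const_mul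
      hs hW Complex.I
    have h2 : SymbolBound s W k (0 - 1) (fun i ξ => Complex.I *
        (Complex.exp (Complex.I * (h i ξ : ℂ)) * ((pderiv j (h i) ξ : ℝ) : ℂ))) :=
      mono_exponent hW hR (d := 1) (by simpa using h1)
    refine h2.congr hs fun i ξ hξ => ?_
    simp only [pderiv_cexp ((hdc i ξ hξ).const_mul _)]
    have h3 := pderiv_mul (differentiableAt_const (c := Complex.I) (x := ξ)) (hdc i ξ hξ) j
    rw [h3, pderiv_const, pderiv_ofReal ((hd i).differentiableAt (hs.mem_nhds hξ))]
    ring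

end SymbolBound

end SymbolClass

/-! ### Non-stationary phase -/

section NonstationaryPhase

variable {n : ℕ} {ι : Type*} {s Z : Set (E n)}

/-- With weight 1 all powers coincide: the exponent is a dummy and the class records uniform bounds
on derivatives. -/
theorem SymbolBound.of_weight_one {A : Type*} [NormedField A] [NormedAlgebra ℝ A] {k : ℕ} :
    ∀ {e e' : ℤ} {f : ι → E n → A}, SymbolBound s (fun _ => 1) k e f →
      SymbolBound s (fun _ => 1) k e' f := by
  induction k with
  | zero =>
    rintro e e' f ⟨C, hC⟩
    exact ⟨C, fun i ξ hξ => by simpa using hC i ξ hξ⟩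
  | succ k ih =>
    rintro e e' f ⟨⟨C, hC⟩, h⟩
    exact ⟨⟨C, fun i ξ hξ => by simpa using hC i ξ hξ⟩, h.1, fun j => ih (h.2 j)⟩

theorem contDiff_of_zero_off {F : Type*} [NormedAddCommGroup F] [NormedSpace ℝ F] (hs : IsOpen s)
    (hZ : IsClosed Z) (hZs : Z ⊆ s) {f : E n → F} (hf : ContDiffOn ℝ ∞ f s)
    (h0 : ∀ ξ ∉ Z, f ξ = 0) : ContDiff ℝ ∞ f := by
  rw [contDiff_iff_contDiffAt]
  intro ξ
  by_cases hξ : ξ ∈ Z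
  · exact hf.contDiffAt (hs.mem_nhds (hZs hξ))
  · have : f =ᶠ[nhds ξ] fun _ => 0 := by
      filter_upwards [hZ.isOpen_compl.mem_nhds hξ] with y hy using h0 y hy
    exact contDiffAt_const.congr_of_eventuallyEq this

theorem wderiv_zero_off {F : Type*} [NormedAddCommGroup F] [NormedSpace ℝ F] (hZ : IsClosed Z)
    {f : E n → F} (h0 : ∀ ξ ∉ Z, f ξ = 0) (l : List (Fin n)) : ∀ ξ ∉ Z, wderiv l f ξ = 0 := by
  induction l with
  | nil => exact h0
  | cons j l ih =>
    intro ξ hξ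
    have h1 : Set.EqOn (wderiv l f) (fun _ => 0) Zᶜ := fun y hy => ih y hy
    rw [wderiv_cons, pderiv_congr hZ.isOpen_compl h1 j hξ]
    simp [pderiv]

theorem integral_pderiv_eq_zero {f : E n → ℂ} (hf : ContDiff ℝ ∞ f) (hc : HasCompactSupport f)
    (j : Fin n) : ∫ ξ, pderiv j f ξ = 0 := by
  have hd : Differentiable ℝ f := hf.differentiable (by simp)
  have hcont : Continuous (pderiv j f) :=
    ((hf.continuous_fderiv (by simp)).clm_apply continuous_const)
  have hint : Integrable (pderiv j f) :=
    hcont.integrable_of_hasCompactSupport (hc.fderiv_apply (𝕜 := ℝ) (basisVec j))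
  have hint' : Integrable (fun ξ => fderiv ℝ f ξ (basisVec j)) := hint
  -- Integration by parts against the constant function 1.
  have h := integral_smul_fderiv_eq_neg_fderiv_smul_of_integrable (𝕜 := ℝ) (μ := volume)
    (f := fun _ : E n => (1 : ℝ)) (g := f) (v := basisVec j) (by simp)
    (by simpa using hint')
    (by simpa using hf.continuous.integrable_of_hasCompactSupport hc)
    (fun _ _ => differentiableAt_const _) (fun ξ _ => hd ξ)
  simpa [pderiv] using h

theorem symbolBound_of_compactSupport (hs : IsOpen s) {χ : E n → ℂ} (hχ : ContDiff ℝ ∞ χ)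
    (hc : HasCompactSupport χ) (k : ℕ) :
    SymbolBound s (fun _ => 1) k 0 (fun _ : ι => χ) := by
  refine SymbolBound.of_wderiv hs (fun _ => hχ.contDiffOn) fun l => ?_
  have h1 : Continuous (wderiv l χ) := by
    have := (contDiffOn_wderiv isOpen_univ hχ.contDiffOn l).continuousOn
    rwa [← continuousOn_univ]
  have h2 : HasCompactSupport (wderiv l χ) :=
    HasCompactSupport.intro (K := tsupport χ) hc
      (wderiv_zero_off (isClosed_tsupport χ) (fun ξ hξ => image_eq_zero_of_notMem_tsupport hξ) l)
  obtain ⟨C, hC⟩ := h1.bounded_above_of_compact_support h2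
  exact ⟨C, fun i ξ _ => by simpa using hC ξ⟩

/-- One integration by parts against `e^{iτΨ}` using the vector field `∇Ψ / |∇Ψ|²`. -/
theorem exists_integration_by_parts (hs : IsOpen s) (hZ : IsCompact Z) (hZs : Z ⊆ s)
    {Ψ : ι → E n → ℝ} (hΨ : ∀ i, ContDiffOn ℝ ∞ (Ψ i) s)
    (hb : ∀ k j, SymbolBound s (fun _ => 1) k 0 (fun i => pderiv j (Ψ i))) {c : ℝ} (hc : 0 < c)
    (hlow : ∀ i, ∀ ξ ∈ s, c ≤ ∑ j, pderiv j (Ψ i) ξ ^ 2)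
    {g : ι → E n → ℂ} (hg : ∀ i, ContDiff ℝ ∞ (g i)) (hg0 : ∀ i, ∀ ξ ∉ Z, g i ξ = 0)
    (hgb : ∀ k, SymbolBound s (fun _ => 1) k 0 g) :
    ∃ g' : ι → E n → ℂ, (∀ i, ContDiff ℝ ∞ (g' i)) ∧ (∀ i, ∀ ξ ∉ Z, g' i ξ = 0) ∧
      (∀ k, SymbolBound s (fun _ => 1) k 0 g') ∧
      ∀ i, ∀ τ : ℝ, 0 < τ → ‖∫ ξ, g i ξ * Complex.exp (Complex.I * ((τ * Ψ i ξ : ℝ) : ℂ))‖ =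
        τ⁻¹ * ‖∫ ξ, g' i ξ * Complex.exp (Complex.I * ((τ * Ψ i ξ : ℝ) : ℂ))‖ := by
  have hW : ∀ ξ ∈ s, (0 : ℝ) < (fun _ : E n => (1 : ℝ)) ξ := fun _ _ => one_pos
  set D : ι → E n → ℝ := fun i ξ => ∑ j, pderiv j (Ψ i) ξ ^ 2 with hD
  -- Normalised so that ∑ w_j ∂_jΨ = 1, hence ∑ w_j ∂_j reproduces e^{iτΨ} up to the factor iτ.
  set w : Fin n → ι → E n → ℂ := fun j i ξ => ((pderiv j (Ψ i) ξ * (D i ξ)⁻¹ : ℝ) : ℂ) with hw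
  have hDne : ∀ i, ∀ ξ ∈ s, D i ξ ≠ 0 := fun i ξ hξ => (hc.trans_le (hlow i ξ hξ)).ne'
  have hDb : ∀ k, SymbolBound s (fun _ => 1) k 0 D := fun k =>
    SymbolBound.sum hs _ fun j _ => by
      have := (hb k j).mul hs hW (hb k j)
      simpa only [pow_two, zero_add] using this
  have hwb : ∀ k j, SymbolBound s (fun _ => 1) k 0 (w j) := fun k j => by
    have h1 := (hDb k).inv hs hW hc (fun i ξ hξ => by
      have := hlow i ξ hξ
      simpa using this.trans (le_abs_self _))
    have h2 := (hb k j).mul hs hW h1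
    exact (by simpa using h2 : SymbolBound s (fun _ => 1) k 0
      (fun i ξ => pderiv j (Ψ i) ξ * (D i ξ)⁻¹)).ofReal hs
  have hpd : ∀ j i, ContDiffOn ℝ ∞ (pderiv j (Ψ i)) s := fun j i =>
    contDiffOn_pderiv hs (hΨ i) j
  have hwd : ∀ j i, ContDiffOn ℝ ∞ (w j i) s := fun j i => by
    have h1 : ContDiffOn ℝ ∞ (D i) s := ContDiffOn.sum fun j _ => (hpd j i).pow 2
    exact Complex.ofRealCLM.contDiff.comp_contDiffOn ((hpd j i).mul (h1.inv (hDne i)))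
  have hgw : ∀ j i, ContDiff ℝ ∞ (fun ξ => g i ξ * w j i ξ) := fun j i =>
    contDiff_of_zero_off hs hZ.isClosed hZs ((hg i).contDiffOn.mul (hwd j i))
      fun ξ hξ => by simp [hg0 i ξ hξ]
  -- The new amplitude is the divergence of g w. It consumes one derivative of g, which is why
  -- bounds of every order k are carried along.
  refine ⟨fun i ξ => ∑ j, pderiv j (fun ξ => g i ξ * w j i ξ) ξ, fun i => ?_, fun i ξ hξ => ?_,
    fun k => ?_, fun i τ hτ => ?_⟩
  · refine ContDiff.sum fun j _ => ?_
    rw [← contDiffOn_univ]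
    exact contDiffOn_pderiv isOpen_univ (hgw j i).contDiffOn j
  · refine Finset.sum_eq_zero fun j _ => ?_
    exact wderiv_zero_off hZ.isClosed (fun ξ hξ => by simp [hg0 i ξ hξ]) [j] ξ hξ
  · refine SymbolBound.sum hs _ fun j _ => ?_
    have h1 := ((hgb (k + 1)).mul hs hW (hwb (k + 1) j)).2.2 j
    exact h1.of_weight_one
  · set P : E n → ℂ := fun ξ => Complex.exp (Complex.I * ((τ * Ψ i ξ : ℝ) : ℂ)) with hP
    have hPs : ContDiffOn ℝ ∞ P s :=
      (contDiffOn_const.mul (Complex.ofRealCLM.contDiff.comp_contDiffOn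
        (contDiffOn_const.mul (hΨ i)))).cexp
    have hG : ∀ j, ContDiff ℝ ∞ (fun ξ => g i ξ * w j i ξ * P ξ) := fun j =>
      contDiff_of_zero_off hs hZ.isClosed hZs ((hgw j i).contDiffOn.mul hPs)
        fun ξ hξ => by simp [hg0 i ξ hξ]
    have hGc : ∀ j, HasCompactSupport (fun ξ => g i ξ * w j i ξ * P ξ) := fun j =>
      HasCompactSupport.intro hZ fun ξ hξ => by simp [hg0 i ξ hξ]
    -- div(g w e^{iτΨ}) = div(g w) e^{iτΨ} + iτ g e^{iτΨ}, and the left side integrates to zero.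
    have hpt : ∀ ξ, ∑ j, pderiv j (fun ξ => g i ξ * w j i ξ * P ξ) ξ =
        (∑ j, pderiv j (fun ξ => g i ξ * w j i ξ) ξ) * P ξ +
          (Complex.I * τ) * (g i ξ * P ξ) := by
      intro ξ
      by_cases hξ : ξ ∈ s
      · have hΨd : DifferentiableAt ℝ (Ψ i) ξ :=
          ((hΨ i).contDiffAt (hs.mem_nhds hξ)).differentiableAt (by simp)
        have hτd : DifferentiableAt ℝ (fun ξ => ((τ * Ψ i ξ : ℝ) : ℂ)) ξ :=
          Complex.ofRealCLM.differentiableAt.comp ξ (hΨd.const_mul τ)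
        have hPd : DifferentiableAt ℝ P ξ := (hτd.const_mul _).cexp
        have hPp : ∀ j, pderiv j P ξ = Complex.I * τ * (pderiv j (Ψ i) ξ : ℝ) * P ξ := by
          intro j
          rw [hP, pderiv_cexp (hτd.const_mul _) j,
            pderiv_mul (differentiableAt_const Complex.I) hτd j, pderiv_const,
            pderiv_ofReal (hΨd.const_mul τ),
            pderiv_mul (differentiableAt_const τ) hΨd j, pderiv_const]
          push_cast
          ring
        have h1 : ∀ j, pderiv j (fun ξ => g i ξ * w j i ξ * P ξ) ξ =
            pderiv j (fun ξ => g i ξ * w j i ξ) ξ * P ξ +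
              Complex.I * τ * (g i ξ * P ξ) * (w j i ξ * (pderiv j (Ψ i) ξ : ℝ)) := by
          intro j
          rw [pderiv_mul ((hgw j i).differentiable (by simp) ξ) hPd j, hPp j]
          ring
        have h2 : ∑ j, w j i ξ * ((pderiv j (Ψ i) ξ : ℝ) : ℂ) = 1 := by
          simp only [hw]
          rw [← Complex.ofReal_one, ← mul_inv_cancel₀ (hDne i ξ hξ)]
          simp only [← Complex.ofReal_mul]
          rw [← Complex.ofReal_sum]
          congr 1
          simp only [hD, Finset.sum_mul]
          refine Finset.sum_congr rfl fun j _ => ?_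
          ring
        rw [Finset.sum_congr rfl fun j _ => h1 j, Finset.sum_add_distrib, ← Finset.sum_mul,
          ← Finset.mul_sum, h2, mul_one]
      · have hξZ : ξ ∉ Z := fun h => hξ (hZs h)
        rw [Finset.sum_eq_zero fun j _ => ?_, Finset.sum_eq_zero fun j _ => ?_, hg0 i ξ hξZ]
        · simp
        · exact wderiv_zero_off hZ.isClosed (fun ξ hξ => by simp [hg0 i ξ hξ]) [j] ξ hξZ
        · exact wderiv_zero_off hZ.isClosed (fun ξ hξ => by simp [hg0 i ξ hξ]) [j] ξ hξZ
    have hint0 : ∫ ξ, ∑ j, pderiv j (fun ξ => g i ξ * w j i ξ * P ξ) ξ = 0 := by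
      rw [integral_finsetSum]
      · exact Finset.sum_eq_zero fun j _ => integral_pderiv_eq_zero (hG j) (hGc j) j
      · intro j _
        exact (((hG j).continuous_fderiv (by simp)).clm_apply
          continuous_const).integrable_of_hasCompactSupport
          ((hGc j).fderiv_apply (𝕜 := ℝ) (basisVec j))
    have hi2 : Integrable (fun ξ => g i ξ * P ξ) := by
      have : ContDiff ℝ ∞ (fun ξ => g i ξ * P ξ) :=
        contDiff_of_zero_off hs hZ.isClosed hZs ((hg i).contDiffOn.mul hPs)
          fun ξ hξ => by simp [hg0 i ξ hξ]
      exact this.continuous.integrable_of_hasCompactSupport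
        (HasCompactSupport.intro hZ fun ξ hξ => by simp [hg0 i ξ hξ])
    have hi1 : Integrable (fun ξ => (∑ j, pderiv j (fun ξ => g i ξ * w j i ξ) ξ) * P ξ) := by
      have h1 : ContDiff ℝ ∞ (fun ξ => ∑ j, pderiv j (fun ξ => g i ξ * w j i ξ) ξ) := by
        refine ContDiff.sum fun j _ => ?_
        rw [← contDiffOn_univ]
        exact contDiffOn_pderiv isOpen_univ (hgw j i).contDiffOn j
      have h0 : ∀ ξ ∉ Z, (∑ j, pderiv j (fun ξ => g i ξ * w j i ξ) ξ) = 0 := fun ξ hξ =>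
        Finset.sum_eq_zero fun j _ =>
          wderiv_zero_off hZ.isClosed (fun ξ hξ => by simp [hg0 i ξ hξ]) [j] ξ hξ
      have : ContDiff ℝ ∞ (fun ξ => (∑ j, pderiv j (fun ξ => g i ξ * w j i ξ) ξ) * P ξ) :=
        contDiff_of_zero_off hs hZ.isClosed hZs (h1.contDiffOn.mul hPs)
          fun ξ hξ => by simp [h0 ξ hξ]
      exact this.continuous.integrable_of_hasCompactSupport
        (HasCompactSupport.intro hZ fun ξ hξ => by simp [h0 ξ hξ])
    simp only [hpt] at hint0
    rw [integral_add hi1 (hi2.const_mul _), integral_const_mul] at hint0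
    have h4 : (∫ ξ, (∑ j, pderiv j (fun ξ => g i ξ * w j i ξ) ξ) * P ξ) =
        -((Complex.I * τ) * ∫ ξ, g i ξ * P ξ) := eq_neg_of_add_eq_zero_left hint0
    rw [h4, norm_neg, norm_mul, norm_mul, Complex.norm_I, one_mul, Complex.norm_real,
      Real.norm_of_nonneg hτ.le]
    field_simp
    rfl

/-- Rapid decay of oscillatory integrals without stationary points, uniformly over a family of
phases. -/
theorem exists_nonstationary_bound (hs : IsOpen s) {Ψ : ι → E n → ℝ}
    (hΨ : ∀ i, ContDiffOn ℝ ∞ (Ψ i) s)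
    (hb : ∀ k j, SymbolBound s (fun _ => 1) k 0 (fun i => pderiv j (Ψ i))) {c : ℝ} (hc : 0 < c)
    (hlow : ∀ i, ∀ ξ ∈ s, c ≤ ∑ j, pderiv j (Ψ i) ξ ^ 2)
    {χ : E n → ℂ} (hχ : ContDiff ℝ ∞ χ) (hχc : HasCompactSupport χ) (hχs : tsupport χ ⊆ s)
    (M : ℕ) :
    ∃ C : ℝ, 0 ≤ C ∧ ∀ i, ∀ τ : ℝ, 0 < τ →
      ‖∫ ξ, χ ξ * Complex.exp (Complex.I * ((τ * Ψ i ξ : ℝ) : ℂ))‖ ≤ C * (τ⁻¹) ^ M := by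
  have key : ∃ g : ι → E n → ℂ, (∀ i, ContDiff ℝ ∞ (g i)) ∧
      (∀ i, ∀ ξ ∉ tsupport χ, g i ξ = 0) ∧
      (∀ k, SymbolBound s (fun _ => 1) k 0 g) ∧ ∀ i, ∀ τ : ℝ, 0 < τ →
        ‖∫ ξ, χ ξ * Complex.exp (Complex.I * ((τ * Ψ i ξ : ℝ) : ℂ))‖ =
        (τ⁻¹) ^ M * ‖∫ ξ, g i ξ * Complex.exp (Complex.I * ((τ * Ψ i ξ : ℝ) : ℂ))‖ := by
    induction M with
    | zero =>
      exact ⟨fun _ => χ, fun _ => hχ, fun _ ξ hξ => image_eq_zero_of_notMem_tsupport hξ,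
        fun k => symbolBound_of_compactSupport hs hχ hχc k, fun i τ _ => by simp⟩
    | succ M ih =>
      obtain ⟨g, h1, h2, h3, h4⟩ := ih
      obtain ⟨g', k1, k2, k3, k4⟩ :=
        exists_integration_by_parts hs hχc hχs hΨ hb hc hlow h1 h2 h3
      refine ⟨g', k1, k2, k3, fun i τ hτ => ?_⟩
      rw [h4 i τ hτ, k4 i τ hτ, pow_succ, mul_assoc]
  obtain ⟨g, -, h2, h3, h4⟩ := key
  obtain ⟨C, hC0, hC⟩ := (h3 0).bound_nonneg (fun _ _ => one_pos)
  refine ⟨C * volume.real (tsupport χ), by positivity, fun i τ hτ => ?_⟩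
  rw [h4 i τ hτ, mul_comm]
  gcongr
  rw [← setIntegral_eq_integral_of_forall_compl_eq_zero (s := tsupport χ)
    (fun ξ hξ => by simp [h2 i ξ hξ])]
  refine norm_setIntegral_le_of_norm_le_const hχc.measure_lt_top fun ξ hξ => ?_
  rw [norm_mul, mul_comm Complex.I, Complex.norm_exp_ofReal_mul_I, mul_one]
  simpa using hC i ξ (hχs hξ)

end NonstationaryPhase

/-! ### Hadamard's global inverse function theorem -/

section GlobalInverse

variable {V : Type*} [NormedAddCommGroup V] [NormedSpace ℝ V] [FiniteDimensional ℝ V]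

theorem exists_equiv_of_bound_below {A : V →L[ℝ] V} {C : ℝ} (h : ∀ v, ‖v‖ ≤ C * ‖A v‖) :
    ∃ e : V ≃L[ℝ] V, (e : V →L[ℝ] V) = A := by
  have hinj : Function.Injective (A : V →ₗ[ℝ] V) := by
    rw [← LinearMap.ker_eq_bot, LinearMap.ker_eq_bot']
    intro v hv
    have h1 := h v
    rw [show A v = 0 from hv, norm_zero, mul_zero] at h1
    exact norm_le_zero_iff.1 h1
  refine ⟨(LinearEquiv.ofInjectiveEndo (A : V →ₗ[ℝ] V) hinj).toContinuousLinearEquiv, ?_⟩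
  ext v
  rfl

/-- A segment lifts through a smooth map whose derivative is uniformly bounded below. -/
theorem exists_lift_segment {G : V → V} (hG : ContDiff ℝ ∞ G) {C : ℝ} (hC : 0 ≤ C)
    (hb : ∀ x v, ‖v‖ ≤ C * ‖fderiv ℝ G x v‖) (x₀ w : V) :
    ∃ γ : ℝ → V, γ 0 = x₀ ∧ ContinuousOn γ (Set.Icc 0 1) ∧
      (∀ t ∈ Set.Icc (0 : ℝ) 1, G (γ t) = G x₀ + t • w) ∧ ‖γ 1 - x₀‖ ≤ C * ‖w‖ := by
  have : CompleteSpace V := FiniteDimensional.complete ℝ V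
  -- Along the flow of f(x) = DG(x)⁻¹ w the image under G moves with constant velocity w, and the
  -- speed of the flow is at most C‖w‖.
  set f : V → V := fun x => (fderiv ℝ G x).inverse w with hf
  have hGf : ∀ x, fderiv ℝ G x (f x) = w := fun x => by
    obtain ⟨e, he⟩ := exists_equiv_of_bound_below (hb x)
    simp only [hf, ← he, ContinuousLinearMap.inverse_equiv]
    exact e.apply_symm_apply w
  have hfb : ∀ x, ‖f x‖ ≤ C * ‖w‖ := fun x => by
    have := hb x (f x)
    rwa [hGf] at this
  have hfs : ContDiff ℝ 1 f := by
    rw [contDiff_iff_contDiffAt]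
    intro x
    obtain ⟨e, he⟩ := exists_equiv_of_bound_below (hb x)
    have h1 : ContDiffAt ℝ 1 (fderiv ℝ G) x :=
      ((hG.fderiv_right (m := ∞) (by simp)).of_le
        (ENat.one_le_iff_ne_zero_withTop.2 (by simp))).contDiffAt
    have h2 : ContDiffAt ℝ 1 ContinuousLinearMap.inverse (fderiv ℝ G x) := by
      rw [← he]
      exact contDiffAt_map_inverse e
    exact (h2.comp x h1).clm_apply contDiffAt_const
  -- In unit time the flow travels at most C‖w‖, so Picard–Lindelöf on the ball of this radius gives
  -- a solution on all of [0, 1].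
  set a : ℝ≥0 := ⟨C * ‖w‖, by positivity⟩ with ha
  obtain ⟨K, hK⟩ := (hfs.contDiffOn (s := Metric.closedBall x₀ a)).exists_lipschitzOnWith (by simp)
    (convex_closedBall _ _) (isCompact_closedBall _ _)
  have hpl : IsPicardLindelof (fun _ => f) (tmin := 0) (tmax := 1) ⟨0, by simp⟩ x₀ a 0 a K :=
    IsPicardLindelof.of_time_independent (fun x _ => hfb x) hK (by simp)
  obtain ⟨γ, h0, hγ⟩ := hpl.exists_eq_forall_mem_Icc_hasDerivWithinAt₀
  have hcont : ContinuousOn γ (Set.Icc 0 1) := fun t ht => (hγ t ht).continuousWithinAt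
  refine ⟨γ, h0, hcont, fun t ht => ?_, ?_⟩
  · have hd : ∀ t ∈ Set.Icc (0 : ℝ) 1,
        HasDerivWithinAt (fun t => G (γ t) - t • w) 0 (Set.Icc 0 1) t := by
      intro t ht
      have h1 := ((hG.differentiable (by simp) (γ t)).hasFDerivAt).comp_hasDerivWithinAt t (hγ t ht)
      have h2 : HasDerivWithinAt (fun t : ℝ => t • w) ((1 : ℝ) • w) (Set.Icc 0 1) t :=
        (hasDerivAt_id t).hasDerivWithinAt.smul_const w
      have h3 := h1.sub h2
      rwa [hGf, one_smul, sub_self] at h3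
    have h4 := (convex_Icc (0 : ℝ) 1).is_const_of_fderivWithin_eq_zero (𝕜 := ℝ)
      (f := fun t => G (γ t) - t • w) (fun t ht => (hd t ht).differentiableWithinAt)
      (fun t ht => by
        have := (hd t ht).hasFDerivWithinAt.fderivWithin (uniqueDiffOn_Icc one_pos t ht)
        rw [this]
        ext
        simp) ht (Set.left_mem_Icc.2 zero_le_one)
    simp only [zero_smul, sub_zero] at h4
    rw [← sub_eq_iff_eq_add, h4]
    exact congrArg G h0
  · have := norm_image_sub_le_of_norm_deriv_le_segment_01' (f := γ) (C := C * ‖w‖) hγ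
      (fun t _ => hfb _)
    rwa [show γ 0 = x₀ from h0] at this

/-- **Hadamard's global inverse function theorem**, quantitative injectivity: a smooth map whose
derivative is uniformly bounded below is itself bounded below. -/
theorem norm_sub_le_of_fderiv_bound_below {G : V → V} (hG : ContDiff ℝ ∞ G) {C : ℝ} (hC : 0 ≤ C)
    (hb : ∀ x v, ‖v‖ ≤ C * ‖fderiv ℝ G x v‖) (x y : V) : ‖x - y‖ ≤ C * ‖G x - G y‖ := by
  have : CompleteSpace V := FiniteDimensional.complete ℝ V
  -- For every z, lift the segment from G y to G z starting at y. The endpoint map z ↦ γ z 1 lifts G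
  -- through G; once continuous it must be the identity, and the bound on the lifted displacement
  -- for z = x is the claim.
  choose γ h0 hcont hl hn using fun z => exists_lift_segment hG hC hb y (G z - G y)
  have hloc : IsLocalHomeomorph G := by
    refine IsLocalHomeomorph.mk G fun z => ?_
    obtain ⟨e, he⟩ := exists_equiv_of_bound_below (hb z)
    have hz : HasStrictFDerivAt G (e : V →L[ℝ] V) z := by
      rw [he]
      exact hG.contDiffAt.hasStrictFDerivAt (by simp)
    exact ⟨hz.toOpenPartialHomeomorph G, hz.mem_toOpenPartialHomeomorph_source, fun _ _ => rfl⟩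
  have hsep : IsSeparatedMap G := T2Space.isSeparatedMap G
  let f : C(unitInterval × V, V) :=
    ⟨fun q => G y + (q.1 : ℝ) • (G q.2 - G y), by
      have := hG.continuous
      fun_prop⟩
  let g : unitInterval × V → V := fun q => γ q.2 q.1
  -- Path lifts through a separated local homeomorphism depend continuously on z as soon as their
  -- starting points do.
  have hg : Continuous g := hloc.continuous_lift hsep f
    (by
      funext q
      exact hl q.2 q.1 q.1.2)
    (by
      simp only [g]
      have : (fun z => γ z ((0 : unitInterval) : ℝ)) = fun _ => y := by
        funext z
        simpa using h0 z
      rw [this]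
      exact continuous_const)
    (fun z => (hcont z).comp_continuous continuous_subtype_val fun t => t.2)
  -- Two lifts of G on a connected space, both sending y to y.
  have hend : (fun z => g (1, z)) = id := by
    refine hsep.eq_of_comp_eq hloc.isLocallyInjective (hg.comp (by fun_prop)) continuous_id ?_ y ?_
    · funext z
      have := hl z 1 (by simp)
      simp only [g, Function.comp, id, Set.Icc.coe_one]
      rw [this]
      simp
    · have h1 := hn y
      simp only [sub_self, norm_zero, mul_zero] at h1
      simpa [g, sub_eq_zero] using h1
  have h2 : γ x 1 = x := by simpa [g] using congrFun hend x
  have h3 := hn x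
  rwa [h2] at h3

end GlobalInverse

/-! ### Quantitative invertibility of matrices -/

section MatrixBound

/-- If all entries of a matrix are bounded by `B` and `|det A| ≥ c`, then `A` is bounded below. -/
theorem exists_mulVec_bound_below (n : ℕ) (B c : ℝ) (hc : 0 < c) :
    ∃ C : ℝ, 0 ≤ C ∧ ∀ A : Matrix (Fin n) (Fin n) ℝ, (∀ i j, |A i j| ≤ B) → c ≤ |A.det| →
      ∀ v : Fin n → ℝ, ‖v‖ ≤ C * ‖A.mulVec v‖ := by
  -- Adjugate entries are determinants with one row replaced by a unit vector, hence the maximum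
  -- with 1; each is at most n! Dⁿ. The bound then comes from adj(A) A v = det(A) v.
  set D : ℝ := max B 1 with hD
  have hD1 : 1 ≤ D := le_max_right _ _
  refine ⟨c⁻¹ * (n * ((n.factorial : ℝ) * D ^ n)), by positivity, fun A hA hdet v => ?_⟩
  have hadj : ∀ i j, |A.adjugate i j| ≤ (n.factorial : ℝ) * D ^ n := by
    intro i j
    rw [Matrix.adjugate_apply]
    have := Matrix.det_le (A := A.updateRow j (Pi.single i 1)) (abv := AbsoluteValue.abs)
      (x := D) (fun k l => by
        by_cases hk : k = j
        · subst hk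
          rw [Matrix.updateRow_self]
          by_cases hl : l = i
          · subst hl; simpa using hD1
          · simp only [Pi.single_apply, if_neg hl]
            simpa using zero_le_one.trans hD1
        · rw [Matrix.updateRow_ne hk]
          exact (hA k l).trans (le_max_left _ _))
    simpa using this
  have hdet0 : 0 < |A.det| := hc.trans_le hdet
  have h1 : A.adjugate.mulVec (A.mulVec v) = A.det • v := by
    rw [Matrix.mulVec_mulVec, Matrix.adjugate_mul, Matrix.smul_mulVec, Matrix.one_mulVec]
  have h2 : ‖A.det • v‖ ≤ n * ((n.factorial : ℝ) * D ^ n) * ‖A.mulVec v‖ := by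
    rw [← h1, pi_norm_le_iff_of_nonneg (by positivity)]
    intro i
    calc ‖A.adjugate.mulVec (A.mulVec v) i‖ ≤ ∑ j, ‖A.adjugate i j * A.mulVec v j‖ := by
          simp only [Matrix.mulVec, dotProduct]
          exact norm_sum_le _ _
      _ ≤ ∑ _j : Fin n, ((n.factorial : ℝ) * D ^ n) * ‖A.mulVec v‖ := by
          refine Finset.sum_le_sum fun j _ => ?_
          rw [norm_mul]
          exact mul_le_mul (hadj i j) (norm_le_pi_norm _ j) (norm_nonneg _) (by positivity)
      _ = _ := by simp; ring
  rw [norm_smul, Real.norm_eq_abs] at h2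
  have h3 : c * ‖v‖ ≤ n * ((n.factorial : ℝ) * D ^ n) * ‖A.mulVec v‖ :=
    (mul_le_mul_of_nonneg_right hdet (norm_nonneg _)).trans h2
  rw [mul_assoc, ← div_eq_inv_mul, le_div_iff₀ hc]
  linarith

end MatrixBound

/-! ### The T T* argument with Schur's test -/

section TTStar

variable {X Ξ : Type*} [MeasurableSpace X] [MeasurableSpace Ξ] {ν : Measure X} {lam : Measure Ξ}

theorem lintegral_mul_sq_le {μ : Measure X} {f g : X → ℝ≥0∞} (hf : AEMeasurable f μ)
    (hg : AEMeasurable g μ) :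
    (∫⁻ x, f x * g x ∂μ) ^ 2 ≤ (∫⁻ x, f x ^ 2 ∂μ) * ∫⁻ x, g x ^ 2 ∂μ := by
  have h := ENNReal.lintegral_mul_le_Lp_mul_Lq μ Real.HolderConjugate.two_two hf hg
  simp only [Pi.mul_apply, ENNReal.rpow_ofNat] at h
  refine (pow_le_pow_left₀ (zero_le) h 2).trans (le_of_eq ?_)
  rw [mul_pow, ← ENNReal.rpow_natCast, ← ENNReal.rpow_natCast, ← ENNReal.rpow_mul,
    ← ENNReal.rpow_mul]
  norm_num

theorem integral_mul_integral_swap [SFinite ν] [SFinite lam] {f : X → ℂ} (hf : Integrable f ν)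
    {h : Ξ → ℂ} (hh : Integrable h lam) {m : X → Ξ → ℂ} (hm : Measurable (Function.uncurry m))
    (hb : ∀ x ξ, ‖m x ξ‖ ≤ 1) :
    ∫ x, f x * ∫ ξ, m x ξ * h ξ ∂lam ∂ν = ∫ ξ, (∫ x, f x * m x ξ ∂ν) * h ξ ∂lam := by
  have hint : Integrable (Function.uncurry fun x ξ => f x * (m x ξ * h ξ)) (ν.prod lam) := by
    have h1 := (hf.mul_prod hh).bdd_mul hm.aestronglyMeasurable
      (ae_of_all _ fun z => hb z.1 z.2)
    refine h1.congr (ae_of_all _ fun z => ?_)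
    simp only [Function.uncurry]
    ring
  have h2 := integral_integral_swap hint
  simp only [integral_const_mul] at h2
  rw [h2]
  refine integral_congr_ae (ae_of_all _ fun ξ => ?_)
  simp only
  rw [← integral_mul_const]
  refine integral_congr_ae (ae_of_all _ fun x => ?_)
  simp only
  ring

theorem aestronglyMeasurable_integral_mul [SFinite lam] {h : Ξ → ℂ}
    (hh : AEStronglyMeasurable h lam) {m : X → Ξ → ℂ} (hm : Measurable (Function.uncurry m)) :
    AEStronglyMeasurable (fun x => ∫ ξ, m x ξ * h ξ ∂lam) ν := by
  have h1 : ∀ x, ∫ ξ, m x ξ * h ξ ∂lam = ∫ ξ, m x ξ * hh.mk h ξ ∂lam := fun x => by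
    refine integral_congr_ae ?_
    filter_upwards [hh.ae_eq_mk] with ξ hξ
    rw [← hξ]
  simp only [h1]
  have h2 : StronglyMeasurable (Function.uncurry fun x ξ => m x ξ * hh.mk h ξ) :=
    (hm.mul (hh.stronglyMeasurable_mk.measurable.comp measurable_snd)).stronglyMeasurable
  exact h2.integral_prod_right.aestronglyMeasurable

/-- The `T T*` argument with Schur's test. The operator `v ↦ ∫ e(x, ξ) v(ξ) dξ` is bounded in `L²`
on functions supported in `Ω`, if the kernel of `T χ T*` satisfies Schur bounds for some `χ ≥ 1_Ω`. -/
theorem lintegral_sq_le_of_kernel_bound [SigmaFinite ν] [SFinite lam] {e : X → Ξ → ℂ}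
    (he : Measurable (Function.uncurry e)) (hb : ∀ x ξ, ‖e x ξ‖ ≤ 1) {χ : Ξ → ℝ}
    (hχ0 : ∀ ξ, 0 ≤ χ ξ) (hχi : Integrable χ lam) {Ω : Set Ξ} (hΩ : ∀ ξ ∈ Ω, 1 ≤ χ ξ)
    {κ : X → X → ℝ≥0∞} (hκm : Measurable (Function.uncurry κ))
    (hκ : ∀ x y, ‖∫ ξ, (starRingEnd ℂ) (e y ξ) * (χ ξ * e x ξ) ∂lam‖ₑ ≤ κ x y)
    {A : ℝ≥0∞} (hA1 : ∀ x, ∫⁻ y, κ x y ∂ν ≤ A) (hA2 : ∀ y, ∫⁻ x, κ x y ∂ν ≤ A)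
    {v : Ξ → ℂ} (hv : Integrable v lam) (hv0 : ∀ ξ ∉ Ω, v ξ = 0) :
    ∫⁻ x, ‖∫ ξ, e x ξ * v ξ ∂lam‖ₑ ^ 2 ∂ν ≤ 2 * A * ∫⁻ ξ, ‖v ξ‖ₑ ^ 2 ∂lam := by
  set h : X → ℂ := fun x => ∫ ξ, e x ξ * v ξ ∂lam with hh
  have hhm : AEStronglyMeasurable h ν := aestronglyMeasurable_integral_mul hv.1 he
  have hhb : ∀ x, ‖h x‖ ≤ ∫ ξ, ‖v ξ‖ ∂lam := fun x => by
    refine (norm_integral_le_integral_norm _).trans (integral_mono_of_nonneg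
      (ae_of_all _ fun _ => norm_nonneg _) hv.norm (ae_of_all _ fun ξ => ?_))
    simp only [norm_mul]
    exact mul_le_of_le_one_left (norm_nonneg _) (hb x ξ)
  have hec : Measurable (Function.uncurry fun x ξ => (starRingEnd ℂ) (e x ξ)) :=
    Complex.continuous_conj.measurable.comp he
  have hecb : ∀ x ξ, ‖(starRingEnd ℂ) (e x ξ)‖ ≤ 1 := fun x ξ => by simpa using hb x ξ
  -- Over a set of finite measure the left side is finite, so that a factor of it can be cancelled
  -- at the end; exhaustion gives the general case.
  have main : ∀ S : Set X, MeasurableSet S → ν S < ⊤ →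
      ∫⁻ x in S, ‖h x‖ₑ ^ 2 ∂ν ≤ 2 * A * ∫⁻ ξ, ‖v ξ‖ₑ ^ 2 ∂lam := by
    intro S hS hSf
    set g : X → ℂ := S.indicator h with hg
    have hgi : Integrable g ν := by
      rw [hg, integrable_indicator_iff hS]
      have : IsFiniteMeasure (ν.restrict S) := ⟨by simpa using hSf⟩
      exact Integrable.of_bound hhm.restrict _ (ae_of_all _ hhb)
    have hgci : Integrable (fun x => (starRingEnd ℂ) (g x)) ν :=
      (hgi.norm.mono' (Complex.continuous_conj.comp_aestronglyMeasurable hgi.1)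
        (ae_of_all _ fun x => by simp))
    set I : ℝ≥0∞ := ∫⁻ x, ‖g x‖ₑ ^ 2 ∂ν with hI
    have hIeq : ∫⁻ x in S, ‖h x‖ₑ ^ 2 ∂ν = I := by
      rw [hI, ← lintegral_indicator hS]
      refine lintegral_congr fun x => ?_
      by_cases hx : x ∈ S <;> simp [hg, hx]
    have hIfin : I < ⊤ := by
      rw [← hIeq]
      refine (setLIntegral_mono (g := fun _ => ENNReal.ofReal (∫ ξ, ‖v ξ‖ ∂lam) ^ 2)
        measurable_const fun x _ => ?_).trans_lt ?_
      · gcongr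
        rw [← ofReal_norm]
        exact ENNReal.ofReal_le_ofReal (hhb x)
      · rw [setLIntegral_const]
        exact ENNReal.mul_lt_top (by simp) hSf
    set H : Ξ → ℂ := fun ξ => ∫ x, (starRingEnd ℂ) (g x) * e x ξ ∂ν with hH
    have hHm : AEStronglyMeasurable H lam := by
      have := aestronglyMeasurable_integral_mul (ν := lam) (lam := ν) hgci.1
        (m := fun ξ x => e x ξ) (he.comp measurable_swap)
      simpa only [hH, mul_comm] using this
    have hHb : ∀ ξ, ‖H ξ‖ ≤ ∫ x, ‖g x‖ ∂ν := fun ξ => by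
      refine (norm_integral_le_integral_norm _).trans (integral_mono_of_nonneg
        (ae_of_all _ fun _ => norm_nonneg _) hgi.norm (ae_of_all _ fun x => ?_))
      simp only [norm_mul, RCLike.norm_conj]
      exact mul_le_of_le_one_right (norm_nonneg _) (hb x ξ)
    have hHc : ∀ ξ, (starRingEnd ℂ) (H ξ) = ∫ x, g x * (starRingEnd ℂ) (e x ξ) ∂ν := fun ξ => by
      rw [hH, ← integral_conj]
      refine integral_congr_ae (ae_of_all _ fun x => ?_)
      simp only [map_mul, Complex.conj_conj]
    have hχH : Integrable (fun ξ => (χ ξ : ℂ) * (starRingEnd ℂ) (H ξ)) lam := by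
      have h1 := (hχi.ofReal (𝕜 := ℂ)).bdd_mul
        (Complex.continuous_conj.comp_aestronglyMeasurable hHm)
        (c := ∫ x, ‖g x‖ ∂ν) (ae_of_all _ fun ξ => by simpa using hHb ξ)
      exact h1.congr (ae_of_all _ fun ξ => mul_comm _ _)
    -- Duality gives I = ∫ H v, and since √χ ≥ 1 on Ω, off which v vanishes, the cutoff can be
    -- inserted for free.
    have step1 : I ≤ ∫⁻ ξ, ‖v ξ‖ₑ * (ENNReal.ofReal (Real.sqrt (χ ξ)) * ‖H ξ‖ₑ) ∂lam := by
      have e1 : ∫ x, (starRingEnd ℂ) (g x) * h x ∂ν = ∫ ξ, H ξ * v ξ ∂lam :=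
        integral_mul_integral_swap hgci hv he hb
      have e2 : ∀ x, (starRingEnd ℂ) (g x) * h x = ((‖g x‖ ^ 2 : ℝ) : ℂ) := fun x => by
        by_cases hx : x ∈ S
        · simp [hg, hx, Complex.conj_mul']
        · simp [hg, hx]
      simp only [e2] at e1
      rw [integral_complex_ofReal] at e1
      have e3 : I = ‖((∫ x, ‖g x‖ ^ 2 ∂ν : ℝ) : ℂ)‖ₑ := by
        have e4 : ∫ x, ‖g x‖ ^ 2 ∂ν = I.toReal := by
          rw [integral_eq_lintegral_of_nonneg_ae (f := fun x => ‖g x‖ ^ 2)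
            (ae_of_all _ fun x => by positivity) (hgi.1.norm.pow 2)]
          congr 1
          refine lintegral_congr fun x => ?_
          rw [ENNReal.ofReal_pow (norm_nonneg _), ofReal_norm]
        rw [e4, ← ofReal_norm, Complex.norm_real, Real.norm_of_nonneg ENNReal.toReal_nonneg,
          ENNReal.ofReal_toReal hIfin.ne]
      rw [e3]
      change ‖((∫ x, ‖g x‖ ^ 2 ∂ν : ℝ) : ℂ)‖ₑ ≤ _
      rw [show ((∫ x, ‖g x‖ ^ 2 ∂ν : ℝ) : ℂ) = ∫ ξ, H ξ * v ξ ∂lam from e1]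
      refine (enorm_integral_le_lintegral_enorm _).trans (lintegral_mono fun ξ => ?_)
      rw [enorm_mul, mul_comm]
      by_cases hξ : ξ ∈ Ω
      · gcongr
        refine le_mul_of_one_le_left' ?_
        rw [← ENNReal.ofReal_one]
        exact ENNReal.ofReal_le_ofReal (Real.one_le_sqrt.2 (hΩ ξ hξ))
      · simp [hv0 ξ hξ]
    -- ∫ χ|H|² is the quadratic form of the kernel of T χ T* at g, to which Schur's test applies.
    have step2 : ∫⁻ ξ, (ENNReal.ofReal (Real.sqrt (χ ξ)) * ‖H ξ‖ₑ) ^ 2 ∂lam ≤ 2 * A * I := by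
      have f1 : ∫⁻ ξ, (ENNReal.ofReal (Real.sqrt (χ ξ)) * ‖H ξ‖ₑ) ^ 2 ∂lam =
          ‖∫ ξ, H ξ * (χ ξ * (starRingEnd ℂ) (H ξ)) ∂lam‖ₑ := by
        have g1 : ∀ ξ, H ξ * (χ ξ * (starRingEnd ℂ) (H ξ)) = ((χ ξ * ‖H ξ‖ ^ 2 : ℝ) : ℂ) := by
          intro ξ
          push_cast
          rw [← Complex.mul_conj']
          ring
        simp only [g1]
        rw [integral_complex_ofReal]
        change _ = ‖((∫ ξ, χ ξ * ‖H ξ‖ ^ 2 ∂lam : ℝ) : ℂ)‖ₑ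
        have g2 : Integrable (fun ξ => χ ξ * ‖H ξ‖ ^ 2) lam := by
          have := hχi.bdd_mul (hHm.norm.pow 2) (c := (∫ x, ‖g x‖ ∂ν) ^ 2)
            (ae_of_all _ fun ξ => by
              simp only [Pi.pow_apply, norm_pow, norm_norm]
              gcongr
              exact hHb ξ)
          exact this.congr (ae_of_all _ fun ξ => mul_comm _ _)
        rw [← ofReal_norm, Complex.norm_real, Real.norm_of_nonneg
          (integral_nonneg fun ξ => mul_nonneg (hχ0 ξ) (by positivity)),
          ofReal_integral_eq_lintegral_ofReal g2
            (ae_of_all _ fun ξ => mul_nonneg (hχ0 ξ) (by positivity))]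
        refine lintegral_congr fun ξ => ?_
        rw [mul_pow, ← ENNReal.ofReal_pow (Real.sqrt_nonneg _), Real.sq_sqrt (hχ0 ξ),
          ENNReal.ofReal_mul (hχ0 ξ), ENNReal.ofReal_pow (norm_nonneg _), ofReal_norm]
      have f2 : ∫ ξ, H ξ * (χ ξ * (starRingEnd ℂ) (H ξ)) ∂lam =
          ∫ x, (starRingEnd ℂ) (g x) * ∫ y, g y *
            ∫ ξ, (starRingEnd ℂ) (e y ξ) * (χ ξ * e x ξ) ∂lam ∂ν ∂ν := by
        rw [← integral_mul_integral_swap hgci hχH he hb]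
        refine integral_congr_ae (ae_of_all _ fun x => ?_)
        simp only
        congr 1
        have hxi : Integrable (fun ξ => (χ ξ : ℂ) * e x ξ) lam := by
          have := (hχi.ofReal (𝕜 := ℂ)).bdd_mul
            (he.comp measurable_prodMk_left).aestronglyMeasurable
            (ae_of_all _ fun ξ => hb x ξ)
          exact this.congr (ae_of_all _ fun ξ => mul_comm _ _)
        rw [integral_mul_integral_swap hgi hxi hec hecb]
        refine integral_congr_ae (ae_of_all _ fun ξ => ?_)
        simp only [hHc]
        ring
      rw [f1, f2]
      have hgm : AEMeasurable (fun x => ‖g x‖ₑ) ν := hgi.1.enorm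
      calc ‖∫ x, (starRingEnd ℂ) (g x) * ∫ y, g y *
            ∫ ξ, (starRingEnd ℂ) (e y ξ) * (χ ξ * e x ξ) ∂lam ∂ν ∂ν‖ₑ
          ≤ ∫⁻ x, ∫⁻ y, ‖g x‖ₑ * ‖g y‖ₑ * κ x y ∂ν ∂ν := by
            refine (enorm_integral_le_lintegral_enorm _).trans (lintegral_mono fun x => ?_)
            rw [enorm_mul]
            refine (mul_le_mul_right (enorm_integral_le_lintegral_enorm _) _).trans ?_
            rw [← lintegral_const_mul' _ _ enorm_ne_top]
            refine lintegral_mono fun y => ?_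
            rw [enorm_mul, mul_assoc, RCLike.enorm_conj]
            gcongr
            exact hκ x y
        -- Using ab ≤ a² + b² without the factor 1/2 is what puts the 2 into the constant.
        _ ≤ ∫⁻ x, ∫⁻ y, (‖g x‖ₑ ^ 2 * κ x y + ‖g y‖ₑ ^ 2 * κ x y) ∂ν ∂ν := by
            refine lintegral_mono fun x => lintegral_mono fun y => ?_
            simp only
            rw [← add_mul]
            gcongr
            rcases le_total ‖g x‖ₑ ‖g y‖ₑ with hle | hle
            · refine le_add_left ?_
              rw [pow_two]
              gcongr
            · refine le_add_right ?_
              rw [pow_two]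
              gcongr
        _ = (∫⁻ x, ∫⁻ y, ‖g x‖ₑ ^ 2 * κ x y ∂ν ∂ν) + ∫⁻ y, ∫⁻ x, ‖g y‖ₑ ^ 2 * κ x y ∂ν ∂ν := by
            rw [lintegral_lintegral_swap (f := fun y x => ‖g y‖ₑ ^ 2 * κ x y),
              ← lintegral_add_left']
            · refine lintegral_congr fun x => ?_
              rw [lintegral_add_left']
              exact ((hκm.comp measurable_prodMk_left).const_mul _).aemeasurable
            · have : AEMeasurable (fun z : X × X => ‖g z.1‖ₑ ^ 2 * κ z.1 z.2) (ν.prod ν) :=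
                ((hgm.pow_const 2).comp_fst).mul hκm.aemeasurable
              exact this.lintegral_prod_right'
            · exact ((hgm.pow_const 2).comp_fst).mul (hκm.comp measurable_swap).aemeasurable
        _ ≤ I * A + I * A := by
            rw [hI, ← lintegral_mul_const'' _ (hgm.pow_const 2)]
            refine add_le_add (lintegral_mono fun x => ?_) (lintegral_mono fun y => ?_)
            · rw [lintegral_const_mul _ (show Measurable fun y => κ x y from hκm.comp measurable_prodMk_left)]
              gcongr
              exact hA1 x
            · rw [lintegral_const_mul _ (show Measurable fun x => κ x y from hκm.comp measurable_prodMk_right)]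
              gcongr
              exact hA2 y
        _ = 2 * A * I := by ring
    have hsm : AEMeasurable (fun ξ => ENNReal.ofReal (Real.sqrt (χ ξ)) * ‖H ξ‖ₑ) lam :=
      (Real.continuous_sqrt.measurable.comp_aemeasurable hχi.1.aemeasurable).ennreal_ofReal.mul
        hHm.enorm
    -- Cauchy–Schwarz; one factor I, finite by the localisation, is cancelled below.
    have step3 : I ^ 2 ≤ (∫⁻ ξ, ‖v ξ‖ₑ ^ 2 ∂lam) * (2 * A * I) :=
      (pow_le_pow_left₀ zero_le step1 2).trans
        ((lintegral_mul_sq_le hv.1.enorm hsm).trans (mul_le_mul_right step2 _))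
    rw [hIeq]
    by_cases hI0 : I = 0
    · rw [hI0]; exact zero_le
    · have : I * I ≤ (2 * A * ∫⁻ ξ, ‖v ξ‖ₑ ^ 2 ∂lam) * I := by
        calc I * I = I ^ 2 := by ring
          _ ≤ _ := step3
          _ = _ := by ring
      exact (ENNReal.mul_le_mul_iff_left hI0 hIfin.ne).1 this
  have huniv : ∫⁻ x, ‖h x‖ₑ ^ 2 ∂ν = ∫⁻ x in ⋃ k, spanningSets ν k, ‖h x‖ₑ ^ 2 ∂ν := by
    rw [iUnion_spanningSets, setLIntegral_univ]
  rw [huniv, setLIntegral_iUnion_of_directed _ (monotone_spanningSets ν).directed_le]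
  exact iSup_le fun k => main _ (measurableSet_spanningSets ν k) (measure_spanningSets_lt_top ν k)

end TTStar

/-! ### Amplitudes that are superpositions of functions of x -/

section AmplitudeBound

variable {X Ξ Y : Type*} [MeasurableSpace X] [MeasurableSpace Ξ] [MeasurableSpace Y]
  {ν : Measure X} {lam : Measure Ξ} {μ : Measure Y}

theorem eLpNorm_two_eq_lintegral {F : Type*} [NormedAddCommGroup F] (f : Y → F) :
    eLpNorm f 2 μ = (∫⁻ y, ‖f y‖ₑ ^ 2 ∂μ) ^ (1 / 2 : ℝ) := by
  rw [eLpNorm_eq_lintegral_rpow_enorm_toReal (by norm_num) (by norm_num)]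
  simp

theorem rpow_half_sq (a : ℝ≥0∞) : (a ^ (1 / 2 : ℝ)) ^ 2 = a := by
  rw [← ENNReal.rpow_natCast, ← ENNReal.rpow_mul]
  norm_num

/-- On a finite measure space `Y`, a uniform `L^p_x` bound with `p ≥ 2` controls the `L^p_x L²_y`
norm. -/
theorem eLpNorm_eLpNorm_two_le [SigmaFinite ν] [IsFiniteMeasure μ] {b : X → Y → ℂ}
    (hbm : Measurable (Function.uncurry b)) {p : ℝ≥0∞} (hp : 2 ≤ p) {A : ℝ≥0∞} (hA : A < ⊤)
    (hbA : ∀ᵐ y ∂μ, eLpNorm (fun x => b x y) p ν ≤ A) :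
    (∀ᵐ x ∂ν, eLpNorm (b x) 2 μ < ⊤) ∧
      eLpNorm (fun x => (eLpNorm (b x) 2 μ).toReal) p ν ≤ A * μ Set.univ ^ (1 / 2 : ℝ) := by
  have hsec : ∀ x, AEStronglyMeasurable (b x) μ := fun x =>
    (show Measurable (b x) from hbm.comp measurable_prodMk_left).aestronglyMeasurable
  -- Hölder on the finite measure space Y; here p ≥ 2 is used.
  have hle : ∀ x, eLpNorm (b x) 2 μ ≤
      eLpNorm (b x) p μ * μ Set.univ ^ (1 / 2 - 1 / p.toReal) := fun x => by
    simpa using eLpNorm_le_eLpNorm_mul_rpow_measure_univ (μ := μ) hp (hsec x)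
  have hμ : ∀ t : ℝ, 0 ≤ t → μ Set.univ ^ t < ⊤ := fun t ht =>
    ENNReal.rpow_lt_top_of_nonneg ht (measure_ne_top μ _)
  rcases eq_or_ne p ⊤ with rfl | hpt
  · have h1 : ∀ᵐ x ∂ν, ∀ᵐ y ∂μ, ‖b x y‖ₑ ≤ A := by
      rw [Measure.ae_ae_comm (p := fun x y => ‖b x y‖ₑ ≤ A)
        (measurableSet_le hbm.enorm measurable_const)]
      filter_upwards [hbA] with y hy
      filter_upwards [ae_le_eLpNormEssSup (f := fun x => b x y) (μ := ν)] with x hx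
      exact hx.trans (by simpa using hy)
    have h2 : ∀ᵐ x ∂ν, eLpNorm (b x) 2 μ ≤ A * μ Set.univ ^ (1 / 2 : ℝ) := by
      filter_upwards [h1] with x hx
      refine (hle x).trans ?_
      simp only [ENNReal.toReal_top, div_zero, sub_zero]
      gcongr
      rw [eLpNorm_exponent_top]
      exact eLpNormEssSup_le_of_ae_enorm_bound hx
    have hfin : A * μ Set.univ ^ (1 / 2 : ℝ) < ⊤ := ENNReal.mul_lt_top hA (hμ _ (by norm_num))
    refine ⟨h2.mono fun x hx => hx.trans_lt hfin, ?_⟩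
    rw [eLpNorm_exponent_top]
    refine eLpNormEssSup_le_of_ae_enorm_bound ?_
    filter_upwards [h2] with x hx
    rw [Real.enorm_eq_ofReal ENNReal.toReal_nonneg]
    exact ENNReal.ofReal_toReal_le.trans hx
  · have hp0 : p ≠ 0 := (lt_of_lt_of_le (by norm_num) hp).ne'
    have hq : 2 ≤ p.toReal := by
      simpa using ENNReal.toReal_mono hpt hp
    have hq0 : 0 < p.toReal := by linarith
    have hexp : 0 ≤ 1 / 2 - 1 / p.toReal := by
      rw [sub_nonneg]
      exact one_div_le_one_div_of_le (by norm_num) hq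
    -- Tonelli exchanges the L^p norms in x and y; uniformity in y costs one factor μ(Y).
    have e1 : ∫⁻ x, eLpNorm (b x) p μ ^ p.toReal ∂ν ≤ A ^ p.toReal * μ Set.univ := by
      have h1 : ∀ x, eLpNorm (b x) p μ ^ p.toReal = ∫⁻ y, ‖b x y‖ₑ ^ p.toReal ∂μ := fun x => by
        rw [eLpNorm_eq_lintegral_rpow_enorm_toReal hp0 hpt, ← ENNReal.rpow_mul,
          one_div_mul_cancel hq0.ne', ENNReal.rpow_one]
      simp only [h1]
      rw [lintegral_lintegral_swap ((hbm.enorm.pow_const _).aemeasurable)]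
      calc ∫⁻ y, ∫⁻ x, ‖b x y‖ₑ ^ p.toReal ∂ν ∂μ ≤ ∫⁻ _y, A ^ p.toReal ∂μ := by
            refine lintegral_mono_ae ?_
            filter_upwards [hbA] with y hy
            have h2 := ENNReal.rpow_le_rpow hy hq0.le
            rwa [eLpNorm_eq_lintegral_rpow_enorm_toReal hp0 hpt, ← ENNReal.rpow_mul,
              one_div_mul_cancel hq0.ne', ENNReal.rpow_one] at h2
        _ = _ := by rw [lintegral_const]
    have hmeas : Measurable fun x => eLpNorm (b x) 2 μ := by
      simp only [eLpNorm_two_eq_lintegral]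
      exact (hbm.enorm.pow_const 2).lintegral_prod_right'.pow_const _
    have e2 : ∫⁻ x, eLpNorm (b x) 2 μ ^ p.toReal ∂ν ≤
        (A * μ Set.univ ^ (1 / 2 : ℝ)) ^ p.toReal := by
      calc ∫⁻ x, eLpNorm (b x) 2 μ ^ p.toReal ∂ν
          ≤ ∫⁻ x, eLpNorm (b x) p μ ^ p.toReal *
              (μ Set.univ ^ (1 / 2 - 1 / p.toReal)) ^ p.toReal ∂ν := by
            refine lintegral_mono fun x => ?_
            simp only
            rw [← ENNReal.mul_rpow_of_nonneg _ _ hq0.le]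
            exact ENNReal.rpow_le_rpow (hle x) hq0.le
        _ = (∫⁻ x, eLpNorm (b x) p μ ^ p.toReal ∂ν) *
              (μ Set.univ ^ (1 / 2 - 1 / p.toReal)) ^ p.toReal :=
            lintegral_mul_const' _ _
              (ENNReal.rpow_lt_top_of_nonneg hq0.le (hμ _ hexp).ne).ne
        _ ≤ A ^ p.toReal * μ Set.univ * (μ Set.univ ^ (1 / 2 - 1 / p.toReal)) ^ p.toReal := by
            gcongr
        -- Exponents of μ(Y): 1 + p(1/2 - 1/p) = p/2.
        _ = (A * μ Set.univ ^ (1 / 2 : ℝ)) ^ p.toReal := by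
            rw [ENNReal.mul_rpow_of_nonneg _ _ hq0.le, mul_assoc]
            congr 1
            rw [← ENNReal.rpow_mul, ← ENNReal.rpow_mul]
            nth_rewrite 1 [← ENNReal.rpow_one (μ Set.univ)]
            rw [← ENNReal.rpow_add_of_nonneg _ _ zero_le_one (by positivity)]
            congr 1
            field_simp
            ring
    refine ⟨?_, ?_⟩
    · have h3 : ∀ᵐ x ∂ν, eLpNorm (b x) 2 μ ^ p.toReal < ⊤ := by
        refine MeasureTheory.ae_lt_top (hmeas.pow_const _) (e2.trans_lt ?_).ne
        exact ENNReal.rpow_lt_top_of_nonneg hq0.le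
          (ENNReal.mul_lt_top hA (hμ _ (by norm_num))).ne
      filter_upwards [h3] with x hx
      exact (ENNReal.rpow_lt_top_iff_of_pos hq0).1 hx
    · rw [eLpNorm_eq_lintegral_rpow_enorm_toReal hp0 hpt, one_div,
        ENNReal.rpow_inv_le_iff hq0]
      refine le_trans (lintegral_mono fun x => ?_) e2
      refine ENNReal.rpow_le_rpow ?_ hq0.le
      rw [Real.enorm_eq_ofReal ENNReal.toReal_nonneg]
      exact ENNReal.ofReal_toReal_le

/-- If the amplitude `a(x, ξ) = ∫ K(ξ, η) b(x, η) dμ(η)` is a superposition of functions of `x`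
that are uniformly bounded in `L^p`, then the operator with amplitude `e(x, ξ) a(x, ξ)` inherits
an `L² → L^r` bound from a weighted `L²` bound of the operator with amplitude `e(x, ξ)`. -/
theorem amplitude_bound_of_measurable [SigmaFinite ν] [SigmaFinite lam] [IsFiniteMeasure μ]
    {e : X → Ξ → ℂ} (he : Measurable (Function.uncurry e)) (hb : ∀ x ξ, ‖e x ξ‖ ≤ 1)
    {wt : Ξ → ℝ≥0∞} (hwt : Measurable wt) (hwt1 : ∀ ξ, 1 ≤ wt ξ) {M : ℝ≥0∞}
    (HF : ∀ v : Ξ → ℂ, Integrable v lam → ∫⁻ x, ‖∫ ξ, e x ξ * v ξ ∂lam‖ₑ ^ 2 ∂ν ≤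
      M * ∫⁻ ξ, wt ξ * ‖v ξ‖ₑ ^ 2 ∂lam)
    {b : X → Y → ℂ} (hbm : Measurable (Function.uncurry b)) {p r : ℝ≥0∞} (hp : 2 ≤ p)
    (hr : 1 / r = 1 / p + 1 / 2) {A : ℝ≥0∞} (hA : A < ⊤)
    (hbA : ∀ᵐ y ∂μ, eLpNorm (fun x => b x y) p ν ≤ A)
    {K : Ξ → Y → ℂ} (hK : Measurable (Function.uncurry K)) {Q : ℝ≥0∞} (hQ : Q < ⊤)
    (hKQ : ∀ ξ, wt ξ * ∫⁻ y, ‖K ξ y‖ₑ ^ 2 ∂μ ≤ Q)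
    {v : Ξ → ℂ} (hv : Integrable v lam) (hvm : Measurable v) :
    (∀ᵐ x ∂ν, Integrable (fun ξ => e x ξ * v ξ * ∫ y, K ξ y * b x y ∂μ) lam) ∧
    eLpNorm (fun x => ∫ ξ, e x ξ * v ξ * ∫ y, K ξ y * b x y ∂μ ∂lam) r ν ≤
      A * μ Set.univ ^ (1 / 2 : ℝ) * (M * Q * ∫⁻ ξ, ‖v ξ‖ₑ ^ 2 ∂lam) ^ (1 / 2 : ℝ) := by
  obtain ⟨hBfin, hBnorm⟩ := eLpNorm_eLpNorm_two_le (ν := ν) (μ := μ) hbm hp hA hbA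
  have hvK : Measurable fun z : Y × Ξ => v z.2 * K z.2 z.1 :=
    (hvm.comp measurable_snd).mul (hK.comp measurable_swap)
  have hKQ1 : ∀ ξ, ∫⁻ y, ‖K ξ y‖ₑ ^ 2 ∂μ ≤ Q := fun ξ =>
    (le_mul_of_one_le_left' (hwt1 ξ)).trans (hKQ ξ)
  -- A majorant of g(x, ·) below, uniform in x. Its square integrability supplies the absolute
  -- convergence for exchanging the ξ and y integrals.
  set k : Y → ℝ≥0∞ := fun y => ∫⁻ ξ, ‖v ξ‖ₑ * ‖K ξ y‖ₑ ∂lam with hk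
  have hvKe : Measurable fun z : Y × Ξ => ‖v z.2‖ₑ * ‖K z.2 z.1‖ₑ :=
    (hvm.comp measurable_snd).enorm.mul (hK.comp measurable_swap).enorm
  have hkm : Measurable k := hvKe.lintegral_prod_right'
  have hk2 : ∫⁻ y, k y ^ 2 ∂μ < ⊤ := by
    -- Cauchy–Schwarz with |v| split into two square roots, because v is only known to be
    -- integrable.
    have h1 : ∀ y, k y ^ 2 ≤ (∫⁻ ξ, ‖v ξ‖ₑ ∂lam) * ∫⁻ ξ, ‖v ξ‖ₑ * ‖K ξ y‖ₑ ^ 2 ∂lam := fun y => by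
      have h2 := lintegral_mul_sq_le (μ := lam) (f := fun ξ => ‖v ξ‖ₑ ^ (1 / 2 : ℝ))
        (g := fun ξ => ‖v ξ‖ₑ ^ (1 / 2 : ℝ) * ‖K ξ y‖ₑ)
        (hvm.enorm.pow_const _).aemeasurable
        ((hvm.enorm.pow_const _).mul
          (show Measurable fun ξ => K ξ y from hK.comp measurable_prodMk_right).enorm).aemeasurable
      simp only [← mul_assoc, mul_pow, rpow_half_sq] at h2
      simp only [← pow_two, rpow_half_sq] at h2
      exact h2
    have hKe : Measurable fun z : Y × Ξ => ‖v z.2‖ₑ * ‖K z.2 z.1‖ₑ ^ 2 :=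
      (hvm.comp measurable_snd).enorm.mul ((hK.comp measurable_swap).enorm.pow_const 2)
    calc ∫⁻ y, k y ^ 2 ∂μ
        ≤ ∫⁻ y, (∫⁻ ξ, ‖v ξ‖ₑ ∂lam) * ∫⁻ ξ, ‖v ξ‖ₑ * ‖K ξ y‖ₑ ^ 2 ∂lam ∂μ := lintegral_mono h1
      _ = (∫⁻ ξ, ‖v ξ‖ₑ ∂lam) * ∫⁻ ξ, ‖v ξ‖ₑ * ∫⁻ y, ‖K ξ y‖ₑ ^ 2 ∂μ ∂lam := by
          rw [lintegral_const_mul _ hKe.lintegral_prod_right', lintegral_lintegral_swap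
            hKe.aemeasurable]
          congr 1
          exact lintegral_congr fun ξ =>
            lintegral_const_mul' ‖v ξ‖ₑ (fun y => ‖K ξ y‖ₑ ^ 2) enorm_ne_top
      _ ≤ (∫⁻ ξ, ‖v ξ‖ₑ ∂lam) * ∫⁻ ξ, ‖v ξ‖ₑ * Q ∂lam := by
          gcongr with ξ
          exact hKQ1 ξ
      _ < ⊤ := by
          rw [lintegral_mul_const' _ _ hQ.ne]
          exact ENNReal.mul_lt_top hv.2 (ENNReal.mul_lt_top hv.2 hQ)
  -- The amplitude-1 operator applied to v K(·, y); the operator to be bounded is ∫ b(x, y) g(x, y)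
  -- dμ(y).
  set g : X → Y → ℂ := fun x y => ∫ ξ, e x ξ * (v ξ * K ξ y) ∂lam with hg
  have hgm : Measurable (Function.uncurry g) := by
    have h1 : StronglyMeasurable (Function.uncurry fun (z : X × Y) (ξ : Ξ) =>
        e z.1 ξ * (v ξ * K ξ z.2)) := by
      refine Measurable.stronglyMeasurable ?_
      have h2 : Measurable fun w : (X × Y) × Ξ => e w.1.1 w.2 :=
        he.comp ((measurable_fst.comp measurable_fst).prodMk measurable_snd)
      have h3 : Measurable fun w : (X × Y) × Ξ => K w.2 w.1.2 :=
        hK.comp (measurable_snd.prodMk (measurable_snd.comp measurable_fst))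
      exact h2.mul ((hvm.comp measurable_snd).mul h3)
    exact h1.integral_prod_right.measurable
  have hgk : ∀ x y, ‖g x y‖ₑ ≤ k y := fun x y => by
    refine (enorm_integral_le_lintegral_enorm _).trans (lintegral_mono fun ξ => ?_)
    simp only [enorm_mul]
    refine mul_le_of_le_one_left' ?_
    rw [← ofReal_norm, ← ENNReal.ofReal_one]
    exact ENNReal.ofReal_le_ofReal (hb x ξ)
  have hgx : ∀ x, Measurable (g x) := fun x => hgm.comp measurable_prodMk_left
  have hbx : ∀ x, Measurable (b x) := fun x => hbm.comp measurable_prodMk_left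
  have hGfin : ∀ x, eLpNorm (g x) 2 μ < ⊤ := fun x => by
    rw [eLpNorm_two_eq_lintegral]
    refine ENNReal.rpow_lt_top_of_nonneg (by norm_num) ?_
    refine ((lintegral_mono fun y => ?_).trans_lt hk2).ne
    gcongr
    exact hgk x y
  have hGm : Measurable fun x => eLpNorm (g x) 2 μ := by
    simp only [eLpNorm_two_eq_lintegral]
    exact (hgm.enorm.pow_const 2).lintegral_prod_right'.pow_const _
  have hBm : Measurable fun x => eLpNorm (b x) 2 μ := by
    simp only [eLpNorm_two_eq_lintegral]
    exact (hbm.enorm.pow_const 2).lintegral_prod_right'.pow_const _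
  have hGnorm : eLpNorm (fun x => (eLpNorm (g x) 2 μ).toReal) 2 ν ≤
      (M * Q * ∫⁻ ξ, ‖v ξ‖ₑ ^ 2 ∂lam) ^ (1 / 2 : ℝ) := by
    rw [eLpNorm_two_eq_lintegral]
    refine ENNReal.rpow_le_rpow ?_ (by norm_num)
    have hklt : ∀ᵐ y ∂μ, k y < ⊤ := by
      filter_upwards [MeasureTheory.ae_lt_top (hkm.pow_const 2) hk2.ne] with y hy
      by_contra hcon
      rw [not_lt, top_le_iff] at hcon
      simp [hcon] at hy
    have hwtm : Measurable fun z : Y × Ξ => wt z.2 * ‖v z.2 * K z.2 z.1‖ₑ ^ 2 :=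
      (hwt.comp measurable_snd).mul (hvK.enorm.pow_const 2)
    calc ∫⁻ x, ‖(eLpNorm (g x) 2 μ).toReal‖ₑ ^ 2 ∂ν
        = ∫⁻ x, ∫⁻ y, ‖g x y‖ₑ ^ 2 ∂μ ∂ν := by
          refine lintegral_congr fun x => ?_
          rw [Real.enorm_eq_ofReal ENNReal.toReal_nonneg, ENNReal.ofReal_toReal (hGfin x).ne,
            eLpNorm_two_eq_lintegral, rpow_half_sq]
      _ = ∫⁻ y, ∫⁻ x, ‖g x y‖ₑ ^ 2 ∂ν ∂μ :=
          lintegral_lintegral_swap (hgm.enorm.pow_const 2).aemeasurable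
      -- The hypothesis `HF` is used for fixed y. It needs v K(·, y) integrable, that is k y < ∞,
      -- which holds for almost every y.
      _ ≤ ∫⁻ y, M * ∫⁻ ξ, wt ξ * ‖v ξ * K ξ y‖ₑ ^ 2 ∂lam ∂μ := by
          refine lintegral_mono_ae ?_
          filter_upwards [hklt] with y hy
          refine HF (fun ξ => v ξ * K ξ y) ⟨?_, ?_⟩
          · exact (hvm.mul (show Measurable fun ξ => K ξ y from
              hK.comp measurable_prodMk_right)).aestronglyMeasurable
          · simpa only [HasFiniteIntegral, enorm_mul] using hy
      _ = M * ∫⁻ ξ, ∫⁻ y, wt ξ * ‖v ξ * K ξ y‖ₑ ^ 2 ∂μ ∂lam := by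
          rw [lintegral_const_mul _ hwtm.lintegral_prod_right',
            lintegral_lintegral_swap hwtm.aemeasurable]
      _ ≤ M * ∫⁻ ξ, Q * ‖v ξ‖ₑ ^ 2 ∂lam := by
          gcongr with ξ
          have hKx : Measurable fun y => ‖K ξ y‖ₑ ^ 2 :=
            (show Measurable (K ξ) from hK.comp measurable_prodMk_left).enorm.pow_const 2
          have : ∀ y, wt ξ * ‖v ξ * K ξ y‖ₑ ^ 2 = (wt ξ * ‖v ξ‖ₑ ^ 2) * ‖K ξ y‖ₑ ^ 2 := fun y => by
            rw [enorm_mul, mul_pow, mul_assoc]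
          simp only [this]
          rw [lintegral_const_mul _ hKx]
          calc wt ξ * ‖v ξ‖ₑ ^ 2 * ∫⁻ y, ‖K ξ y‖ₑ ^ 2 ∂μ
              = (wt ξ * ∫⁻ y, ‖K ξ y‖ₑ ^ 2 ∂μ) * ‖v ξ‖ₑ ^ 2 := by ring
            _ ≤ _ := by
                gcongr
                exact hKQ ξ
      _ = M * Q * ∫⁻ ξ, ‖v ξ‖ₑ ^ 2 ∂lam := by
          rw [lintegral_const_mul' _ _ hQ.ne, mul_assoc]
  have hprod : ∀ x, eLpNorm (b x) 2 μ < ⊤ →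
      Integrable (Function.uncurry fun ξ y => e x ξ * v ξ * (K ξ y * b x y)) (lam.prod μ) := by
    intro x hx
    have hm : Measurable (Function.uncurry fun ξ y => e x ξ * v ξ * (K ξ y * b x y)) :=
      (((show Measurable (e x) from he.comp measurable_prodMk_left).mul hvm).comp
        measurable_fst).mul (hK.mul ((hbx x).comp measurable_snd))
    refine ⟨hm.aestronglyMeasurable, ?_⟩
    rw [hasFiniteIntegral_def, lintegral_prod _ hm.enorm.aemeasurable]
    have hm2 : Measurable fun z : Y × Ξ => ‖b x z.1‖ₑ * (‖v z.2‖ₑ * ‖K z.2 z.1‖ₑ) :=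
      ((hbx x).comp measurable_fst).enorm.mul hvKe
    calc ∫⁻ ξ, ∫⁻ y, ‖Function.uncurry (fun ξ y => e x ξ * v ξ * (K ξ y * b x y)) (ξ, y)‖ₑ ∂μ ∂lam
        ≤ ∫⁻ ξ, ∫⁻ y, ‖b x y‖ₑ * (‖v ξ‖ₑ * ‖K ξ y‖ₑ) ∂μ ∂lam := by
          refine lintegral_mono fun ξ => lintegral_mono fun y => ?_
          simp only [Function.uncurry, enorm_mul]
          have h1 : ‖e x ξ‖ₑ ≤ 1 := by
            rw [← ofReal_norm, ← ENNReal.ofReal_one]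
            exact ENNReal.ofReal_le_ofReal (hb x ξ)
          calc ‖e x ξ‖ₑ * ‖v ξ‖ₑ * (‖K ξ y‖ₑ * ‖b x y‖ₑ)
              ≤ 1 * ‖v ξ‖ₑ * (‖K ξ y‖ₑ * ‖b x y‖ₑ) := by gcongr
            _ = _ := by ring
      _ = ∫⁻ y, ‖b x y‖ₑ * k y ∂μ := by
          rw [← lintegral_lintegral_swap hm2.aemeasurable]
          refine lintegral_congr fun y => ?_
          rw [lintegral_const_mul' _ _ enorm_ne_top]
      _ < ⊤ := by
          have h1 := lintegral_mul_sq_le (μ := μ) (hbx x).enorm.aemeasurable hkm.aemeasurable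
          have h2 : (∫⁻ y, ‖b x y‖ₑ ^ 2 ∂μ) < ⊤ := by
            rw [eLpNorm_two_eq_lintegral] at hx
            exact (ENNReal.rpow_lt_top_iff_of_pos (by norm_num)).1 hx
          have h3 := h1.trans_lt (ENNReal.mul_lt_top h2 hk2)
          by_contra hcon
          rw [not_lt, top_le_iff] at hcon
          simp [hcon] at h3
  refine ⟨?_, ?_⟩
  · filter_upwards [hBfin] with x hx
    have := (hprod x hx).integral_prod_left
    simpa only [Function.uncurry, integral_const_mul] using this
  -- Cauchy–Schwarz in y separates the rough factor b from the oscillatory factor g; Hölder in x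
  -- then combines L^p and L² into L^r.
  · have hpt : ∀ᵐ x ∂ν, ‖∫ ξ, e x ξ * v ξ * ∫ y, K ξ y * b x y ∂μ ∂lam‖ ≤
        (eLpNorm (b x) 2 μ).toReal * (eLpNorm (g x) 2 μ).toReal := by
      filter_upwards [hBfin] with x hx
      have h1 : ∫ ξ, e x ξ * v ξ * ∫ y, K ξ y * b x y ∂μ ∂lam = ∫ y, b x y * g x y ∂μ := by
        have h2 := integral_integral_swap (hprod x hx)
        simp only [integral_const_mul] at h2
        rw [h2]
        refine integral_congr_ae (ae_of_all _ fun y => ?_)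
        simp only [hg]
        rw [← integral_const_mul]
        refine integral_congr_ae (ae_of_all _ fun ξ => ?_)
        simp only
        ring
      rw [h1, ← ENNReal.toReal_mul, ← toReal_enorm]
      refine ENNReal.toReal_mono (ENNReal.mul_lt_top hx (hGfin x)).ne ?_
      refine (enorm_integral_le_lintegral_enorm _).trans ?_
      simp only [enorm_mul]
      have h3 := lintegral_mul_sq_le (μ := μ) (hbx x).enorm.aemeasurable (hgx x).enorm.aemeasurable
      rw [eLpNorm_two_eq_lintegral, eLpNorm_two_eq_lintegral,
        ← ENNReal.mul_rpow_of_nonneg _ _ (by norm_num), one_div, ENNReal.le_rpow_inv_iff two_pos]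
      simpa using h3
    have hholder : ENNReal.HolderTriple p 2 r := ⟨by simpa using hr.symm⟩
    calc eLpNorm (fun x => ∫ ξ, e x ξ * v ξ * ∫ y, K ξ y * b x y ∂μ ∂lam) r ν
        ≤ eLpNorm ((fun x => (eLpNorm (b x) 2 μ).toReal) • fun x => (eLpNorm (g x) 2 μ).toReal)
            r ν := eLpNorm_mono_ae_real hpt
      _ ≤ eLpNorm (fun x => (eLpNorm (b x) 2 μ).toReal) p ν *
            eLpNorm (fun x => (eLpNorm (g x) 2 μ).toReal) 2 ν :=
          eLpNorm_smul_le_mul_eLpNorm hGm.ennreal_toReal.aestronglyMeasurable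
            hBm.ennreal_toReal.aestronglyMeasurable
      _ ≤ _ := mul_le_mul' hBnorm hGnorm

end AmplitudeBound

/-! ### Recovering a function from cube integrals of its mixed derivatives -/

section CubeFormula

variable {V F : Type*} [NormedAddCommGroup V] [NormedSpace ℝ V] [NormedAddCommGroup F]
  [NormedSpace ℝ F]

/-- The weight of `f` (for `β = false`) and of `f'` (for `β = true`) in the formula
`f 0 = ∫₀^ℓ (f / ℓ - (ℓ - s) f' / ℓ) ds`. -/
def cubeWeight (len : ℝ) (β : Bool) (s : ℝ) : ℝ := bif β then -((len - s) / len) else len⁻¹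

theorem continuous_cubeWeight (len : ℝ) (β : Bool) : Continuous (cubeWeight len β) := by
  unfold cubeWeight
  cases β
  · exact continuous_const
  · simp only [cond_true]
    fun_prop

/-- The total integrand is the derivative of -((ℓ - s)/ℓ) f(s), which is 0 at s = ℓ and -f(0) at s =
0. -/
theorem eq_integral_cubeWeight [CompleteSpace F] {f f' : ℝ → F} {len : ℝ} (hl : 0 < len)
    (hf : ∀ s ∈ Set.Icc 0 len, HasDerivAt f (f' s) s) (hc : ContinuousOn f' (Set.Icc 0 len)) :
    f 0 = ∑ β : Bool, ∫ s in Set.Icc 0 len, cubeWeight len β s • (bif β then f' s else f s) := by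
  have hfc : ContinuousOn f (Set.Icc 0 len) := fun s hs =>
    (hf s hs).continuousAt.continuousWithinAt
  have hd : ∀ s ∈ Set.uIcc 0 len, HasDerivAt (fun s => -(((len - s) / len) • f s))
      (cubeWeight len true s • f' s + cubeWeight len false s • f s) s := by
    intro s hs
    rw [Set.uIcc_of_le hl.le] at hs
    have h1 : HasDerivAt (fun s => (len - s) / len) (-1 / len) s :=
      ((hasDerivAt_id s).const_sub len).div_const len
    have h2 := (h1.smul (hf s hs)).neg
    convert! h2 using 1
    simp only [cubeWeight, cond_true, cond_false, neg_smul, neg_add, neg_div, one_div, neg_neg]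
  have i1 : IntegrableOn (fun s => cubeWeight len true s • f' s) (Set.Icc 0 len) :=
    ((continuous_cubeWeight len true).continuousOn.smul hc).integrableOn_Icc
  have i2 : IntegrableOn (fun s => cubeWeight len false s • f s) (Set.Icc 0 len) :=
    ((continuous_cubeWeight len false).continuousOn.smul hfc).integrableOn_Icc
  have h3 := intervalIntegral.integral_eq_sub_of_hasDerivAt hd
    (by
      rw [intervalIntegrable_iff_integrableOn_Icc_of_le hl.le]
      exact i1.add i2)
  rw [intervalIntegral.integral_of_le hl.le, ← integral_Icc_eq_integral_Ioc,
    integral_add i1 i2] at h3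
  rw [Fintype.sum_bool]
  simp only [cond_true, cond_false]
  rw [h3]
  simp [hl.ne']

/-- The list of directions `d j` for which `α j` holds. -/
def bitWord {D : Type*} {k : ℕ} (d : Fin k → D) (α : Fin k → Bool) : List D :=
  ((List.finRange k).filter fun j => α j).map d

theorem bitWord_cons {D : Type*} {k : ℕ} (d : Fin (k + 1) → D) (β : Bool) (α : Fin k → Bool) :
    bitWord d (Fin.cons β α) =
      (bif β then [d 0] else []) ++ bitWord (fun j => d j.succ) α := by
  cases β <;> simp [bitWord, List.finRange_succ, List.filter_map,
    Function.comp_def]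

/-- Fubini with the first coordinate split off. The integrability clause later permits exchanging
the outer integral with a finite sum. -/
theorem setIntegral_Icc_succ {k : ℕ} {len : ℝ} {f : (Fin (k + 1) → ℝ) → F}
    (hf : ContinuousOn f (Set.Icc 0 fun _ => len)) :
    IntegrableOn (fun t => ∫ s in Set.Icc 0 len, f (Fin.cons s t))
      (Set.Icc (0 : Fin k → ℝ) fun _ => len) ∧
    ∫ t in Set.Icc (0 : Fin (k + 1) → ℝ) (fun _ => len), f t =
      ∫ t in Set.Icc (0 : Fin k → ℝ) (fun _ => len), ∫ s in Set.Icc 0 len, f (Fin.cons s t) := by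
  set e := MeasurableEquiv.piFinSuccAbove (fun _ : Fin (k + 1) => ℝ) 0 with he
  have hmp : MeasurePreserving e := volume_preserving_piFinSuccAbove (fun _ => ℝ) 0
  have hsymm : ∀ z : ℝ × (Fin k → ℝ), e.symm z = Fin.cons z.1 z.2 := fun z => by
    rw [he]
    simp [MeasurableEquiv.piFinSuccAbove]
    rfl
  have hset : e ⁻¹' (Set.Icc 0 len ×ˢ Set.Icc 0 fun _ => len) =
      Set.Icc (0 : Fin (k + 1) → ℝ) (fun _ => len) := by
    ext t
    obtain ⟨z, rfl⟩ := e.symm.surjective t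
    rw [hsymm, Set.mem_preimage, ← hsymm, MeasurableEquiv.apply_symm_apply, hsymm]
    simp only [Set.mem_prod, Set.mem_Icc, Pi.le_def, Fin.forall_fin_succ, Fin.cons_zero,
      Fin.cons_succ, Pi.zero_apply]
    tauto
  have hint : IntegrableOn (fun z => f (e.symm z)) (Set.Icc 0 len ×ˢ Set.Icc 0 fun _ => len)
      (volume : Measure (ℝ × (Fin k → ℝ))) := by
    rw [← hmp.integrableOn_comp_preimage e.measurableEmbedding, hset]
    have : (fun z => f (e.symm z)) ∘ e = f := by
      funext t
      simp
    rw [this]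
    exact hf.integrableOn_compact isCompact_Icc
  have h1 := hmp.setIntegral_preimage_emb e.measurableEmbedding (fun z => f (e.symm z))
    (Set.Icc 0 len ×ˢ Set.Icc 0 fun _ => len)
  simp only [MeasurableEquiv.symm_apply_apply, hset] at h1
  rw [IntegrableOn, Measure.volume_eq_prod, ← Measure.prod_restrict] at hint
  refine ⟨by
    rw [IntegrableOn]
    simpa only [hsymm] using hint.integral_prod_right, ?_⟩
  rw [h1, Measure.volume_eq_prod, ← Measure.prod_restrict, integral_prod_symm _ hint]
  simp only [hsymm]

/-- A smooth function is recovered from the averages over a cube of its derivatives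
`∂^α g`, `α ∈ {0, 1}^k`. -/
theorem eq_sum_integral_cube [CompleteSpace F] {U : Set V} (hU : IsOpen U) {g : V → F}
    (hg : ContDiffOn ℝ ∞ g U) {len : ℝ} (hl : 0 < len) {k : ℕ} :
    ∀ (d : Fin k → V) (ξ : V),
      (∀ t ∈ Set.Icc (0 : Fin k → ℝ) (fun _ => len), ξ + ∑ j, t j • d j ∈ U) →
      g ξ = ∑ α : Fin k → Bool, ∫ t in Set.Icc (0 : Fin k → ℝ) (fun _ => len),
        (∏ j, cubeWeight len (α j) (t j)) • dirDeriv (bitWord d α) g (ξ + ∑ j, t j • d j) := by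
  induction k with
  | zero =>
    intro d ξ _
    have h0 : Set.Icc (0 : Fin 0 → ℝ) (fun _ => len) = Set.univ := by
      ext t
      simp [Subsingleton.elim t 0]
    rw [Fintype.sum_unique, h0, setIntegral_univ, Measure.volume_pi_eq_dirac 0, integral_dirac]
    simp [bitWord]
  | succ k ih =>
    intro d ξ hbox
    have hcons : ∀ s ∈ Set.Icc 0 len, ∀ t ∈ Set.Icc (0 : Fin k → ℝ) (fun _ => len),
        (Fin.cons s t : Fin (k + 1) → ℝ) ∈ Set.Icc (0 : Fin (k + 1) → ℝ) (fun _ => len) := by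
      intro s hs t ht
      simp only [Set.mem_Icc, Pi.le_def, Fin.forall_fin_succ, Fin.cons_zero, Fin.cons_succ,
        Pi.zero_apply] at ht hs ⊢
      tauto
    have hsum : ∀ (s : ℝ) (t : Fin k → ℝ), ξ + ∑ j, (Fin.cons s t : Fin (k + 1) → ℝ) j • d j =
        ξ + ∑ j, t j • d j.succ + s • d 0 := by
      intro s t
      rw [Fin.sum_univ_succ]
      simp only [Fin.cons_zero, Fin.cons_succ]
      abel
    have hU' : ∀ s ∈ Set.Icc 0 len, ∀ t ∈ Set.Icc (0 : Fin k → ℝ) (fun _ => len),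
        ξ + ∑ j, t j • d j.succ + s • d 0 ∈ U := fun s hs t ht => by
      rw [← hsum]
      exact hbox _ (hcons s hs t ht)
    rw [ih (fun j => d j.succ) ξ fun t ht => by
      simpa using hU' 0 ⟨le_rfl, hl.le⟩ t ht]
    have hsplit : ∑ α : Fin (k + 1) → Bool,
        ∫ t in Set.Icc (0 : Fin (k + 1) → ℝ) (fun _ => len),
          (∏ j, cubeWeight len (α j) (t j)) • dirDeriv (bitWord d α) g (ξ + ∑ j, t j • d j) =
        ∑ β : Bool, ∑ α : Fin k → Bool, ∫ t in Set.Icc (0 : Fin (k + 1) → ℝ) (fun _ => len),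
          (∏ j, cubeWeight len ((Fin.cons β α : Fin (k + 1) → Bool) j) (t j)) •
            dirDeriv (bitWord d (Fin.cons β α)) g (ξ + ∑ j, t j • d j) := by
      rw [← Fintype.sum_prod_type', ← (Fin.consEquiv fun _ : Fin (k + 1) => Bool).sum_comp]
      rfl
    rw [hsplit, Finset.sum_comm]
    refine Finset.sum_congr rfl fun α _ => ?_
    have hDs : ∀ l : List V, ContDiffOn ℝ ∞ (dirDeriv l g) U := contDiffOn_dirDeriv hU hg
    have hcont : ∀ β : Bool, ContinuousOn (fun t : Fin (k + 1) → ℝ =>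
        (∏ j, cubeWeight len ((Fin.cons β α : Fin (k + 1) → Bool) j) (t j)) •
            dirDeriv (bitWord d (Fin.cons β α)) g (ξ + ∑ j, t j • d j))
        (Set.Icc 0 fun _ => len) := by
      intro β
      refine ContinuousOn.smul (Continuous.continuousOn ?_) ?_
      · exact continuous_finsetProd _ fun j _ =>
          (continuous_cubeWeight len _).comp (continuous_apply j)
      · exact (hDs _).continuousOn.comp (Continuous.continuousOn (by fun_prop)) hbox
    -- The one-dimensional formula along d 0, applied to a derivative already produced by the other
    -- k directions.
    have hone : ∀ t ∈ Set.Icc (0 : Fin k → ℝ) (fun _ => len),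
        (∏ j, cubeWeight len (α j) (t j)) •
          dirDeriv (bitWord (fun j => d j.succ) α) g (ξ + ∑ j, t j • d j.succ) =
        ∑ β : Bool, ∫ s in Set.Icc 0 len,
          (∏ j, cubeWeight len ((Fin.cons β α : Fin (k + 1) → Bool) j)
            ((Fin.cons s t : Fin (k + 1) → ℝ) j)) •
            dirDeriv (bitWord d (Fin.cons β α)) g
              (ξ + ∑ j, (Fin.cons s t : Fin (k + 1) → ℝ) j • d j) := by
      intro t ht
      set G := dirDeriv (bitWord (fun j => d j.succ) α) g with hG
      set q := ξ + ∑ j, t j • d j.succ with hq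
      have hGd : ∀ s ∈ Set.Icc 0 len, HasDerivAt (fun s : ℝ => G (q + s • d 0))
          (fderiv ℝ G (q + s • d 0) (d 0)) s := by
        intro s hs
        have h1 : HasFDerivAt G (fderiv ℝ G (q + s • d 0)) (q + s • d 0) :=
          (((hDs _).contDiffAt (hU.mem_nhds (hU' s hs t ht))).differentiableAt
            (by simp)).hasFDerivAt
        have h2 : HasDerivAt (fun s : ℝ => q + s • d 0) (d 0) s := by
          simpa using ((hasDerivAt_id s).smul_const (d 0)).const_add q
        exact h1.comp_hasDerivAt s h2
      have hGc : ContinuousOn (fun s : ℝ => fderiv ℝ G (q + s • d 0) (d 0)) (Set.Icc 0 len) :=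
        (contDiffOn_fderiv_apply hU (hDs _) (d 0)).continuousOn.comp
          (Continuous.continuousOn (by fun_prop)) fun s hs => hU' s hs t ht
      have h3 := eq_integral_cubeWeight hl hGd hGc
      simp only [zero_smul, add_zero] at h3
      rw [h3, Finset.smul_sum]
      refine Finset.sum_congr rfl fun β _ => ?_
      rw [← integral_smul]
      refine integral_congr_ae (ae_of_all _ fun s => ?_)
      simp only [hsum, Fin.prod_univ_succ, Fin.cons_zero, Fin.cons_succ, smul_smul, bitWord_cons]
      rw [mul_comm]
      cases β <;> rfl
    rw [setIntegral_congr_fun measurableSet_Icc hone, integral_finsetSum]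
    · refine Finset.sum_congr rfl fun β _ => ?_
      rw [(setIntegral_Icc_succ (hcont β)).2]
    · exact fun β _ => (setIntegral_Icc_succ (hcont β)).1

end CubeFormula

/-! ### Estimates for phases in Φ² and the consequence of non-degeneracy -/

section PhaseEstimates

variable {n : ℕ}

theorem isOpen_ne_zero : IsOpen {ξ : E n | ξ ≠ 0} := isOpen_ne

theorem isOpen_snd_ne_zero : IsOpen {z : E n × E n | z.2 ≠ 0} := isOpen_ne.preimage continuous_snd

theorem wderiv_linear_comb {s : Set (E n)} (hs : IsOpen s) {f g : E n → ℝ}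
    (hf : ContDiffOn ℝ ∞ f s) (hg : ContDiffOn ℝ ∞ g s) (a b : ℝ) (l : List (Fin n)) :
    Set.EqOn (wderiv l fun ξ => a * f ξ + b * g ξ) (fun ξ => a * wderiv l f ξ + b * wderiv l g ξ)
      s := by
  induction l with
  | nil => exact fun _ _ => rfl
  | cons j l ih =>
    intro ξ hξ
    have hd : ∀ {h : E n → ℝ}, ContDiffOn ℝ ∞ h s → DifferentiableAt ℝ (wderiv l h) ξ :=
      fun hh => ((contDiffOn_wderiv hs hh l).contDiffAt (hs.mem_nhds hξ)).differentiableAt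
        (by simp)
    simp only [wderiv_cons]
    rw [pderiv_congr hs ih j hξ, pderiv_add ((hd hf).const_mul a) ((hd hg).const_mul b),
      pderiv_mul (differentiableAt_const a) (hd hf), pderiv_mul (differentiableAt_const b) (hd hg),
      pderiv_const, pderiv_const]
    ring

theorem norm_le_sum_abs (v : E n) : ‖v‖ ≤ ∑ j, |v j| := by
  have h : v = ∑ j, v j • basisVec j := by
    ext i
    simp [Finset.sum_apply, Pi.single_apply]
  calc ‖v‖ = ‖∑ j, v j • basisVec j‖ := by rw [← h]
    _ ≤ ∑ j, ‖v j • basisVec j‖ := norm_sum_le _ _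
    _ = ∑ j, |v j| := by simp [norm_smul]

theorem abs_apply_le_norm (v : E n) (j : Fin n) : |v j| ≤ ‖v‖ := by
  simpa using PiLp.norm_apply_le v j

theorem clm_apply_eq_sum (A : E n →L[ℝ] ℝ) (v : E n) : A v = ∑ j, v j * A (basisVec j) := by
  have h : v = ∑ j, v j • basisVec j := by
    ext i
    simp [Finset.sum_apply, Pi.single_apply]
  conv_lhs => rw [h]
  simp [map_sum]

theorem norm_le_of_forall_basisVec (A : E n →L[ℝ] ℝ) {b : ℝ} (hb : 0 ≤ b)
    (h : ∀ j, |A (basisVec j)| ≤ b) : ‖A‖ ≤ n * b := by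
  refine A.opNorm_le_bound (by positivity) fun v => ?_
  rw [clm_apply_eq_sum, Real.norm_eq_abs]
  calc |∑ j, v j * A (basisVec j)| ≤ ∑ j, |v j * A (basisVec j)| :=
        Finset.abs_sum_le_sum_abs _ _
    _ ≤ ∑ _j : Fin n, ‖v‖ * b := by
        refine Finset.sum_le_sum fun j _ => ?_
        rw [abs_mul]
        exact mul_le_mul (abs_apply_le_norm v j) (h j) (abs_nonneg _) (norm_nonneg _)
    _ = n * b * ‖v‖ := by simp; ring

section

variable {B : (Fin n → ℕ) → (Fin n → ℕ) → ℝ} {φ : E n → E n → ℝ}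

theorem IsPhaseWith.contDiffOn_right {k : ℕ} (h : IsPhaseWith k B φ) (x : E n) :
    ContDiffOn ℝ ∞ (φ x) {ξ | ξ ≠ 0} := by
  have h1 : ContDiff ℝ ∞ (fun ξ : E n => (x, ξ)) := contDiff_const.prodMk contDiff_id
  exact h.smooth.comp h1.contDiffOn fun ξ hξ => hξ

/-- Seen as a joint derivative of φ, a ξ-derivative is visibly smooth in x as well. -/
theorem IsPhaseWith.wderiv_eq {k : ℕ} (h : IsPhaseWith k B φ) (l : List (Fin n)) (x ξ : E n)
    (hξ : ξ ≠ 0) : wderiv l (φ x) ξ =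
      dirDeriv (l.map fun j => ((0 : E n), (basisVec j : E n))) (fun z => φ z.1 z.2) (x, ξ) := by
  have := dirDeriv_comp_affine (isOpen_snd_ne_zero (n := n)) h.smooth
    (ContinuousLinearMap.inr ℝ (E n) (E n)) (x, 0) (l.map basisVec) ξ (by simpa using hξ)
  simpa [wderiv, Function.comp_def] using this

theorem IsPhaseWith.contDiff_wderiv_left {k : ℕ} (h : IsPhaseWith k B φ) (l : List (Fin n))
    {ξ : E n} (hξ : ξ ≠ 0) : ContDiff ℝ ∞ fun x => wderiv l (φ x) ξ := by
  simp only [fun x => h.wderiv_eq l x ξ hξ]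
  have h1 : ContDiff ℝ ∞ (fun x : E n => (x, ξ)) := contDiff_id.prodMk contDiff_const
  rw [← contDiffOn_univ]
  exact (contDiffOn_dirDeriv isOpen_snd_ne_zero h.smooth _).comp h1.contDiffOn fun _ _ => hξ

theorem mderiv_zero {F : Type*} [NormedAddCommGroup F] [NormedSpace ℝ F] (f : E n → F) :
    mderiv 0 f = f := by
  rw [mderiv_eq_wderiv]
  simp [wordOf, List.flatMap]

theorem IsPhaseWith.mixedDeriv_zero {k : ℕ} (h : IsPhaseWith k B φ) (l : List (Fin n))
    (x ξ : E n) (hξ : ξ ≠ 0) :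
    mixedDeriv (fun j => l.count j) 0 φ x ξ = wderiv l (φ x) ξ := by
  simp only [mixedDeriv, mderiv_zero]
  exact (wderiv_eq_mderiv isOpen_ne_zero (h.contDiffOn_right x) l hξ).symm

/-- `mixedDeriv` takes the x-derivatives first, while the estimates below differentiate ∂_ξ^α φ in
x. Both are joint derivatives along the same vectors, so symmetry identifies them. -/
theorem IsPhaseWith.mixedDeriv_single {k : ℕ} (h : IsPhaseWith k B φ) (l : List (Fin n))
    (j : Fin n) (x ξ : E n) (hξ : ξ ≠ 0) :
    mixedDeriv (fun i => l.count i) (fun i => [j].count i) φ x ξ =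
      pderiv j (fun y => wderiv l (φ y) ξ) x := by
  set Φ : E n × E n → ℝ := fun z => φ z.1 z.2 with hΦ
  set w : List (E n × E n) := l.map fun j => ((0 : E n), (basisVec j : E n)) with hw
  have hinl : ∀ {f : E n × E n → ℝ}, ContDiffOn ℝ ∞ f {z | z.2 ≠ 0} → ∀ y ζ : E n, ζ ≠ 0 →
      pderiv j (fun y => f (y, ζ)) y = dirDeriv [((basisVec j : E n), (0 : E n))] f (y, ζ) := by
    intro f hf y ζ hζ
    have := dirDeriv_comp_affine (isOpen_snd_ne_zero (n := n)) hf
      (ContinuousLinearMap.inl ℝ (E n) (E n)) (0, ζ) [basisVec j] y (by simpa using hζ)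
    simpa [dirDeriv, pderiv] using this
  have h1 : Set.EqOn (fun ζ => mderiv (fun i => [j].count i) (fun y => φ y ζ) x)
      (fun ζ => dirDeriv [((basisVec j : E n), (0 : E n))] Φ (x, ζ)) {ζ | ζ ≠ 0} := by
    intro ζ hζ
    simp only
    rw [← hinl h.smooth x ζ hζ]
    have hs : ContDiffOn ℝ ∞ (fun y => φ y ζ) Set.univ :=
      (h.contDiff_wderiv_left [] hζ).contDiffOn
    exact (wderiv_eq_mderiv isOpen_univ hs [j] (Set.mem_univ x)).symm
  have hsm : ContDiffOn ℝ ∞ (dirDeriv [((basisVec j : E n), (0 : E n))] Φ) {z | z.2 ≠ 0} :=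
    contDiffOn_dirDeriv isOpen_snd_ne_zero h.smooth _
  have hsx : ContDiffOn ℝ ∞ (fun ζ => dirDeriv [((basisVec j : E n), (0 : E n))] Φ (x, ζ))
      {ζ | ζ ≠ 0} :=
    hsm.comp (contDiff_const.prodMk contDiff_id).contDiffOn fun ξ hξ => hξ
  have h2 : mixedDeriv (fun i => l.count i) (fun i => [j].count i) φ x ξ =
      dirDeriv w (dirDeriv [((basisVec j : E n), (0 : E n))] Φ) (x, ξ) := by
    rw [mixedDeriv, mderiv_eq_wderiv, wderiv_congr isOpen_ne_zero h1 _ hξ, ← mderiv_eq_wderiv,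
      ← wderiv_eq_mderiv isOpen_ne_zero hsx l hξ]
    have := dirDeriv_comp_affine (isOpen_snd_ne_zero (n := n)) hsm
      (ContinuousLinearMap.inr ℝ (E n) (E n)) (x, 0) (l.map basisVec) ξ (by simpa using hξ)
    simpa [wderiv, hw, Function.comp_def] using this
  rw [h2, ← dirDeriv_append, dirDeriv_perm isOpen_snd_ne_zero h.smooth
    (l' := [((basisVec j : E n), (0 : E n))] ++ w) List.perm_append_comm
    (show (x, ξ) ∈ {z : E n × E n | z.2 ≠ 0} from hξ), dirDeriv_append]
  simp only [fun y => h.wderiv_eq l y ξ hξ]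
  exact (hinl (contDiffOn_dirDeriv isOpen_snd_ne_zero h.smooth w) x ξ hξ).symm

theorem abs_le_of_zpow_mul_le {t a b : ℝ} (ht : 0 < t) (m : ℕ)
    (h : t ^ (-1 + (m : ℤ)) * a ≤ b) : a ≤ b * t ^ (1 - (m : ℤ)) := by
  have h1 : t ^ (-1 + (m : ℤ)) * t ^ (1 - (m : ℤ)) = 1 := by
    rw [← zpow_add₀ ht.ne']
    simp
  calc a = (t ^ (-1 + (m : ℤ)) * a) * t ^ (1 - (m : ℤ)) := by
        rw [mul_right_comm, h1, one_mul]
    _ ≤ _ := by gcongr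

theorem IsPhaseWith.abs_wderiv_le (h : IsPhaseWith 2 B φ) (l : List (Fin n)) (hl : 2 ≤ l.length)
    (x ξ : E n) (hξ : ξ ≠ 0) :
    |wderiv l (φ x) ξ| ≤ B (fun j => l.count j) 0 * ‖ξ‖ ^ (1 - (l.length : ℤ)) := by
  have h1 := h.bound (fun j => l.count j) 0 (by rw [order_count]; omega) x ξ hξ
  rw [h.mixedDeriv_zero l x ξ hξ, order_count] at h1
  exact abs_le_of_zpow_mul_le (norm_pos_iff.2 hξ) _ h1

/-- One ξ-derivative is enough: the x-derivative brings the total order to 2, where the Φ² bounds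
begin. -/
theorem IsPhaseWith.abs_pderiv_wderiv_le (h : IsPhaseWith 2 B φ) (l : List (Fin n))
    (hl : 1 ≤ l.length) (j : Fin n) (x ξ : E n) (hξ : ξ ≠ 0) :
    |pderiv j (fun y => wderiv l (φ y) ξ) x| ≤
      B (fun i => l.count i) (fun i => [j].count i) * ‖ξ‖ ^ (1 - (l.length : ℤ)) := by
  have h1 := h.bound (fun i => l.count i) (fun i => [j].count i)
    (by rw [order_count, order_count]; simp; omega) x ξ hξ
  rw [h.mixedDeriv_single l j x ξ hξ, order_count] at h1
  exact abs_le_of_zpow_mul_le (norm_pos_iff.2 hξ) _ h1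

/-- Mean value theorem in x. Differences of ∇_ξφ in x are thus controlled, although Φ² does not
bound ∇_ξφ itself. -/
theorem exists_abs_wderiv_sub_le (B : (Fin n → ℕ) → (Fin n → ℕ) → ℝ) (l : List (Fin n))
    (hl : 1 ≤ l.length) :
    ∃ C : ℝ, 0 ≤ C ∧ ∀ φ, IsPhaseWith 2 B φ → ∀ x y ξ : E n, ξ ≠ 0 →
      |wderiv l (φ x) ξ - wderiv l (φ y) ξ| ≤ C * ‖x - y‖ * ‖ξ‖ ^ (1 - (l.length : ℤ)) := by
  set b : ℝ := ∑ j, |B (fun i => l.count i) (fun i => [j].count i)| with hb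
  refine ⟨n * b, by positivity, fun φ h x y ξ hξ => ?_⟩
  have hξ0 : 0 < ‖ξ‖ := norm_pos_iff.2 hξ
  have hd := h.contDiff_wderiv_left l hξ
  have h1 : ∀ z, ‖fderiv ℝ (fun x => wderiv l (φ x) ξ) z‖ ≤
      n * (b * ‖ξ‖ ^ (1 - (l.length : ℤ))) := fun z => by
    refine norm_le_of_forall_basisVec _ (by positivity) fun j => ?_
    refine (h.abs_pderiv_wderiv_le l hl j z ξ hξ).trans ?_
    gcongr
    exact (le_abs_self _).trans (Finset.single_le_sum
      (f := fun j => |B (fun i => l.count i) (fun i => [j].count i)|)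
      (fun _ _ => abs_nonneg _) (Finset.mem_univ j))
  have h2 := convex_univ.norm_image_sub_le_of_norm_fderiv_le (𝕜 := ℝ)
    (fun z _ => hd.differentiable (by simp) z) (fun z _ => h1 z) (Set.mem_univ y) (Set.mem_univ x)
  rw [Real.norm_eq_abs] at h2
  refine h2.trans (le_of_eq ?_)
  ring

/-- By the strong non-degeneracy condition the map `x ↦ ∇_ξ φ(x, ξ)` is bounded below. -/
theorem exists_gradient_bound_below (B : (Fin n → ℕ) → (Fin n → ℕ) → ℝ) {c : ℝ} (hc : 0 < c) :
    ∃ δ : ℝ, 0 < δ ∧ ∀ φ, IsPhaseWith 2 B φ → SNDWith c φ → ∀ x y ξ : E n, ξ ≠ 0 →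
      δ * ‖x - y‖ ^ 2 ≤ ∑ k, (pderiv k (φ x) ξ - pderiv k (φ y) ξ) ^ 2 := by
  set b : ℝ := ∑ j, ∑ k, |B (fun i => [k].count i) (fun i => [j].count i)| with hb
  obtain ⟨C, hC0, hC⟩ := exists_mulVec_bound_below n b c hc
  -- The summand 1 keeps δ positive even if n * C = 0.
  refine ⟨((n * C) ^ 2 + 1)⁻¹, by positivity, fun φ h hsnd x y ξ hξ => ?_⟩
  -- G = ∇_ξφ(·, ξ). Its Jacobian is the transposed mixed Hessian: the entries are bounded without
  -- any power of |ξ| and the determinant is bounded below, so Hadamard's theorem applies.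
  set G : E n → E n := fun x => WithLp.toLp 2 fun k => wderiv [k] (φ x) ξ with hG
  have hGs : ContDiff ℝ ∞ G := by
    rw [contDiff_euclidean]
    exact fun k => h.contDiff_wderiv_left [k] hξ
  have hGb : ∀ x v, ‖v‖ ≤ (n * C) * ‖fderiv ℝ G x v‖ := by
    intro x v
    set A : Matrix (Fin n) (Fin n) ℝ :=
      Matrix.of fun j k : Fin n => pderiv j (fun y => pderiv k (φ y) ξ) x with hA
    have hcomp : ∀ k, fderiv ℝ G x v k = A.transpose.mulVec v k := by
      intro k
      have h1 : HasFDerivAt (fun y => G y k) ((EuclideanSpace.proj k).comp (fderiv ℝ G x)) x :=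
        (EuclideanSpace.proj (𝕜 := ℝ) k).hasFDerivAt.comp x
          (hGs.differentiable (by simp) x).hasFDerivAt
      have h2 : fderiv ℝ (fun y => G y k) x v = fderiv ℝ G x v k := by
        rw [h1.fderiv]
        rfl
      rw [← h2, clm_apply_eq_sum]
      simp only [Matrix.mulVec, dotProduct, Matrix.transpose_apply]
      refine Finset.sum_congr rfl fun j _ => ?_
      rw [mul_comm]
      rfl
    have hAb : ∀ j k, |A.transpose j k| ≤ b := by
      intro k j
      have h1 := h.abs_pderiv_wderiv_le [k] (by simp) j x ξ hξ
      simp only [List.length_singleton, Nat.cast_one, sub_self, zpow_zero, mul_one] at h1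
      refine h1.trans ((le_abs_self _).trans ?_)
      refine le_trans ?_ (Finset.single_le_sum
        (f := fun j => ∑ k, |B (fun i => [k].count i) (fun i => [j].count i)|)
        (fun j _ => Finset.sum_nonneg fun _ _ => abs_nonneg _) (Finset.mem_univ j))
      exact Finset.single_le_sum (f := fun k => |B (fun i => [k].count i) (fun i => [j].count i)|)
        (fun _ _ => abs_nonneg _) (Finset.mem_univ k)
    have hdet : c ≤ |A.transpose.det| := by
      rw [Matrix.det_transpose]
      exact hsnd x ξ hξ
    have h3 := hC A.transpose hAb hdet v
    have h4 : ‖A.transpose.mulVec v‖ ≤ ‖fderiv ℝ G x v‖ := by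
      rw [pi_norm_le_iff_of_nonneg (norm_nonneg _)]
      intro k
      rw [← hcomp]
      exact abs_apply_le_norm _ k
    calc ‖v‖ ≤ ∑ j, |v j| := norm_le_sum_abs v
      _ ≤ ∑ _j : Fin n, C * ‖fderiv ℝ G x v‖ := by
          refine Finset.sum_le_sum fun j _ => ?_
          exact (norm_le_pi_norm (WithLp.ofLp v) j).trans (h3.trans (by gcongr))
      _ = _ := by simp; ring
  have h5 := norm_sub_le_of_fderiv_bound_below hGs (by positivity) hGb x y
  have h6 : ‖G x - G y‖ ^ 2 = ∑ k, (pderiv k (φ x) ξ - pderiv k (φ y) ξ) ^ 2 := by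
    rw [EuclideanSpace.norm_sq_eq]
    refine Finset.sum_congr rfl fun k _ => ?_
    rw [Real.norm_eq_abs, sq_abs]
    rfl
  rw [← h6, inv_mul_le_iff₀ (by positivity)]
  calc ‖x - y‖ ^ 2 ≤ ((n * C) * ‖G x - G y‖) ^ 2 := by gcongr
    _ ≤ ((n * C) ^ 2 + 1) * ‖G x - G y‖ ^ 2 := by
        rw [mul_pow]
        gcongr
        linarith

/-- The Euler relation for the homogeneous function `φ(x, ·)`. -/
theorem IsPhaseWith.euler {k : ℕ} (h : IsPhaseWith k B φ) (x ξ : E n) (hξ : ξ ≠ 0) :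
    φ x ξ = ∑ j, ξ j * pderiv j (φ x) ξ := by
  have hd : HasFDerivAt (φ x) (fderiv ℝ (φ x) ξ) ((1 : ℝ) • ξ) := by
    rw [one_smul]
    exact (((h.contDiffOn_right x).contDiffAt (isOpen_ne_zero.mem_nhds hξ)).differentiableAt
      (by simp)).hasFDerivAt
  have h1 : HasDerivAt (fun t : ℝ => φ x (t • ξ)) (fderiv ℝ (φ x) ξ ξ) 1 := by
    have h2 : HasDerivAt (fun t : ℝ => t • ξ) ξ 1 := by
      simpa using (hasDerivAt_id (1 : ℝ)).smul_const ξ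
    exact hd.comp_hasDerivAt 1 h2
  have h3 : HasDerivAt (fun t : ℝ => φ x (t • ξ)) (φ x ξ) 1 := by
    have h4 : HasDerivAt (fun t : ℝ => t * φ x ξ) (φ x ξ) 1 := by
      simpa using (hasDerivAt_id (1 : ℝ)).mul_const (φ x ξ)
    refine h4.congr_of_eventuallyEq ?_
    filter_upwards [lt_mem_nhds (zero_lt_one (α := ℝ))] with t ht
    exact h.homogeneous x ξ hξ t ht
  rw [h3.unique h1, clm_apply_eq_sum]
  rfl

theorem IsPhaseWith.pderiv_smul {k : ℕ} (h : IsPhaseWith k B φ) (x ξ : E n) (hξ : ξ ≠ 0) {t : ℝ}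
    (ht : 0 < t) (j : Fin n) : pderiv j (φ x) (t • ξ) = pderiv j (φ x) ξ := by
  have hd : ∀ ζ : E n, ζ ≠ 0 → HasFDerivAt (φ x) (fderiv ℝ (φ x) ζ) ζ := fun ζ hζ =>
    (((h.contDiffOn_right x).contDiffAt (isOpen_ne_zero.mem_nhds hζ)).differentiableAt
      (by simp)).hasFDerivAt
  have h1 : HasFDerivAt (fun ζ => φ x (t • ζ))
      ((fderiv ℝ (φ x) (t • ξ)).comp (t • ContinuousLinearMap.id ℝ (E n))) ξ :=
    (hd (t • ξ) (smul_ne_zero ht.ne' hξ)).comp ξ ((hasFDerivAt_id ξ).const_smul t)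
  have h2 : HasFDerivAt (fun ζ => φ x (t • ζ)) (t • fderiv ℝ (φ x) ξ) ξ := by
    refine ((hd ξ hξ).const_mul t).congr_of_eventuallyEq ?_
    filter_upwards [isOpen_ne_zero.mem_nhds hξ] with ζ hζ
    exact h.homogeneous x ζ hζ t ht
  have h3 := congrArg (fun A => A (basisVec j)) (h1.unique h2)
  simp only [ContinuousLinearMap.comp_apply, smul_apply,
    ContinuousLinearMap.id_apply, map_smul, smul_eq_mul] at h3
  exact mul_left_cancel₀ ht.ne' h3

end

end PhaseEstimates

/-! ### L² bounds on frequency shells -/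

section PhaseBound

variable {n : ℕ}

theorem exists_smooth_cutoff {K s : Set (E n)} (hK : IsCompact K) (hs : IsOpen s) (hKs : K ⊆ s) :
    ∃ χ : E n → ℝ, ContDiff ℝ ∞ χ ∧ HasCompactSupport χ ∧ tsupport χ ⊆ s ∧
      (∀ ξ ∈ K, χ ξ = 1) ∧ ∀ ξ, 0 ≤ χ ξ := by
  obtain ⟨L, hL, hKL, hLs⟩ := exists_compact_between hK hs hKs
  obtain ⟨f, hf1, hf0, hf⟩ := exists_contMDiffMap_one_nhds_of_subset_interior
    (n := ⊤) (modelWithCornersSelf ℝ (E n)) hK.isClosed hKL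
  have hsup : tsupport f ⊆ L := closure_minimal (fun x hx => by
    by_contra h
    exact hx (hf0 x h)) hL.isClosed
  exact ⟨f, f.contMDiff.contDiff, HasCompactSupport.of_support_subset_isCompact hL
    (subset_closure.trans hsup), hsup.trans hLs, fun ξ hξ => hf1.self_of_nhdsSet ξ hξ,
    fun ξ => (hf ξ).1⟩

theorem lintegral_comp_smul_sub {f : E n → ℝ≥0∞} (hf : Measurable f) {t : ℝ} (ht : 0 < t)
    (x : E n) : ∫⁻ y, f (t • (x - y)) = ENNReal.ofReal ((t ^ n)⁻¹) * ∫⁻ y, f y := by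
  have h1 := lintegral_sub_left_eq_self (μ := (volume : Measure (E n))) (fun y => f (t • y)) x
  rw [h1]
  have h2 := lintegral_map (μ := (volume : Measure (E n))) hf (measurable_const_smul t)
  rw [Measure.map_addHaar_smul _ ht.ne', lintegral_smul_measure] at h2
  rw [← h2]
  simp [abs_of_pos ht]

/-- Decay of order M serves τ ≥ 1 and the trivial bound of order 0 serves τ ≤ 1; together they give
a power of 1 + τ. -/
theorem exists_kernel_bound {ι : Type*} {s : Set (E n)} (hs : IsOpen s) {Ψ : ι → E n → ℝ}
    (hΨ : ∀ i, ContDiffOn ℝ ∞ (Ψ i) s)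
    (hb : ∀ k j, SymbolBound s (fun _ => 1) k 0 (fun i => pderiv j (Ψ i))) {c : ℝ} (hc : 0 < c)
    (hlow : ∀ i, ∀ ξ ∈ s, c ≤ ∑ j, pderiv j (Ψ i) ξ ^ 2)
    {χ : E n → ℂ} (hχ : ContDiff ℝ ∞ χ) (hχc : HasCompactSupport χ) (hχs : tsupport χ ⊆ s)
    (M : ℕ) :
    ∃ C : ℝ, 0 ≤ C ∧ ∀ i, ∀ τ : ℝ, 0 < τ →
      ‖∫ ξ, χ ξ * Complex.exp (Complex.I * ((τ * Ψ i ξ : ℝ) : ℂ))‖ ≤ C * ((1 + τ) ^ M)⁻¹ := by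
  obtain ⟨C, hC0, hC⟩ := exists_nonstationary_bound hs hΨ hb hc hlow hχ hχc hχs M
  obtain ⟨D, hD0, hD⟩ := exists_nonstationary_bound hs hΨ hb hc hlow hχ hχc hχs 0
  refine ⟨(C + D) * 2 ^ M, by positivity, fun i τ hτ => ?_⟩
  rw [mul_assoc, ← div_eq_mul_inv, ← div_pow]
  rcases le_total τ 1 with h | h
  · have h1 : 1 ≤ (2 / (1 + τ)) ^ M :=
      one_le_pow₀ (by rw [le_div_iff₀ (by positivity)]; linarith)
    have h2 := hD i τ hτ
    rw [pow_zero, mul_one] at h2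
    refine h2.trans ?_
    calc D ≤ C + D := by linarith
      _ ≤ _ := le_mul_of_one_le_right (by positivity) h1
  · refine (hC i τ hτ).trans ?_
    have h1 : τ⁻¹ ≤ 2 / (1 + τ) := by
      rw [inv_le_comm₀ hτ (by positivity), inv_div]
      linarith
    gcongr
    linarith

/-- An `L²` bound for oscillatory integral operators whose phase differences
`θ x ξ - θ y ξ` behave like `‖x - y‖` times a non-stationary phase on the open set `s`. The bound
is invariant under dilations. -/
theorem exists_lintegral_sq_le_of_phase {κ : Type*} {s Ω : Set (E n)} (hs : IsOpen s)
    (hΩ : IsCompact Ω) (hΩs : Ω ⊆ s) (θ : κ → E n → E n → ℝ)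
    (hθ : ∀ k x, ContDiffOn ℝ ∞ (θ k x) s)
    (hub : ∀ l : List (Fin n), 1 ≤ l.length → ∃ C : ℝ, ∀ k x y, ∀ ξ ∈ s,
      |wderiv l (θ k x) ξ - wderiv l (θ k y) ξ| ≤ C * ‖x - y‖)
    {δ : ℝ} (hδ : 0 < δ)
    (hlow : ∀ k x y, ∀ ξ ∈ s,
      δ * ‖x - y‖ ^ 2 ≤ ∑ j, (pderiv j (θ k x) ξ - pderiv j (θ k y) ξ) ^ 2) :
    ∃ M : ℝ≥0∞, M < ⊤ ∧ ∀ k, ∀ t : ℝ, 0 < t → ∀ e : E n → E n → ℂ,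
      Measurable (Function.uncurry e) → (∀ x ξ, ‖e x ξ‖ ≤ 1) →
      (∀ x, ∀ ξ ∈ s, e x (t • ξ) = Complex.exp (Complex.I * ((t * θ k x ξ : ℝ) : ℂ))) →
      ∀ v : E n → ℂ, Integrable v → (∀ ξ ∉ Ω, v (t • ξ) = 0) →
        ∫⁻ x, ‖∫ ξ, e x ξ * v ξ‖ₑ ^ 2 ≤ M * ∫⁻ ξ, ‖v ξ‖ₑ ^ 2 := by
  obtain ⟨χ, hχ, hχc, hχs, hχ1, hχ0⟩ := exists_smooth_cutoff hΩ hs hΩs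
  set χc : E n → ℂ := fun ξ => (χ ξ : ℂ) with hχcdef
  have hχcs : ContDiff ℝ ∞ χc := Complex.ofRealCLM.contDiff.comp hχ
  have hsupp : Function.support χc = Function.support χ := by
    ext ξ
    simp [hχcdef]
  have htsupp : tsupport χc = tsupport χ := by rw [tsupport, tsupport, hsupp]
  have hχcc : HasCompactSupport χc := by
    rw [HasCompactSupport, htsupp]
    exact hχc
  -- Phase differences divided by ‖x - y‖ form one family with gradients uniformly bounded above and
  -- below; the large parameter becomes t‖x - y‖. The diagonal is treated separately.
  let ι := {i : κ × E n × E n // i.2.1 ≠ i.2.2}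
  let Ψ : ι → E n → ℝ := fun i ξ =>
    ‖i.1.2.1 - i.1.2.2‖⁻¹ * θ i.1.1 i.1.2.1 ξ + -‖i.1.2.1 - i.1.2.2‖⁻¹ * θ i.1.1 i.1.2.2 ξ
  have hpos : ∀ i : ι, 0 < ‖i.1.2.1 - i.1.2.2‖ := fun i => norm_pos_iff.2 (sub_ne_zero.2 i.2)
  have hΨ : ∀ i, ContDiffOn ℝ ∞ (Ψ i) s := fun i =>
    (contDiffOn_const.mul (hθ _ _)).add (contDiffOn_const.mul (hθ _ _))
  have hw : ∀ i l, ∀ ξ ∈ s, wderiv l (Ψ i) ξ = ‖i.1.2.1 - i.1.2.2‖⁻¹ *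
      (wderiv l (θ i.1.1 i.1.2.1) ξ - wderiv l (θ i.1.1 i.1.2.2) ξ) := fun i l ξ hξ => by
    rw [show wderiv l (Ψ i) ξ = _ from wderiv_linear_comb hs (hθ _ _) (hθ _ _) _ _ l hξ]
    ring
  have hb : ∀ k j, SymbolBound s (fun _ => 1) k 0 (fun i => pderiv j (Ψ i)) := by
    intro k j
    refine SymbolBound.of_wderiv hs (fun i => contDiffOn_pderiv hs (hΨ i) j) fun l => ?_
    obtain ⟨C, hC⟩ := hub (l ++ [j]) (by simp)
    refine ⟨C, fun i ξ hξ => ?_⟩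
    have h1 : wderiv l (pderiv j (Ψ i)) ξ = wderiv (l ++ [j]) (Ψ i) ξ := by
      rw [wderiv_append]
      rfl
    rw [h1, hw i _ ξ hξ, norm_mul, norm_inv, norm_norm, one_zpow, mul_one,
      inv_mul_le_iff₀ (hpos i), mul_comm _ C]
    exact hC _ _ _ ξ hξ
  have hl : ∀ i, ∀ ξ ∈ s, δ ≤ ∑ j, pderiv j (Ψ i) ξ ^ 2 := by
    intro i ξ hξ
    have h1 : ∀ j, pderiv j (Ψ i) ξ ^ 2 = (‖i.1.2.1 - i.1.2.2‖ ^ 2)⁻¹ *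
        (pderiv j (θ i.1.1 i.1.2.1) ξ - pderiv j (θ i.1.1 i.1.2.2) ξ) ^ 2 := fun j => by
      rw [show pderiv j (Ψ i) ξ = _ from hw i [j] ξ hξ, mul_pow, inv_pow]
      rfl
    simp only [h1]
    rw [← Finset.mul_sum, le_inv_mul_iff₀ (by have := hpos i; positivity), mul_comm]
    exact hlow _ _ _ ξ hξ
  -- Decay of order n + 1 makes the kernel integrable on ℝⁿ.
  obtain ⟨C, hC0, hC⟩ := exists_kernel_bound hs hΨ hb hδ hl hχcs hχcc (htsupp ▸ hχs) (n + 1)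
  -- The second summand covers x = y, where nothing oscillates.
  set D : ℝ := C + ∫ ξ, ‖χc ξ‖ with hD
  have hI0 : 0 ≤ ∫ ξ, ‖χc ξ‖ := integral_nonneg fun _ => norm_nonneg _
  have hD0 : 0 ≤ D := by positivity
  set J : ℝ≥0∞ := ∫⁻ y : E n, ENNReal.ofReal (((1 + ‖y‖) ^ (n + 1))⁻¹) with hJ
  have hJt : J < ⊤ := by
    have h1 := finite_integral_one_add_norm (μ := (volume : Measure (E n))) (r := n + 1) (by simp)
    refine lt_of_le_of_lt (lintegral_mono fun y => ?_) h1
    rw [Real.rpow_neg (by positivity)]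
    exact_mod_cast le_rfl
  refine ⟨2 * (ENNReal.ofReal D * J), ENNReal.mul_lt_top (by simp)
    (ENNReal.mul_lt_top (by simp) hJt), fun k t ht e he heb hes v hv hv0 => ?_⟩
  set f : E n → ℝ≥0∞ := fun y => ENNReal.ofReal (((1 + ‖y‖) ^ (n + 1))⁻¹) with hf
  have hfm : Measurable f := by fun_prop
  -- The factor tⁿ from rescaling ξ cancels the t⁻ⁿ from integrating in x or y, so the Schur
  -- constant does not depend on t.
  set ker : E n → E n → ℝ≥0∞ := fun x y =>
    ENNReal.ofReal (t ^ n * D) * f (t • (x - y)) with hker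
  have hkerI : ∀ x, ∫⁻ y, ker x y = ENNReal.ofReal D * J := by
    intro x
    have hm : Measurable fun y => f (t • (x - y)) :=
      hfm.comp (by fun_prop : Measurable fun y : E n => t • (x - y))
    simp only [hker]
    rw [lintegral_const_mul _ hm, lintegral_comp_smul_sub hfm ht, ← mul_assoc,
      ← ENNReal.ofReal_mul (by positivity)]
    congr 2
    field_simp
  have hker_symm : ∀ x y, ker x y = ker y x := fun x y => by
    simp only [hker, hf]
    rw [show t • (x - y) = -(t • (y - x)) by rw [← smul_neg, neg_sub], norm_neg]
  refine lintegral_sq_le_of_kernel_bound (χ := fun ξ => χ (t⁻¹ • ξ)) (κ := ker)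
    (Ω := {ξ | t⁻¹ • ξ ∈ Ω}) he heb (fun ξ => hχ0 _) ?_ (fun ξ hξ => (hχ1 _ hξ).ge) ?_ ?_
    (fun x => (hkerI x).le) (fun y => ?_) hv fun ξ hξ => ?_
  · exact (hχ.continuous.integrable_of_hasCompactSupport hχc).comp_smul (inv_ne_zero ht.ne')
  · exact (hfm.comp (by fun_prop : Measurable fun z : E n × E n => t • (z.1 - z.2))).const_mul _
  · intro x y
    have h1 := Measure.integral_comp_smul (volume : Measure (E n))
      (fun ξ => (starRingEnd ℂ) (e y ξ) * (χ (t⁻¹ • ξ) * e x ξ)) t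
    rw [finrank_euclideanSpace_fin, abs_of_pos (by positivity), eq_inv_smul_iff₀ (by positivity)]
      at h1
    have h2 : ∀ ξ, (starRingEnd ℂ) (e y (t • ξ)) * (χ (t⁻¹ • t • ξ) * e x (t • ξ)) =
        χc ξ * Complex.exp (Complex.I * ((t * (θ k x ξ - θ k y ξ) : ℝ) : ℂ)) := by
      intro ξ
      rw [smul_smul, inv_mul_cancel₀ ht.ne', one_smul]
      by_cases hξ : ξ ∈ s
      · rw [hes x ξ hξ, hes y ξ hξ, ← Complex.exp_conj, mul_left_comm, ← Complex.exp_add]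
        congr 2
        simp
        ring
      · have : χ ξ = 0 := image_eq_zero_of_notMem_tsupport fun h => hξ (hχs h)
        simp [hχcdef, this]
    rw [← h1]
    simp only [h2]
    rw [hker, hf]
    simp only
    rw [← ENNReal.ofReal_mul (by positivity), ← ofReal_norm]
    refine ENNReal.ofReal_le_ofReal ?_
    rw [norm_smul, Real.norm_of_nonneg (by positivity), mul_assoc]
    refine mul_le_mul_of_nonneg_left ?_ (by positivity)
    rcases eq_or_ne x y with rfl | hxy
    · simp only [sub_self, smul_zero, norm_zero, add_zero, one_pow, inv_one, mul_one]
      refine (norm_integral_le_integral_norm _).trans ?_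
      simp [hD, hC0]
    · have h3 := hC ⟨(k, x, y), hxy⟩ (t * ‖x - y‖)
        (mul_pos ht (norm_pos_iff.2 (sub_ne_zero.2 hxy)))
      have h4 : ∀ ξ, t * ‖x - y‖ * Ψ ⟨(k, x, y), hxy⟩ ξ = t * (θ k x ξ - θ k y ξ) := fun ξ => by
        have : ‖x - y‖ ≠ 0 := norm_ne_zero_iff.2 (sub_ne_zero.2 hxy)
        simp only [Ψ]
        field_simp
        ring
      simp only [h4] at h3
      rw [norm_smul, Real.norm_of_nonneg ht.le]
      refine h3.trans ?_
      gcongr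
      linarith
  · rw [← hkerI y]
    exact (lintegral_congr fun x => hker_symm x y).le
  · have := hv0 (t⁻¹ • ξ) hξ
    rwa [smul_smul, mul_inv_cancel₀ ht.ne', one_smul] at this

/-- The oscillating factor `e^{iφ(x, ξ)}`, set to zero at `ξ = 0`. -/
def oscFactor (φ : E n → E n → ℝ) (x ξ : E n) : ℂ :=
  open Classical in if ξ = 0 then 0 else Complex.exp (Complex.I * (φ x ξ : ℂ))

theorem norm_oscFactor_le (φ : E n → E n → ℝ) (x ξ : E n) : ‖oscFactor φ x ξ‖ ≤ 1 := by
  unfold oscFactor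
  split_ifs
  · simp
  · rw [mul_comm, Complex.norm_exp_ofReal_mul_I]

theorem oscFactor_of_ne (φ : E n → E n → ℝ) (x : E n) {ξ : E n} (hξ : ξ ≠ 0) :
    oscFactor φ x ξ = Complex.exp (Complex.I * (φ x ξ : ℂ)) := if_neg hξ

theorem IsPhaseWith.measurable_oscFactor {k : ℕ} {B : (Fin n → ℕ) → (Fin n → ℕ) → ℝ}
    {φ : E n → E n → ℝ} (h : IsPhaseWith k B φ) : Measurable (Function.uncurry (oscFactor φ)) := by
  have hm : MeasurableSet {z : E n × E n | z.2 = 0} := measurable_snd (measurableSet_singleton 0)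
  refine measurable_of_restrict_of_restrict_compl hm ?_ ?_
  · convert measurable_const (a := (0 : ℂ)) using 1
    ext ⟨z, hz⟩
    exact if_pos hz
  · refine Continuous.measurable ?_
    rw [← continuousOn_iff_continuous_domRestrict]
    have h1 : ContinuousOn (fun z : E n × E n => Complex.exp (Complex.I * (φ z.1 z.2 : ℂ)))
        {z | z.2 = 0}ᶜ := by
      refine Complex.continuous_exp.comp_continuousOn (continuousOn_const.mul ?_)
      exact Complex.continuous_ofReal.comp_continuousOn h.smooth.continuousOn
    exact h1.congr fun z hz => oscFactor_of_ne φ z.1 hz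

/-- By homogeneity, ξ = tζ turns φ on |ξ| ~ t into tφ on the fixed shell |ζ| ~ 1, where powers of
|ζ| are harmless. This is why one constant serves all t. -/
theorem exists_shell_bound (B : (Fin n → ℕ) → (Fin n → ℕ) → ℝ) {c : ℝ} (hc : 0 < c) :
    ∃ M : ℝ≥0∞, M < ⊤ ∧ ∀ φ, IsPhaseWith 2 B φ → SNDWith c φ → ∀ t : ℝ, 0 < t →
      ∀ v : E n → ℂ, Integrable v → (∀ ξ, ¬(t ≤ ‖ξ‖ ∧ ‖ξ‖ ≤ 2 * t) → v ξ = 0) →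
        ∫⁻ x, ‖∫ ξ, oscFactor φ x ξ * v ξ‖ₑ ^ 2 ≤ M * ∫⁻ ξ, ‖v ξ‖ₑ ^ 2 := by
  set s : Set (E n) := {ξ | 1 / 2 < ‖ξ‖ ∧ ‖ξ‖ < 4} with hsdef
  set Ω : Set (E n) := {ξ | 1 ≤ ‖ξ‖ ∧ ‖ξ‖ ≤ 2} with hΩdef
  have hs : IsOpen s :=
    (isOpen_lt continuous_const continuous_norm).inter (isOpen_lt continuous_norm continuous_const)
  have hΩc : IsCompact Ω := by
    refine (isCompact_closedBall (0 : E n) 2).of_isClosed_subset ?_ fun ξ hξ => by simpa using hξ.2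
    exact (isClosed_le continuous_const continuous_norm).inter
      (isClosed_le continuous_norm continuous_const)
  have hs0 : s ⊆ {ξ | ξ ≠ 0} := fun ξ hξ h => by
    have := hξ.1
    rw [h, norm_zero] at this
    linarith
  obtain ⟨δ, hδ, hlow⟩ := exists_gradient_bound_below B hc
  obtain ⟨M, hM, H⟩ := exists_lintegral_sq_le_of_phase
    (κ := {φ : E n → E n → ℝ // IsPhaseWith 2 B φ ∧ SNDWith c φ}) hs hΩc
    (fun ξ hξ => ⟨by linarith [hξ.1], by linarith [hξ.2]⟩) (fun k => k.1)
    (fun k x => (k.2.1.contDiffOn_right x).mono hs0) (fun l hl => by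
      obtain ⟨C, hC0, hC⟩ := exists_abs_wderiv_sub_le B l hl
      refine ⟨C * 2 ^ ((l.length : ℤ) - 1), fun k x y ξ hξ => ?_⟩
      refine (hC k.1 k.2.1 x y ξ (hs0 hξ)).trans ?_
      rw [mul_right_comm C]
      gcongr
      rw [← neg_sub (l.length : ℤ) 1, zpow_neg, ← inv_zpow]
      have h1 : ‖ξ‖⁻¹ ≤ 2 := by
        rw [inv_le_comm₀ (by linarith [hξ.1]) (by norm_num)]
        linarith [hξ.1]
      exact zpow_le_zpow_left₀ (by omega) (by positivity) h1)
    hδ (fun k x y ξ hξ => hlow k.1 k.2.1 k.2.2 x y ξ (hs0 hξ))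
  refine ⟨M, hM, fun φ h hsnd t ht v hv hv0 => ?_⟩
  refine H ⟨φ, h, hsnd⟩ t ht _ h.measurable_oscFactor (norm_oscFactor_le φ)
    (fun x ξ hξ => ?_) v hv fun ξ hξ => hv0 _ fun h' => hξ ?_
  · rw [oscFactor_of_ne φ x (smul_ne_zero ht.ne' (hs0 hξ)), h.homogeneous x ξ (hs0 hξ) t ht]
  · rw [norm_smul, Real.norm_of_nonneg ht.le] at h'
    exact ⟨by nlinarith [h'.1], by nlinarith [h'.2]⟩

end PhaseBound

/-! ### Amplitudes expanded over cubes of variable side -/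

section CubeAmplitude

variable {n : ℕ}

/-- The cube `[0, len]ⁿ` in `ℝⁿ`. -/
def cubeSet (n : ℕ) (len : ℝ) : Set (E n) := {ζ | ∀ j, 0 ≤ ζ j ∧ ζ j ≤ len}

/-- The number of entries `true` of `α`. -/
def bitCount {k : ℕ} (α : Fin k → Bool) : ℕ := ((List.finRange k).filter fun j => α j).length

theorem measurableSet_cubeSet (len : ℝ) : MeasurableSet (cubeSet n len) := by
  have : cubeSet n len = ⋂ j, {ζ : E n | 0 ≤ ζ j ∧ ζ j ≤ len} := by
    ext ζ
    simp [cubeSet]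
  rw [this]
  refine MeasurableSet.iInter fun j => ?_
  have hm : Measurable fun ζ : E n => ζ j := by fun_prop
  exact (measurableSet_le measurable_const hm).inter (measurableSet_le hm measurable_const)

theorem preimage_cubeSet (len : ℝ) :
    (WithLp.toLp 2 : (Fin n → ℝ) → E n) ⁻¹' cubeSet n len = Set.Icc 0 fun _ => len := by
  ext t
  simp [cubeSet, Pi.le_def, forall_and]

theorem volume_cubeSet (len : ℝ) : volume (cubeSet n len) = ENNReal.ofReal len ^ n := by
  rw [← (PiLp.volume_preserving_toLp (Fin n)).measure_preimage
    (measurableSet_cubeSet len).nullMeasurableSet, preimage_cubeSet, Real.volume_Icc_pi]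
  simp

theorem integral_cube_eq (len : ℝ) (α : Fin n → Bool) (f : E n → ℂ) (ξ : E n) :
    ∫ t in Set.Icc (0 : Fin n → ℝ) (fun _ => len),
        (∏ j, cubeWeight len (α j) (t j)) • f (ξ + ∑ j, t j • basisVec j) =
      ∫ η, (cubeSet n len).indicator (fun ζ => ∏ j, cubeWeight len (α j) (ζ j)) (η - ξ) • f η := by
  have h0 : ∀ t : Fin n → ℝ, ∑ j, t j • (basisVec j : E n) = WithLp.toLp 2 t := fun t => by
    ext i
    simp [Finset.sum_apply, Pi.single_apply]
  simp only [h0]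
  rw [← integral_add_right_eq_self _ ξ]
  have h1 := (PiLp.volume_preserving_toLp (Fin n)).setIntegral_preimage_emb
    (MeasurableEquiv.toLp 2 (Fin n → ℝ)).measurableEmbedding
    (fun ζ : E n => (∏ j, cubeWeight len (α j) (ζ j)) • f (ξ + ζ)) (cubeSet n len)
  rw [preimage_cubeSet] at h1
  rw [h1, ← integral_indicator (measurableSet_cubeSet len)]
  refine integral_congr_ae (ae_of_all _ fun ζ => ?_)
  by_cases hζ : ζ ∈ cubeSet n len <;> simp [hζ, add_comm]

/-- An undifferentiated direction contributes ℓ⁻¹, a differentiated one at most 1 = ℓ · ℓ⁻¹. -/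
theorem abs_prod_cubeWeight_le {len : ℝ} (hl : 0 < len) (α : Fin n → Bool) {ζ : E n}
    (hζ : ζ ∈ cubeSet n len) :
    |∏ j, cubeWeight len (α j) (ζ j)| ≤ len ^ bitCount α * (len ^ n)⁻¹ := by
  have h1 : ∏ j : Fin n, (bif α j then len else 1) = len ^ bitCount α := by
    rw [Fin.prod_univ_def, bitCount]
    induction List.finRange n with
    | nil => simp
    | cons j l ih => cases h : α j <;> simp [h, ih, pow_succ, mul_comm]
  rw [Finset.abs_prod, ← h1, ← inv_pow,
    show len⁻¹ ^ n = ∏ _j : Fin n, len⁻¹ by simp, ← Finset.prod_mul_distrib]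
  refine Finset.prod_le_prod (fun _ _ => abs_nonneg _) fun j _ => ?_
  obtain ⟨h2, h3⟩ := hζ j
  cases α j
  · simp [cubeWeight, abs_of_pos hl]
  · simp only [cubeWeight, cond_true, abs_neg]
    rw [mul_inv_cancel₀ hl.ne', abs_of_nonneg (div_nonneg (by linarith) hl.le), div_le_one hl]
    linarith

theorem stronglyMeasurable_integral_integral {e : E n → E n → ℂ}
    (he : Measurable (Function.uncurry e)) {v : E n → ℂ} (hv : Measurable v)
    {μ : Measure (E n)} [SFinite μ] {K b : E n → E n → ℂ} (hK : Measurable (Function.uncurry K))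
    (hb : Measurable (Function.uncurry b)) :
    StronglyMeasurable fun x => ∫ ξ, e x ξ * v ξ * ∫ η, K ξ η * b x η ∂μ := by
  have h0 : Measurable fun z : (E n × E n) × E n => K z.1.2 z.2 * b z.1.1 z.2 :=
    (hK.comp (measurable_fst.snd.prodMk measurable_snd)).mul
      (hb.comp (measurable_fst.fst.prodMk measurable_snd))
  have h1 : StronglyMeasurable fun z : E n × E n => ∫ η, K z.2 η * b z.1 η ∂μ :=
    h0.stronglyMeasurable.integral_prod_right'
  have h2 : Measurable fun z : E n × E n => e z.1 z.2 * v z.2 := he.mul (hv.comp measurable_snd)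
  exact (h2.stronglyMeasurable.mul h1).integral_prod_right'

theorem one_le_of_holder {p r : ℝ≥0∞} (hp : 2 ≤ p) (hr : 1 / r = 1 / p + 1 / 2) : 1 ≤ r := by
  rw [← ENNReal.inv_le_one, ← one_div, hr]
  calc 1 / p + 1 / 2 ≤ 1 / 2 + 1 / 2 := by gcongr
    _ = 1 := ENNReal.add_halves 1

/-- A bound `L² → L^r` for the operator with amplitude `e(x, ξ) g(x, ξ)`, when `g` is
reproduced by averages of its mixed derivatives `D α` of order at most one in each variable over
cubes of side `len ξ`, and `D α` satisfies `L^p` bounds in `x`. -/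
theorem amplitude_bound_of_cube {e : E n → E n → ℂ} (he : Measurable (Function.uncurry e))
    (hb : ∀ x ξ, ‖e x ξ‖ ≤ 1) {wt : E n → ℝ≥0∞} (hwt : Measurable wt) (hwt1 : ∀ ξ, 1 ≤ wt ξ)
    {M : ℝ≥0∞} (HF : ∀ v : E n → ℂ, Integrable v → ∫⁻ x, ‖∫ ξ, e x ξ * v ξ‖ₑ ^ 2 ≤
      M * ∫⁻ ξ, wt ξ * ‖v ξ‖ₑ ^ 2)
    {p r : ℝ≥0∞} (hp : 2 ≤ p) (hr : 1 / r = 1 / p + 1 / 2) {A : ℝ≥0∞} (hA : A < ⊤)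
    {Ω U : Set (E n)} (hΩ : MeasurableSet Ω) (hU : MeasurableSet U) {len : E n → ℝ}
    (hlen : Measurable len) (hlen0 : ∀ ξ ∈ Ω, 0 < len ξ)
    (hbox : ∀ ξ ∈ Ω, ∀ η, η - ξ ∈ cubeSet n (len ξ) → η ∈ U)
    {S : (Fin n → Bool) → E n → ℝ} (hS : ∀ α, Measurable (S α)) (hS0 : ∀ α, ∀ η ∈ U, 0 < S α η)
    {h : E n → ℝ≥0} (hh : Measurable h) (hh0 : ∀ η ∈ U, 0 < h η)
    (hhI : ∫⁻ η in U, h η < ⊤)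
    {Q : ℝ≥0∞} (hQ : Q < ⊤)
    (hQS : ∀ α, ∀ ξ ∈ Ω, ∀ η ∈ U, η - ξ ∈ cubeSet n (len ξ) →
      wt ξ * ENNReal.ofReal (S α η ^ 2 * len ξ ^ (2 * bitCount α)) ≤
        Q * ENNReal.ofReal (h η * len ξ ^ n))
    {D : (Fin n → Bool) → E n → E n → ℂ} (hD : ∀ α, Measurable (Function.uncurry (D α)))
    (hDA : ∀ α, ∀ η ∈ U, eLpNorm (fun x => D α x η) p volume ≤ A * ENNReal.ofReal (S α η))
    {g : E n → E n → ℂ}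
    (hg : ∀ᵐ x, ∀ ξ ∈ Ω, g x ξ = ∑ α : Fin n → Bool,
      ∫ t in Set.Icc (0 : Fin n → ℝ) (fun _ => len ξ),
        (∏ j, cubeWeight (len ξ) (α j) (t j)) • D α x (ξ + ∑ j, t j • basisVec j))
    {v : E n → ℂ} (hv : Integrable v) (hvm : Measurable v) (hv0 : ∀ ξ ∉ Ω, v ξ = 0) :
    (∀ᵐ x, Integrable fun ξ => e x ξ * v ξ * g x ξ) ∧
    eLpNorm (fun x => ∫ ξ, e x ξ * v ξ * g x ξ) r volume ≤
      2 ^ n * (A * (∫⁻ η in U, h η) ^ (1 / 2 : ℝ) *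
        (M * Q * ∫⁻ ξ, ‖v ξ‖ₑ ^ 2) ^ (1 / 2 : ℝ)) := by
  have hr1 : 1 ≤ r := one_le_of_holder hp hr
  -- The density h makes the measure finite and is divided out again in K; dividing the derivatives
  -- by S bounds b by A in L^p.
  set μ : Measure (E n) := (volume.restrict U).withDensity fun η => h η with hμ
  have hμuniv : μ Set.univ = ∫⁻ η in U, h η := by
    rw [hμ, withDensity_apply _ MeasurableSet.univ, setLIntegral_univ]
  have hfin : IsFiniteMeasure μ := ⟨by rw [hμuniv]; exact hhI⟩
  set w : (Fin n → Bool) → E n → E n → ℝ := fun α ξ η =>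
    (cubeSet n (len ξ)).indicator (fun ζ => ∏ j, cubeWeight (len ξ) (α j) (ζ j)) (η - ξ) with hw
  set K : (Fin n → Bool) → E n → E n → ℂ := fun α ξ η =>
    ((Ω.indicator (fun _ => w α ξ η * S α η / h η) ξ : ℝ) : ℂ) with hK
  set b : (Fin n → Bool) → E n → E n → ℂ := fun α x η => ((S α η)⁻¹ : ℂ) * D α x η with hbdef
  have hbm : ∀ α, Measurable (Function.uncurry (b α)) := fun α =>
    (Complex.measurable_ofReal.comp ((hS α).comp measurable_snd)).inv.mul (hD α)
  have hwm : ∀ α, Measurable (Function.uncurry (w α)) := by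
    intro α
    have hm : MeasurableSet {z : E n × E n | z.2 - z.1 ∈ cubeSet n (len z.1)} := by
      have : {z : E n × E n | z.2 - z.1 ∈ cubeSet n (len z.1)} =
          ⋂ j, {z : E n × E n | 0 ≤ (z.2 - z.1) j ∧ (z.2 - z.1) j ≤ len z.1} := by
        ext z
        simp [cubeSet]
      rw [this]
      refine MeasurableSet.iInter fun j => ?_
      have hl2 : Measurable fun z : E n × E n => (z.2 - z.1) j := by fun_prop
      exact (measurableSet_le measurable_const hl2).inter
        (measurableSet_le hl2 (hlen.comp measurable_fst))
    have hc : ∀ j, Measurable fun z : E n × E n =>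
        cubeWeight (len z.1) (α j) ((z.2 - z.1) j) := by
      intro j
      unfold cubeWeight
      have hl : Measurable fun z : E n × E n => len z.1 := hlen.comp measurable_fst
      cases α j
      · exact hl.inv
      · have hl2 : Measurable fun z : E n × E n => (z.2 - z.1) j := by fun_prop
        exact ((hl.sub hl2).div hl).neg
    exact (Finset.measurable_fun_prod Finset.univ fun j _ => hc j).indicator hm
  have hKm : ∀ α, Measurable (Function.uncurry (K α)) := by
    intro α
    refine Complex.measurable_ofReal.comp ?_
    exact (((hwm α).mul ((hS α).comp measurable_snd)).div
      (hh.coe_nnreal_real.comp measurable_snd)).indicator (measurable_fst hΩ)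
  have hbA : ∀ α, ∀ᵐ η ∂μ, eLpNorm (fun x => b α x η) p volume ≤ A := by
    intro α
    refine (withDensity_absolutelyContinuous _ _).ae_le ?_
    filter_upwards [ae_restrict_mem hU] with η hη
    have h1 := eLpNorm_const_smul (p := p) (μ := (volume : Measure (E n))) ((S α η)⁻¹ : ℂ)
      (fun x => D α x η)
    have h2 : (fun x => b α x η) = ((S α η)⁻¹ : ℂ) • fun x => D α x η := rfl
    rw [h2, h1]
    calc _ ≤ ‖((S α η)⁻¹ : ℂ)‖ₑ * (A * ENNReal.ofReal (S α η)) := by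
          gcongr
          exact hDA α η hη
      _ = A := by
        rw [← Complex.ofReal_inv, ← ofReal_norm, Complex.norm_real,
          Real.norm_of_nonneg (inv_nonneg.2 (hS0 α η hη).le), mul_left_comm,
          ← ENNReal.ofReal_mul (inv_nonneg.2 (hS0 α η hη).le), inv_mul_cancel₀ (hS0 α η hη).ne']
        simp
  -- On the cube h|K|² is at most len^(2|α|-2n) S²/h. By `hQS` its product with wt is at most Q
  -- len⁻ⁿ, and the cube has volume lenⁿ.
  have hKQ : ∀ α ξ, wt ξ * ∫⁻ η, ‖K α ξ η‖ₑ ^ 2 ∂μ ≤ Q := by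
    intro α ξ
    by_cases hξ : ξ ∈ Ω
    swap
    · simp [hK, hξ]
    have hl := hlen0 ξ hξ
    have hKξ : Measurable fun η => ‖K α ξ η‖ₑ ^ 2 :=
      ((hKm α).comp measurable_prodMk_left).enorm.pow_const 2
    rw [hμ, lintegral_withDensity_eq_lintegral_mul _ hh.coe_nnreal_ennreal hKξ,
      ← lintegral_const_mul _ (hh.coe_nnreal_ennreal.mul hKξ)]
    calc _ ≤ ∫⁻ η in U, (cubeSet n (len ξ)).indicator
          (fun _ => Q * ENNReal.ofReal ((len ξ ^ n)⁻¹)) (η - ξ) := by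
          refine setLIntegral_mono' hU fun η hη => ?_
          by_cases hc : η - ξ ∈ cubeSet n (len ξ)
          swap
          · simp [hK, hw, hc]
          rw [Set.indicator_of_mem hc]
          have hh1 := hh0 η hη
          have hS1 := hS0 α η hη
          have hK1 : ‖K α ξ η‖ₑ ^ 2 = ENNReal.ofReal
              ((∏ j, cubeWeight (len ξ) (α j) ((η - ξ) j)) ^ 2 * S α η ^ 2 / h η ^ 2) := by
            simp only [hK, hw, Set.indicator_of_mem hξ, Set.indicator_of_mem hc]
            rw [← ofReal_norm, Complex.norm_real, ← ENNReal.ofReal_pow (norm_nonneg _),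
              Real.norm_eq_abs, sq_abs, div_pow, mul_pow]
          have hw1 := abs_prod_cubeWeight_le hl α hc
          have hw2 : (∏ j, cubeWeight (len ξ) (α j) ((η - ξ) j)) ^ 2 ≤
              len ξ ^ (2 * bitCount α) * ((len ξ ^ n)⁻¹) ^ 2 := by
            rw [← sq_abs, mul_comm 2, pow_mul, ← mul_pow]
            gcongr
          have hh2 : (0 : ℝ) < h η := hh1
          have h3 : (h η : ℝ≥0∞) * ‖K α ξ η‖ₑ ^ 2 ≤
              ENNReal.ofReal (S α η ^ 2 * len ξ ^ (2 * bitCount α)) *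
                ENNReal.ofReal (((len ξ ^ n)⁻¹) ^ 2 / h η) := by
            rw [hK1, ← ENNReal.ofReal_coe_nnreal, ← ENNReal.ofReal_mul hh2.le,
              ← ENNReal.ofReal_mul (by positivity)]
            refine ENNReal.ofReal_le_ofReal ?_
            calc (h η : ℝ) * ((∏ j, cubeWeight (len ξ) (α j) ((η - ξ) j)) ^ 2 * S α η ^ 2 / h η ^ 2)
                = (∏ j, cubeWeight (len ξ) (α j) ((η - ξ) j)) ^ 2 * (S α η ^ 2 / h η) := by
                  field_simp
              _ ≤ (len ξ ^ (2 * bitCount α) * ((len ξ ^ n)⁻¹) ^ 2) * (S α η ^ 2 / h η) := by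
                  gcongr
              _ = _ := by ring
          calc wt ξ * ((h η : ℝ≥0∞) * ‖K α ξ η‖ₑ ^ 2)
              ≤ wt ξ * (ENNReal.ofReal (S α η ^ 2 * len ξ ^ (2 * bitCount α)) *
                ENNReal.ofReal (((len ξ ^ n)⁻¹) ^ 2 / h η)) := by gcongr
            _ ≤ Q * ENNReal.ofReal (h η * len ξ ^ n) *
                ENNReal.ofReal (((len ξ ^ n)⁻¹) ^ 2 / h η) := by
                rw [← mul_assoc]
                exact mul_le_mul_left (hQS α ξ hξ η hη hc) _
            _ = Q * ENNReal.ofReal ((len ξ ^ n)⁻¹) := by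
                rw [mul_assoc, ← ENNReal.ofReal_mul (by positivity)]
                congr 2
                field_simp
      _ ≤ ∫⁻ η, (cubeSet n (len ξ)).indicator
          (fun _ => Q * ENNReal.ofReal ((len ξ ^ n)⁻¹)) (η - ξ) := setLIntegral_le_lintegral _ _
      _ = Q := by
          rw [lintegral_sub_right_eq_self (fun η => (cubeSet n (len ξ)).indicator
            (fun _ => Q * ENNReal.ofReal ((len ξ ^ n)⁻¹)) η) ξ,
            lintegral_indicator (measurableSet_cubeSet _), setLIntegral_const, volume_cubeSet,
            mul_assoc, ← ENNReal.ofReal_pow hl.le, ← ENNReal.ofReal_mul (by positivity),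
            inv_mul_cancel₀ (by positivity), ENNReal.ofReal_one, mul_one]
  have hint : ∀ α x, ∀ ξ ∈ Ω, ∫ η, K α ξ η * b α x η ∂μ =
      ∫ t in Set.Icc (0 : Fin n → ℝ) (fun _ => len ξ),
        (∏ j, cubeWeight (len ξ) (α j) (t j)) • D α x (ξ + ∑ j, t j • basisVec j) := by
    intro α x ξ hξ
    rw [integral_cube_eq, hμ, integral_withDensity_eq_integral_smul hh,
      ← integral_indicator hU]
    refine integral_congr_ae (ae_of_all _ fun η => ?_)
    by_cases hc : η - ξ ∈ cubeSet n (len ξ)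
    · have hη := hbox ξ hξ η hc
      have hS1 : (S α η : ℂ) ≠ 0 := Complex.ofReal_ne_zero.2 (hS0 α η hη).ne'
      have hh1 : ((h η : ℝ) : ℂ) ≠ 0 :=
        Complex.ofReal_ne_zero.2 (NNReal.coe_ne_zero.2 (hh0 η hη).ne')
      simp only [hK, hw, hbdef, Set.indicator_of_mem hξ, Set.indicator_of_mem hc,
        Set.indicator_of_mem hη]
      rw [NNReal.smul_def, Complex.real_smul, Complex.real_smul]
      push_cast
      field_simp
    · simp [hK, hw, hc]
  have key := fun α => amplitude_bound_of_measurable he hb hwt hwt1 HF (hbm α) hp hr hA (hbA α)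
    (hKm α) hQ (hKQ α) hv hvm
  have hsum : ∀ᵐ x, ∀ ξ, e x ξ * v ξ * g x ξ =
      ∑ α : Fin n → Bool, e x ξ * v ξ * ∫ η, K α ξ η * b α x η ∂μ := by
    filter_upwards [hg] with x hx ξ
    by_cases hξ : ξ ∈ Ω
    · rw [hx ξ hξ, ← Finset.mul_sum]
      exact congrArg _ (Finset.sum_congr rfl fun α _ => (hint α x ξ hξ).symm)
    · simp [hv0 ξ hξ]
  have hall : ∀ᵐ x, ∀ α, Integrable fun ξ => e x ξ * v ξ * ∫ η, K α ξ η * b α x η ∂μ :=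
    ae_all_iff.2 fun α => (key α).1
  refine ⟨?_, ?_⟩
  · filter_upwards [hsum, hall] with x hx hx2
    simp only [hx]
    exact integrable_finsetSum _ fun α _ => hx2 α
  · have heq : (fun x => ∫ ξ, e x ξ * v ξ * g x ξ) =ᵐ[volume]
        ∑ α : Fin n → Bool, fun x => ∫ ξ, e x ξ * v ξ * ∫ η, K α ξ η * b α x η ∂μ := by
      filter_upwards [hsum, hall] with x hx hx2
      simp only [hx]
      rw [integral_finsetSum _ fun α _ => hx2 α, Finset.sum_apply]
    have hmeas := fun α : Fin n → Bool =>
      stronglyMeasurable_integral_integral (μ := μ) he hvm (hKm α) (hbm α)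
    rw [eLpNorm_congr_ae heq]
    refine (eLpNorm_sum_le (fun α _ => (hmeas α).aestronglyMeasurable) hr1).trans ?_
    refine (Finset.sum_le_card_nsmul _ _ _ fun α _ => (key α).2).trans (le_of_eq ?_)
    rw [nsmul_eq_mul, hμuniv]
    simp

end CubeAmplitude

/-! ### Uniform L² bounds and phases linear in ξ -/

section LinearPhase

variable {n : ℕ}

/-- The operators `v ↦ ∫ e k (x, ξ) v(ξ) dξ` are bounded on `L²`, uniformly in `k`, for integrable
functions `v` vanishing outside `Ω`. -/
def UniformL2Bound {κ : Type*} (e : κ → E n → E n → ℂ) (Ω : Set (E n)) : Prop :=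
  ∃ M : ℝ≥0∞, M < ⊤ ∧ ∀ k, ∀ v : E n → ℂ, Integrable v → (∀ ξ ∉ Ω, v ξ = 0) →
    ∫⁻ x, ‖∫ ξ, e k x ξ * v ξ‖ₑ ^ 2 ≤ M * ∫⁻ ξ, ‖v ξ‖ₑ ^ 2

theorem enorm_add_sq_le {F : Type*} [NormedAddCommGroup F] (a b : F) :
    ‖a + b‖ₑ ^ 2 ≤ 2 * ‖a‖ₑ ^ 2 + 2 * ‖b‖ₑ ^ 2 := by
  calc ‖a + b‖ₑ ^ 2 ≤ (‖a‖ₑ + ‖b‖ₑ) ^ 2 := by gcongr; exact enorm_add_le a b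
    _ ≤ 2 ^ (2 - 1) * (‖a‖ₑ ^ 2 + ‖b‖ₑ ^ 2) := by
        have := ENNReal.rpow_add_le_mul_rpow_add_rpow ‖a‖ₑ ‖b‖ₑ (p := 2) (by norm_num)
        norm_num at this ⊢
        exact_mod_cast this
    _ = _ := by norm_num; ring

namespace UniformL2Bound

variable {κ : Type*} {e : κ → E n → E n → ℂ} {Ω Ω₁ Ω₂ : Set (E n)}

theorem of_measurable (hΩ : MeasurableSet Ω) {M : ℝ≥0∞} (hM : M < ⊤)
    (H : ∀ k, ∀ v : E n → ℂ, Integrable v → Measurable v → (∀ ξ ∉ Ω, v ξ = 0) →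
      ∫⁻ x, ‖∫ ξ, e k x ξ * v ξ‖ₑ ^ 2 ≤ M * ∫⁻ ξ, ‖v ξ‖ₑ ^ 2) : UniformL2Bound e Ω := by
  refine ⟨M, hM, fun k v hv hv0 => ?_⟩
  set v' := Ω.indicator (hv.1.mk v) with hv'
  have hae : v =ᵐ[volume] v' := by
    filter_upwards [hv.1.ae_eq_mk] with ξ hξ
    by_cases h : ξ ∈ Ω
    · simpa [hv', h] using hξ
    · simp [hv', h, hv0 ξ h]
  have h1 := H k v' (hv.congr hae) (hv.1.stronglyMeasurable_mk.measurable.indicator hΩ)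
    fun ξ hξ => by simp [hv', hξ]
  have h2 : ∀ x, ∫ ξ, e k x ξ * v ξ = ∫ ξ, e k x ξ * v' ξ := fun x =>
    integral_congr_ae (hae.mono fun ξ hξ => by simp only [hξ])
  have h3 : ∫⁻ ξ, ‖v ξ‖ₑ ^ 2 = ∫⁻ ξ, ‖v' ξ‖ₑ ^ 2 :=
    lintegral_congr_ae (hae.mono fun ξ hξ => by simp only [hξ])
  simpa only [h2, h3] using h1

theorem mono (h : UniformL2Bound e Ω₂) (hs : Ω₁ ⊆ Ω₂) : UniformL2Bound e Ω₁ := by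
  obtain ⟨M, hM, H⟩ := h
  exact ⟨M, hM, fun k v hv hv0 => H k v hv fun ξ hξ => hv0 ξ fun h => hξ (hs h)⟩

theorem integrable_mul {e : E n → E n → ℂ} (he : Measurable (Function.uncurry e))
    (hb : ∀ x ξ, ‖e x ξ‖ ≤ 1) {v : E n → ℂ} (hv : Integrable v) (x : E n) :
    Integrable fun ξ => e x ξ * v ξ :=
  hv.bdd_mul (he.comp measurable_prodMk_left).aestronglyMeasurable
    (ae_of_all _ (hb x))

/-- The splitting is required only for almost every x, since the integral of one piece may converge
only there. -/
theorem add_of_eq {e e₁ e₂ : κ → E n → E n → ℂ} {M₁ M₂ : ℝ≥0∞} {k : κ} {v v₁ v₂ : E n → ℂ}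
    (he₁ : Measurable (Function.uncurry (e₁ k))) (hv₁ : AEStronglyMeasurable v₁ volume)
    (heq : ∀ᵐ x, ∫ ξ, e k x ξ * v ξ = (∫ ξ, e₁ k x ξ * v₁ ξ) + ∫ ξ, e₂ k x ξ * v₂ ξ)
    (h₁ : ∫⁻ x, ‖∫ ξ, e₁ k x ξ * v₁ ξ‖ₑ ^ 2 ≤ M₁ * ∫⁻ ξ, ‖v ξ‖ₑ ^ 2)
    (h₂ : ∫⁻ x, ‖∫ ξ, e₂ k x ξ * v₂ ξ‖ₑ ^ 2 ≤ M₂ * ∫⁻ ξ, ‖v ξ‖ₑ ^ 2) :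
    ∫⁻ x, ‖∫ ξ, e k x ξ * v ξ‖ₑ ^ 2 ≤ (2 * M₁ + 2 * M₂) * ∫⁻ ξ, ‖v ξ‖ₑ ^ 2 := by
  have hm := (aestronglyMeasurable_integral_mul (ν := (volume : Measure (E n))) hv₁ he₁).enorm
  calc _ ≤ ∫⁻ x, (2 * ‖∫ ξ, e₁ k x ξ * v₁ ξ‖ₑ ^ 2 + 2 * ‖∫ ξ, e₂ k x ξ * v₂ ξ‖ₑ ^ 2) := by
        refine lintegral_mono_ae ?_
        filter_upwards [heq] with x hx
        rw [hx]
        exact enorm_add_sq_le _ _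
    _ = 2 * (∫⁻ x, ‖∫ ξ, e₁ k x ξ * v₁ ξ‖ₑ ^ 2) + 2 * ∫⁻ x, ‖∫ ξ, e₂ k x ξ * v₂ ξ‖ₑ ^ 2 := by
        rw [lintegral_add_left' ((hm.pow_const 2).const_mul 2), lintegral_const_mul' _ _ (by simp),
          lintegral_const_mul' _ _ (by simp)]
    _ ≤ 2 * (M₁ * ∫⁻ ξ, ‖v ξ‖ₑ ^ 2) + 2 * (M₂ * ∫⁻ ξ, ‖v ξ‖ₑ ^ 2) := by gcongr
    _ = _ := by ring

theorem union (he : ∀ k, Measurable (Function.uncurry (e k))) (hb : ∀ k x ξ, ‖e k x ξ‖ ≤ 1)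
    (hΩ : MeasurableSet Ω₁) (h₁ : UniformL2Bound e Ω₁) (h₂ : UniformL2Bound e Ω₂) :
    UniformL2Bound e (Ω₁ ∪ Ω₂) := by
  obtain ⟨M₁, hM₁, H₁⟩ := h₁
  obtain ⟨M₂, hM₂, H₂⟩ := h₂
  refine ⟨2 * M₁ + 2 * M₂, by finiteness, fun k v hv hv0 => ?_⟩
  have hi₁ := hv.indicator hΩ
  have hi₂ := hv.indicator hΩ.compl
  refine add_of_eq (he k) hi₁.1 (ae_of_all _ fun x => ?_)
    ((H₁ k _ hi₁ fun ξ hξ => by simp [hξ]).trans (by gcongr; exact enorm_indicator_le_enorm_self v _))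
    ((H₂ k _ hi₂ fun ξ hξ => ?_).trans (by gcongr; exact enorm_indicator_le_enorm_self v _))
  · rw [← integral_add (integrable_mul (he k) (hb k) hi₁ x) (integrable_mul (he k) (hb k) hi₂ x)]
    simp only [← mul_add, Set.indicator_self_add_compl_apply]
  · by_cases h : ξ ∈ Ω₁
    · simp [h]
    · simpa [h] using hv0 ξ fun h' => h'.elim h hξ

theorem biUnion (he : ∀ k, Measurable (Function.uncurry (e k))) (hb : ∀ k x ξ, ‖e k x ξ‖ ≤ 1)
    {τ : Type*} (t : Finset τ) {Ω : τ → Set (E n)} (hΩ : ∀ i, MeasurableSet (Ω i))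
    (h : ∀ i ∈ t, UniformL2Bound e (Ω i)) : UniformL2Bound e (⋃ i ∈ t, Ω i) := by
  classical
  induction t using Finset.induction_on with
  | empty =>
    refine ⟨0, by simp, fun k v _ hv0 => ?_⟩
    have : v = 0 := funext fun ξ => hv0 ξ (by simp)
    simp [this]
  | insert i t hi ih =>
    rw [Finset.set_biUnion_insert]
    exact union he hb (hΩ i) (h i (by simp)) (ih fun j hj => h j (by simp [hj]))

end UniformL2Bound

theorem pderiv_inner (y : E n) (j : Fin n) :
    pderiv j (fun ξ : E n => (inner ℝ y ξ : ℝ)) = fun _ => y j := by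
  funext ξ
  have h : HasFDerivAt (fun ξ : E n => (inner ℝ y ξ : ℝ)) (innerSL ℝ y) ξ :=
    (innerSL ℝ y).hasFDerivAt
  rw [pderiv, h.fderiv]
  simp [EuclideanSpace.inner_single_right]

theorem wderiv_inner_of_two_le (y : E n) (l : List (Fin n)) (hl : 2 ≤ l.length) :
    wderiv l (fun ξ : E n => (inner ℝ y ξ : ℝ)) = fun _ => 0 := by
  induction l with
  | nil => simp at hl
  | cons i l ih =>
    rw [wderiv_cons]
    rcases Nat.lt_or_ge l.length 2 with h | h
    · obtain ⟨j, rfl⟩ := List.length_eq_one_iff.1 (show l.length = 1 by simp at hl; omega)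
      rw [wderiv_cons, wderiv_nil, pderiv_inner, pderiv_const]
    · rw [ih h, pderiv_const]

theorem contDiff_inner_const (y : E n) : ContDiff ℝ ∞ fun ξ : E n => (inner ℝ y ξ : ℝ) :=
  (innerSL ℝ y).contDiff

/-- The factor `e^{i⟨Y(x), ξ⟩}`, cut off to the unit ball in `ξ`. -/
def linFactor (Y : E n → E n) (x ξ : E n) : ℂ :=
  (Metric.closedBall (0 : E n) 1).indicator
    (fun ξ => Complex.exp (Complex.I * ((inner ℝ (Y x) ξ : ℝ) : ℂ))) ξ

theorem norm_linFactor_le (Y : E n → E n) (x ξ : E n) : ‖linFactor Y x ξ‖ ≤ 1 := by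
  refine (norm_indicator_le_norm_self _ _).trans ?_
  rw [mul_comm, Complex.norm_exp_ofReal_mul_I]

theorem measurable_linFactor {Y : E n → E n} (hY : Continuous Y) :
    Measurable (Function.uncurry (linFactor Y)) := by
  have h1 : Measurable fun z : E n × E n =>
      Complex.exp (Complex.I * ((inner ℝ (Y z.1) z.2 : ℝ) : ℂ)) :=
    Continuous.measurable (by fun_prop)
  exact h1.indicator (measurable_snd Metric.isClosed_closedBall.measurableSet)

/-- A linear phase is smooth through the origin and its derivatives of order at least 2 vanish, so
the T T* bound applies on all of ℝⁿ with t = 1. Only differences of Y enter, never the size of Y. -/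
theorem exists_linFactor_bound (n : ℕ) (b : ℝ) {δ : ℝ} (hδ : 0 < δ) :
    ∃ M : ℝ≥0∞, M < ⊤ ∧ ∀ Y : E n → E n, Continuous Y →
      (∀ x y j, |Y x j - Y y j| ≤ b * ‖x - y‖) →
      (∀ x y, δ * ‖x - y‖ ^ 2 ≤ ∑ j, (Y x j - Y y j) ^ 2) → ∀ v : E n → ℂ, Integrable v →
        ∫⁻ x, ‖∫ ξ, linFactor Y x ξ * v ξ‖ₑ ^ 2 ≤ M * ∫⁻ ξ, ‖v ξ‖ₑ ^ 2 := by
  set κ := {Y : E n → E n // Continuous Y ∧ (∀ x y j, |Y x j - Y y j| ≤ b * ‖x - y‖) ∧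
    ∀ x y, δ * ‖x - y‖ ^ 2 ≤ ∑ j, (Y x j - Y y j) ^ 2}
  obtain ⟨M, hM, H⟩ := exists_lintegral_sq_le_of_phase (κ := κ) isOpen_univ
    (isCompact_closedBall (0 : E n) 1) (Set.subset_univ _) (fun Y x ξ => (inner ℝ (Y.1 x) ξ : ℝ))
    (fun Y x => (contDiff_inner_const _).contDiffOn) (fun l hl => by
      refine ⟨|b|, fun Y x y ξ _ => ?_⟩
      rcases Nat.lt_or_ge l.length 2 with h | h
      · obtain ⟨j, rfl⟩ := List.length_eq_one_iff.1 (show l.length = 1 by omega)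
        rw [wderiv_cons, wderiv_nil, pderiv_inner, wderiv_cons, wderiv_nil, pderiv_inner]
        refine (Y.2.2.1 x y j).trans ?_
        gcongr
        exact le_abs_self b
      · rw [wderiv_inner_of_two_le _ _ h, wderiv_inner_of_two_le _ _ h]
        simp only [sub_self, abs_zero]
        positivity)
    hδ (fun Y x y ξ _ => by
      simp only [pderiv_inner]
      exact Y.2.2.2 x y)
  refine ⟨M, hM, fun Y hY hYb hYδ v hv => ?_⟩
  set B := Metric.closedBall (0 : E n) 1
  have hB : MeasurableSet B := Metric.isClosed_closedBall.measurableSet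
  have h1 := H ⟨Y, hY, hYb, hYδ⟩ 1 one_pos
    (fun x ξ => Complex.exp (Complex.I * ((inner ℝ (Y x) ξ : ℝ) : ℂ)))
    (Continuous.measurable (by fun_prop))
    (fun x ξ => by rw [mul_comm, Complex.norm_exp_ofReal_mul_I]) (fun x ξ _ => by simp)
    (B.indicator v) (hv.indicator hB) (fun ξ hξ => by simp [hξ])
  have h2 : ∀ x ξ, linFactor Y x ξ * v ξ =
      Complex.exp (Complex.I * ((inner ℝ (Y x) ξ : ℝ) : ℂ)) * B.indicator v ξ := fun x ξ => by
    by_cases h : ξ ∈ B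
    · rw [linFactor, Set.indicator_of_mem h, Set.indicator_of_mem h]
    · rw [linFactor, Set.indicator_of_notMem h, Set.indicator_of_notMem h]
      simp
  simp only [h2]
  refine h1.trans ?_
  gcongr
  exact enorm_indicator_le_enorm_self v _

end LinearPhase

/-! ### Linearisation of the phase in a cone -/

section LowFrequency

variable {n : ℕ}

/-- The open truncated cone of directions close to `u`. -/
def openCone (u : E n) : Set (E n) := {ξ | ‖ξ‖ < 2 * n * inner ℝ u ξ ∧ ‖ξ‖ < 2}

theorem isOpen_openCone (u : E n) : IsOpen (openCone u) :=
  (isOpen_lt continuous_norm (by fun_prop)).inter (isOpen_lt continuous_norm continuous_const)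

theorem openCone_subset (u : E n) : openCone u ⊆ {ξ | ξ ≠ 0} := by
  rintro ξ ⟨h, -⟩ rfl
  simp at h

theorem measurable_indicator_wderiv {Φ : E n × E n → ℂ}
    (hΦ : ContDiffOn ℝ ∞ Φ {z | z.2 ≠ 0}) {U : Set (E n)} (hU : MeasurableSet U)
    (hU0 : U ⊆ {ξ | ξ ≠ 0}) (l : List (Fin n)) :
    Measurable (Function.uncurry fun x ξ => U.indicator (wderiv l fun ζ => Φ (x, ζ)) ξ) := by
  have h1 : ∀ z ∈ {z : E n × E n | z.2 ≠ 0}, wderiv l (fun ζ => Φ (z.1, ζ)) z.2 =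
      dirDeriv (l.map fun j => ((0 : E n), (basisVec j : E n))) Φ z := by
    rintro ⟨x, ξ⟩ hξ
    have := dirDeriv_comp_affine (isOpen_snd_ne_zero (n := n)) hΦ
      (ContinuousLinearMap.inr ℝ (E n) (E n)) (x, 0) (l.map basisVec) ξ (by simpa using hξ)
    simpa [wderiv, Function.comp_def] using this
  have h2 : ContinuousOn (fun z : E n × E n => wderiv l (fun ζ => Φ (z.1, ζ)) z.2)
      {z | z.2 ≠ 0} := (contDiffOn_dirDeriv isOpen_snd_ne_zero hΦ _).continuousOn.congr h1
  have hm : MeasurableSet {z : E n × E n | z.2 ∈ U} := measurable_snd hU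
  refine measurable_of_restrict_of_restrict_compl hm ?_ ?_
  · have h3 : ContinuousOn (Function.uncurry fun x ξ => U.indicator (wderiv l fun ζ => Φ (x, ζ)) ξ)
        {z : E n × E n | z.2 ∈ U} :=
      (h2.mono fun z hz => hU0 hz).congr fun z hz => Set.indicator_of_mem (s := U) (a := z.2) hz _
    exact (continuousOn_iff_continuous_domRestrict.1 h3).measurable
  · convert measurable_const (a := (0 : ℂ)) using 1
    ext ⟨z, hz⟩
    exact Set.indicator_of_notMem (s := U) (a := z.2) hz _

/-- Both endpoints lie in the half-space ⟨u, ζ⟩ ≥ |ξ|/(2n), hence so does the segment, which stays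
away from the singularity at 0. -/
theorem norm_segment_ge {u ξ : E n} (hξ : ξ ∈ openCone u) (hu : ‖u‖ = 1) (hn : 1 ≤ n) {ζ : E n}
    (hζ : ζ ∈ segment ℝ (‖ξ‖ • u) ξ) : ‖ξ‖ / (2 * n) ≤ ‖ζ‖ := by
  have hn' : (1 : ℝ) ≤ n := by exact_mod_cast hn
  have h1 : ‖ξ‖ / (2 * n) ≤ inner ℝ u ξ := by
    rw [div_le_iff₀ (by positivity), mul_comm]
    exact hξ.1.le
  have h2 : ‖ξ‖ / (2 * n) ≤ inner ℝ u (‖ξ‖ • u) := by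
    rw [inner_smul_right, real_inner_self_eq_norm_sq, hu, one_pow, mul_one]
    exact div_le_self (norm_nonneg _) (by linarith)
  have h3 : Convex ℝ {ζ : E n | ‖ξ‖ / (2 * n) ≤ inner ℝ u ζ} :=
    convex_halfSpace_ge (innerSL ℝ u).isLinear _
  have h4 : ‖ξ‖ / (2 * n) ≤ inner ℝ u ζ := h3.segment_subset h2 h1 hζ
  refine h4.trans ((real_inner_le_norm u ζ).trans ?_)
  rw [hu, one_mul]

section

variable {B : (Fin n → ℕ) → (Fin n → ℕ) → ℝ}

/-- The remainder of the linearization of `φ(x, ·)` at the direction `u`. -/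
def phaseRemainder (φ : E n → E n → ℝ) (u x ξ : E n) : ℝ :=
  φ x ξ - inner ℝ (WithLp.toLp 2 fun j => pderiv j (φ x) u : E n) ξ

theorem IsPhaseWith.contDiffOn_phaseRemainder {k : ℕ} {φ : E n → E n → ℝ} (h : IsPhaseWith k B φ)
    (u x : E n) : ContDiffOn ℝ ∞ (phaseRemainder φ u x) {ξ | ξ ≠ 0} :=
  (h.contDiffOn_right x).sub (contDiff_inner_const _).contDiffOn

theorem IsPhaseWith.wderiv_phaseRemainder {k : ℕ} {φ : E n → E n → ℝ} (h : IsPhaseWith k B φ)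
    (u x : E n) {ξ : E n} (hξ : ξ ≠ 0) (l : List (Fin n)) :
    wderiv l (phaseRemainder φ u x) ξ = wderiv l (φ x) ξ -
      wderiv l (fun ξ => inner ℝ (WithLp.toLp 2 fun j => pderiv j (φ x) u : E n) ξ) ξ := by
  have := wderiv_linear_comb isOpen_ne_zero (h.contDiffOn_right x)
    (contDiff_inner_const (WithLp.toLp 2 fun j => pderiv j (φ x) u : E n)).contDiffOn 1 (-1) l hξ
  simp only [one_mul, neg_mul, ← sub_eq_add_neg] at this
  exact this

theorem IsPhaseWith.pderiv_phaseRemainder {k : ℕ} {φ : E n → E n → ℝ} (h : IsPhaseWith k B φ)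
    (u x : E n) {ξ : E n} (hξ : ξ ≠ 0) (j : Fin n) :
    pderiv j (phaseRemainder φ u x) ξ = pderiv j (φ x) ξ - pderiv j (φ x) u := by
  have := h.wderiv_phaseRemainder u x hξ [j]
  simp only [wderiv_cons, wderiv_nil, pderiv_inner] at this
  exact this

/-- By homogeneity of degree 0, ∇_ξφ(x, u) = ∇_ξφ(x, |ξ|u). Between |ξ|u and ξ the second
derivatives are O(1/|ξ|) and the distance is at most 2|ξ|, so the mean value theorem gives a
constant. -/
theorem exists_abs_pderiv_phaseRemainder_le (hn : 1 ≤ n) (B : (Fin n → ℕ) → (Fin n → ℕ) → ℝ)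
    {u : E n} (hu : ‖u‖ = 1) (j : Fin n) :
    ∃ C : ℝ, 0 ≤ C ∧ ∀ φ, IsPhaseWith 2 B φ → ∀ x, ∀ ξ ∈ openCone u,
      |pderiv j (phaseRemainder φ u x) ξ| ≤ C := by
  set b : ℝ := ∑ i, |B (fun k => [i, j].count k) 0| with hb
  have hn' : (1 : ℝ) ≤ n := by exact_mod_cast hn
  refine ⟨(n * b) * (2 * n) * 2, by positivity, fun φ h x ξ hξ => ?_⟩
  have hξ0 : ξ ≠ 0 := openCone_subset u hξ
  have hξp : 0 < ‖ξ‖ := norm_pos_iff.2 hξ0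
  have hu0 : u ≠ 0 := by
    rintro rfl
    simp at hu
  rw [h.pderiv_phaseRemainder u x hξ0, ← h.pderiv_smul x u hu0 hξp j]
  have hseg : ∀ ζ ∈ segment ℝ (‖ξ‖ • u) ξ, ζ ≠ 0 := fun ζ hζ => by
    have h1 := norm_segment_ge hξ hu hn hζ
    exact norm_pos_iff.1 (lt_of_lt_of_le (by positivity) h1)
  have hd : ∀ ζ ∈ segment ℝ (‖ξ‖ • u) ξ, DifferentiableAt ℝ (pderiv j (φ x)) ζ := fun ζ hζ =>
    ((contDiffOn_pderiv isOpen_ne_zero (h.contDiffOn_right x) j).contDiffAt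
      (isOpen_ne_zero.mem_nhds (hseg ζ hζ))).differentiableAt (by simp)
  have hbd : ∀ ζ ∈ segment ℝ (‖ξ‖ • u) ξ,
      ‖fderiv ℝ (pderiv j (φ x)) ζ‖ ≤ n * (b * (2 * n / ‖ξ‖)) := by
    intro ζ hζ
    refine norm_le_of_forall_basisVec _ (by positivity) fun i => ?_
    have h1 := h.abs_wderiv_le [i, j] (by simp) x ζ (hseg ζ hζ)
    refine h1.trans ?_
    have h2 : ‖ζ‖ ^ (1 - (([i, j] : List (Fin n)).length : ℤ)) ≤ 2 * n / ‖ξ‖ := by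
      rw [show (1 - (([i, j] : List (Fin n)).length : ℤ)) = -1 by simp, zpow_neg_one,
        inv_le_comm₀ (norm_pos_iff.2 (hseg ζ hζ)) (by positivity), inv_div]
      exact norm_segment_ge hξ hu hn hζ
    have h3 : B (fun k => [i, j].count k) 0 ≤ b := (le_abs_self _).trans
      (Finset.single_le_sum (f := fun i => |B (fun k => [i, j].count k) 0|)
        (fun _ _ => abs_nonneg _) (Finset.mem_univ i))
    calc _ ≤ b * ‖ζ‖ ^ (1 - (([i, j] : List (Fin n)).length : ℤ)) := by gcongr
      _ ≤ _ := by gcongr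
  have hmv := (convex_segment (‖ξ‖ • u) ξ).norm_image_sub_le_of_norm_fderiv_le (𝕜 := ℝ) hd hbd
    (left_mem_segment ℝ _ _) (right_mem_segment ℝ _ _)
  rw [Real.norm_eq_abs] at hmv
  refine hmv.trans ?_
  have h5 : ‖ξ - ‖ξ‖ • u‖ ≤ 2 * ‖ξ‖ := by
    refine (norm_sub_le _ _).trans ?_
    rw [norm_smul, hu, norm_norm]
    linarith
  calc n * (b * (2 * n / ‖ξ‖)) * ‖ξ - ‖ξ‖ • u‖ ≤ n * (b * (2 * n / ‖ξ‖)) * (2 * ‖ξ‖) := by gcongr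
    _ = _ := by field_simp

/-- For the remainder θ, Euler's relation θ = ∑ ξ_j ∂_jθ with bounded ∂_jθ gives |e^{iθ} - 1| ≤ |θ|
= O(|ξ|). The first derivatives i e^{iθ} ∂_jθ are symbols of order 0, because the higher derivatives
of θ are those of φ. -/
theorem symbolBound_phaseRemainder (hn : 1 ≤ n) (B : (Fin n → ℕ) → (Fin n → ℕ) → ℝ)
    {u : E n} (hu : ‖u‖ = 1) (k : ℕ) :
    SymbolBound (openCone u) (fun ξ => ‖ξ‖) k 1
      (fun i : {φ : E n → E n → ℝ // IsPhaseWith 2 B φ} × E n => fun ξ =>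
        Complex.exp (Complex.I * (phaseRemainder i.1.1 u i.2 ξ : ℂ)) - 1) := by
  have hs := isOpen_openCone u
  have hs0 := openCone_subset u
  have hW : ∀ ξ ∈ openCone u, 0 < ‖ξ‖ := fun ξ hξ => norm_pos_iff.2 (hs0 hξ)
  have hcd : ∀ i : {φ : E n → E n → ℝ // IsPhaseWith 2 B φ} × E n,
      ContDiffOn ℝ ∞ (phaseRemainder i.1.1 u i.2) (openCone u) := fun i =>
    (i.1.2.contDiffOn_phaseRemainder u i.2).mono hs0
  have hgrad : ∀ k j, SymbolBound (openCone u) (fun ξ => ‖ξ‖) k 0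
      (fun i : {φ : E n → E n → ℝ // IsPhaseWith 2 B φ} × E n =>
        pderiv j (phaseRemainder i.1.1 u i.2)) := by
    intro k j
    refine SymbolBound.of_wderiv hs (fun i => contDiffOn_pderiv hs (hcd i) j) fun l => ?_
    rcases l with - | ⟨i, l⟩
    · obtain ⟨C, -, hC⟩ := exists_abs_pderiv_phaseRemainder_le hn B hu j
      exact ⟨C, fun i ξ hξ => by simpa using hC i.1.1 i.1.2 i.2 ξ hξ⟩
    · refine ⟨B (fun k => (i :: l ++ [j]).count k) 0, fun p ξ hξ => ?_⟩
      have h1 : wderiv (i :: l) (pderiv j (phaseRemainder p.1.1 u p.2)) ξ =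
          wderiv (i :: l ++ [j]) (phaseRemainder p.1.1 u p.2) ξ := by
        rw [wderiv_append]
        rfl
      rw [h1, p.1.2.wderiv_phaseRemainder u p.2 (hs0 hξ), wderiv_inner_of_two_le _ _ (by simp),
        sub_zero]
      have h2 := p.1.2.abs_wderiv_le (i :: l ++ [j]) (by simp) p.2 ξ (hs0 hξ)
      rw [Real.norm_eq_abs]
      convert h2 using 3
      simp
  have hexp := SymbolBound.cexp hs hW (fun ξ hξ => hξ.2.le)
    (fun i => (hcd i).differentiableOn (by simp)) (hgrad k)
  have hdc : ∀ i : {φ : E n → E n → ℝ // IsPhaseWith 2 B φ} × E n, ∀ ξ ∈ openCone u,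
      DifferentiableAt ℝ (fun ξ => (phaseRemainder i.1.1 u i.2 ξ : ℂ)) ξ := fun i ξ hξ =>
    Complex.ofRealCLM.differentiableAt.comp ξ
      (((hcd i).contDiffAt (hs.mem_nhds hξ)).differentiableAt (by simp))
  refine SymbolBound.of_pderiv ?_ ?_ ?_
  · choose C hC0 hC using exists_abs_pderiv_phaseRemainder_le hn B hu
    refine ⟨∑ j, C j, fun i ξ hξ => ?_⟩
    have h1 : phaseRemainder i.1.1 u i.2 ξ =
        ∑ j, ξ j * pderiv j (phaseRemainder i.1.1 u i.2) ξ := by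
      simp only [i.1.2.pderiv_phaseRemainder u i.2 (hs0 hξ), mul_sub, Finset.sum_sub_distrib]
      rw [← i.1.2.euler i.2 ξ (hs0 hξ), phaseRemainder, PiLp.inner_apply]
      simp
    have h2 := Real.norm_exp_I_mul_ofReal_sub_one_le (x := phaseRemainder i.1.1 u i.2 ξ)
    refine h2.trans ?_
    rw [h1, zpow_one, Real.norm_eq_abs, Finset.sum_mul]
    refine (Finset.abs_sum_le_sum_abs _ _).trans (Finset.sum_le_sum fun j _ => ?_)
    rw [abs_mul, mul_comm]
    exact mul_le_mul (hC j _ i.1.2 i.2 ξ hξ) (abs_apply_le_norm ξ j) (abs_nonneg _) (hC0 j)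
  · intro i ξ hξ
    exact ((((hdc i ξ hξ).const_mul Complex.I).cexp).sub_const 1).differentiableWithinAt
  · intro j
    have h3 := (hexp.mul hs hW ((hgrad k j).ofReal hs)).const_mul hs hW Complex.I
    refine SymbolBound.congr hs (fun i ξ hξ => ?_) h3
    rw [pderiv_sub_const, pderiv_cexp ((hdc i ξ hξ).const_mul _),
      pderiv_mul (differentiableAt_const _) (hdc i ξ hξ), pderiv_const, pderiv_ofReal
        (((hcd i).contDiffAt (hs.mem_nhds hξ)).differentiableAt (by simp))]
    ring

end

end LowFrequency

/-! ### The L² bound for frequencies in the unit ball -/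

section ConeBound

variable {n : ℕ}

/-- The closed truncated cone of directions close to `u`, without its vertex. -/
def closedCone (u : E n) : Set (E n) := {ξ | 0 < ‖ξ‖ ∧ ‖ξ‖ ≤ 1 ∧ ‖ξ‖ ≤ n * inner ℝ u ξ}

theorem measurableSet_closedCone (u : E n) : MeasurableSet (closedCone u) := by
  have h1 : Measurable fun ξ : E n => (n : ℝ) * inner ℝ u ξ := Continuous.measurable (by fun_prop)
  exact (measurableSet_lt measurable_const measurable_norm).inter
    ((measurableSet_le measurable_norm measurable_const).inter
      (measurableSet_le measurable_norm h1))

theorem norm_le_of_mem_cubeSet {len : ℝ} {ζ : E n} (h : ζ ∈ cubeSet n len) : ‖ζ‖ ≤ n * len := by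
  calc ‖ζ‖ ≤ ∑ j, |ζ j| := norm_le_sum_abs ζ
    _ ≤ ∑ _j : Fin n, len := Finset.sum_le_sum fun j _ => by
        rw [abs_of_nonneg (h j).1]
        exact (h j).2
    _ = n * len := by simp

/-- The side is chosen so that |η - ξ| ≤ |ξ|/(4n), small enough to remain in the wider open cone. -/
theorem mem_openCone_of_cube (hn : 1 ≤ n) {u ξ η : E n} (hu : ‖u‖ = 1) (hξ : ξ ∈ closedCone u)
    (hη : η - ξ ∈ cubeSet n (‖ξ‖ / (4 * n ^ 2))) :
    η ∈ openCone u ∧ ‖ξ‖ / 2 ≤ ‖η‖ ∧ ‖η‖ ≤ 2 * ‖ξ‖ := by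
  have hn' : (1 : ℝ) ≤ n := by exact_mod_cast hn
  obtain ⟨h0, h1, h2⟩ := hξ
  have h3 := norm_le_of_mem_cubeSet hη
  have h4 : (n : ℝ) * (‖ξ‖ / (4 * n ^ 2)) = ‖ξ‖ / (4 * n) := by field_simp
  rw [h4, le_div_iff₀ (by positivity)] at h3
  have h5 : |inner ℝ u (η - ξ)| ≤ ‖η - ξ‖ := by
    simpa [hu] using abs_real_inner_le_norm u (η - ξ)
  rw [inner_sub_right, abs_le] at h5
  have h6 : ‖η‖ ≤ ‖ξ‖ + ‖η - ξ‖ := by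
    simpa using norm_add_le ξ (η - ξ)
  have h7 : ‖ξ‖ - ‖η - ξ‖ ≤ ‖η‖ := by
    have := norm_sub_norm_le ξ (ξ - η)
    rwa [sub_sub_cancel, norm_sub_rev ξ η] at this
  have h8 : ‖η - ξ‖ ≤ n * ‖η - ξ‖ := le_mul_of_one_le_left (norm_nonneg _) hn'
  refine ⟨⟨?_, by linarith⟩, by linarith, by linarith⟩
  have h9 : (n : ℝ) * (inner ℝ u ξ - ‖η - ξ‖) ≤ n * inner ℝ u η := by
    gcongr
    linarith [h5.1]
  nlinarith

/-- In polar coordinates the integrand is r^(2-n) r^(n-1) = r. -/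
theorem lintegral_openCone_lt_top (hn : 1 ≤ n) (u : E n) :
    ∫⁻ η in openCone u, ((‖η‖₊ ^ (2 - n : ℤ) : ℝ≥0) : ℝ≥0∞) < ⊤ := by
  have hnt : Nontrivial (E n) :=
    Module.nontrivial_of_finrank_pos (R := ℝ) (by rw [finrank_euclideanSpace_fin]; omega)
  have h1 : IntegrableOn (fun x : E n => ‖x‖ ^ (2 - n : ℤ)) (Metric.ball 0 2) volume := by
    rw [integrableOn_fun_norm_addHaar (volume : Measure (E n)) (f := fun y => y ^ (2 - n : ℤ))]
    have h2 : IntegrableOn (fun y : ℝ => y) (Set.Ioo 0 2) :=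
      (continuous_id.integrableOn_Icc).mono_set Set.Ioo_subset_Icc_self
    refine h2.congr_fun (fun y hy => ?_) measurableSet_Ioo
    rw [finrank_euclideanSpace_fin, smul_eq_mul, ← zpow_natCast, ← zpow_add₀ hy.1.ne']
    push_cast [hn]
    ring_nf
    simp
  have h2 := h1.2
  refine lt_of_le_of_lt (lintegral_mono' (Measure.restrict_mono (fun ξ hξ => ?_) le_rfl)
    fun η => ?_) h2
  · simpa using hξ.2
  · rw [← enorm_norm, Real.enorm_eq_ofReal_abs, abs_norm, ← ENNReal.ofReal_coe_nnreal]
    refine ENNReal.ofReal_le_ofReal ?_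
    simp

/-- For l comparable to t both sides are of size t². This is the condition `hQS` of
`amplitude_bound_of_cube` for a symbol of order 1 and the density |η|^(2-n). -/
theorem zpow_sq_mul_pow_le {t l b : ℝ} (ht : 0 < t) (hl : 0 < l) (h1 : l ≤ t) (h2 : t ≤ b * l)
    (k n : ℕ) :
    (t ^ (1 - k : ℤ)) ^ 2 * l ^ (2 * k) ≤ b ^ n * (t ^ (2 - n : ℤ) * l ^ n) := by
  have e1 : t ^ (1 - k : ℤ) = t / t ^ k := by rw [zpow_sub₀ ht.ne', zpow_one, zpow_natCast]
  have e2 : t ^ (2 - n : ℤ) = t ^ 2 / t ^ n := by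
    rw [zpow_sub₀ ht.ne', zpow_natCast]
    norm_cast
  have h3 : (l / t) ^ (2 * k) ≤ 1 := pow_le_one₀ (by positivity) ((div_le_one ht).2 h1)
  have h4 : 1 ≤ (b * l / t) ^ n := one_le_pow₀ ((one_le_div ht).2 h2)
  calc (t ^ (1 - k : ℤ)) ^ 2 * l ^ (2 * k) = t ^ 2 * (l / t) ^ (2 * k) := by
        rw [e1, div_pow, div_pow, ← pow_mul, mul_comm k 2]
        ring
    _ ≤ t ^ 2 * (b * l / t) ^ n := by
        gcongr
        exact h3.trans h4
    _ = _ := by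
        rw [e2, div_pow, mul_pow]
        ring

-- With Y(x) = ∇_ξφ(x, u), e^{iφ} = e^{i⟨Y(x),ξ⟩}(1 + Φ(x, ξ)). The first term is a linear phase. In
-- the second, Φ is a symbol of order 1 in |ξ|, bounded uniformly in x, so the cube expansion with p
-- = ∞, r = 2 inherits the bound of the linear phase.
set_option maxHeartbeats 600000 in
theorem exists_cone_bound (hn : 1 ≤ n) (B : (Fin n → ℕ) → (Fin n → ℕ) → ℝ) {c : ℝ} (hc : 0 < c)
    {u : E n} (hu : ‖u‖ = 1) :
    UniformL2Bound (fun φ : {φ : E n → E n → ℝ // IsPhaseWith 2 B φ ∧ SNDWith c φ} =>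
      oscFactor φ.1) (closedCone u) := by
  have hn' : (1 : ℝ) ≤ n := by exact_mod_cast hn
  have hu0 : u ≠ 0 := by
    rintro rfl
    simp at hu
  have hs := isOpen_openCone u
  have hs0 := openCone_subset u
  obtain ⟨δ, hδ, hlow⟩ := exists_gradient_bound_below B hc
  choose C hC0 hC using fun j : Fin n => exists_abs_wderiv_sub_le B [j] (by simp)
  obtain ⟨M, hM, HM⟩ := exists_linFactor_bound n (∑ j, C j) hδ
  have hsym : ∀ α : Fin n → Bool, ∃ A : ℝ, ∀ φ : {φ : E n → E n → ℝ // IsPhaseWith 2 B φ}, ∀ x,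
      ∀ ξ ∈ openCone u, ‖wderiv ((List.finRange n).filter fun j => α j) (fun ξ => Complex.exp
        (Complex.I * (phaseRemainder φ.1 u x ξ : ℂ)) - 1) ξ‖ ≤
          A * ‖ξ‖ ^ (1 - bitCount α : ℤ) := fun α => by
    obtain ⟨A, hA⟩ := ((symbolBound_phaseRemainder hn B hu n).iterated_wderiv
      ((List.finRange n).filter fun j => α j)
      ((List.length_filter_le _ _).trans (by simp))).bound
    exact ⟨A, fun φ x ξ hξ => hA (φ, x) ξ hξ⟩
  choose A hA using hsym
  set S : (Fin n → Bool) → E n → ℝ := fun α η => ‖η‖ ^ (1 - bitCount α : ℤ) with hS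
  set h : E n → ℝ≥0 := fun η => ‖η‖₊ ^ (2 - n : ℤ) with hh
  set H := ∫⁻ η in openCone u, (h η : ℝ≥0∞) with hH
  have hHt : H < ⊤ := lintegral_openCone_lt_top hn u
  set AA : ℝ≥0∞ := ENNReal.ofReal (∑ α, |A α|) with hAA
  -- 8n² is the ratio of 2|ξ|, which bounds |η|, to the side |ξ|/(4n²).
  set Q : ℝ≥0∞ := ENNReal.ofReal ((8 * n ^ 2) ^ n) with hQ
  refine UniformL2Bound.of_measurable (measurableSet_closedCone u)
    (M := 2 * M + 2 * ((2 ^ n * AA) ^ 2 * H * (M * Q))) (by finiteness)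
    fun φ v hv hvm hv0 => ?_
  obtain ⟨φ, hφ, hsnd⟩ := φ
  simp only
  set Y : E n → E n := fun x => WithLp.toLp 2 fun j => pderiv j (φ x) u with hY
  have hYs : ContDiff ℝ ∞ Y := by
    rw [contDiff_euclidean]
    exact fun j => hφ.contDiff_wderiv_left [j] hu0
  have HF := HM Y hYs.continuous (fun x y j => by
      refine (hC j φ hφ x y u hu0).trans ?_
      simp only [List.length_singleton, Nat.cast_one, sub_self, zpow_zero, mul_one]
      gcongr
      exact Finset.single_le_sum (f := C) (fun j _ => hC0 j) (Finset.mem_univ j))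
    (fun x y => hlow φ hφ hsnd x y u hu0)
  set Φ : E n × E n → ℂ := fun z =>
    Complex.exp (Complex.I * (phaseRemainder φ u z.1 z.2 : ℂ)) - 1 with hΦ
  have hΦs : ContDiffOn ℝ ∞ Φ {z | z.2 ≠ 0} := by
    have h1 : ContDiff ℝ ∞ fun z : E n × E n => (inner ℝ (Y z.1) z.2 : ℝ) :=
      (hYs.comp contDiff_fst).inner ℝ contDiff_snd
    have h2 : ContDiffOn ℝ ∞ (fun z : E n × E n => phaseRemainder φ u z.1 z.2) {z | z.2 ≠ 0} :=
      hφ.smooth.sub h1.contDiffOn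
    exact ((contDiffOn_const.mul (Complex.ofRealCLM.contDiff.comp_contDiffOn h2)).cexp).sub
      contDiffOn_const
  set D : (Fin n → Bool) → E n → E n → ℂ := fun α x η => (openCone u).indicator
    (wderiv ((List.finRange n).filter fun j => α j) fun ζ => Φ (x, ζ)) η with hD
  have key := amplitude_bound_of_cube (p := ⊤) (r := 2) (wt := fun _ => 1) (A := AA) (Q := Q)
    (measurable_linFactor hYs.continuous) (norm_linFactor_le Y) measurable_const (fun _ => le_rfl)
    (fun v hv => by simpa using HF v hv) le_top (by simp) (by simp [hAA])
    (measurableSet_closedCone u) hs.measurableSet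
    (len := fun ξ => ‖ξ‖ / (4 * n ^ 2)) (by fun_prop)
    (fun ξ hξ => by have := hξ.1; positivity)
    (fun ξ hξ η hη => (mem_openCone_of_cube hn hu hξ hη).1)
    (S := S) (fun α => by simp only [hS]; fun_prop)
    (fun α η hη => zpow_pos (norm_pos_iff.2 (hs0 hη)) _)
    (h := h) (by simp only [hh]; fun_prop) (fun η hη => zpow_pos (nnnorm_pos.2 (hs0 hη)) _) hHt
    ENNReal.ofReal_lt_top
    (fun α ξ hξ η hη hc => by
      have hηp : 0 < ‖η‖ := norm_pos_iff.2 (hs0 hη)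
      have hξp : 0 < ‖ξ‖ := hξ.1
      obtain ⟨-, h1, h2⟩ := mem_openCone_of_cube hn hu hξ hc
      rw [one_mul, hQ, ← ENNReal.ofReal_mul (by positivity)]
      refine ENNReal.ofReal_le_ofReal ?_
      set l : ℝ := ‖ξ‖ / (4 * n ^ 2) with hl
      have h5 : l ≤ ‖η‖ := by
        refine le_trans ?_ h1
        rw [hl]
        exact div_le_div_of_nonneg_left hξp.le (by norm_num) (by nlinarith)
      have h6 : ‖η‖ ≤ 8 * n ^ 2 * l := by
        have : 8 * (n : ℝ) ^ 2 * l = 2 * ‖ξ‖ := by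
          rw [hl]
          field_simp
          norm_num
        rw [this]
        exact h2
      have h7 := zpow_sq_mul_pow_le hηp (show 0 < l by positivity) h5 h6 (bitCount α) n
      simpa [hh, hS] using h7)
    (D := D) (fun α => measurable_indicator_wderiv hΦs hs.measurableSet hs0 _)
    (fun α η hη => by
      rw [eLpNorm_exponent_top, hAA, ← ENNReal.ofReal_mul (by positivity)]
      refine eLpNormEssSup_le_of_ae_bound (ae_of_all _ fun x => ?_)
      simp only [hD, Set.indicator_of_mem hη]
      refine (hA α ⟨φ, hφ⟩ x η hη).trans ?_
      refine mul_le_mul_of_nonneg_right ?_ (by positivity)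
      exact (le_abs_self _).trans (Finset.single_le_sum (f := fun α => |A α|)
        (fun _ _ => abs_nonneg _) (Finset.mem_univ α)))
    (g := fun x ξ => Φ (x, ξ)) (ae_of_all _ fun x ξ hξ => by
      have hbox : ∀ t ∈ Set.Icc (0 : Fin n → ℝ) (fun _ => ‖ξ‖ / (4 * n ^ 2)),
          ξ + ∑ j, t j • basisVec j ∈ openCone u := fun t ht => by
        refine (mem_openCone_of_cube hn hu hξ ?_).1
        intro j
        have : (ξ + ∑ j, t j • (basisVec j : E n) - ξ) j = t j := by
          simp [Finset.sum_apply, Pi.single_apply]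
        rw [this]
        exact ⟨ht.1 j, ht.2 j⟩
      have hΦx : ContDiffOn ℝ ∞ (fun ζ => Φ (x, ζ)) (openCone u) :=
        hΦs.comp (contDiff_const.prodMk contDiff_id).contDiffOn fun ζ hζ => hs0 hζ
      rw [eq_sum_integral_cube hs hΦx (show 0 < ‖ξ‖ / (4 * n ^ 2) by
        have := hξ.1
        positivity) basisVec ξ hbox]
      refine Finset.sum_congr rfl fun α _ => setIntegral_congr_fun measurableSet_Icc fun t ht => ?_
      simp only [hD, Set.indicator_of_mem (hbox t ht)]
      rfl)
    hv hvm hv0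
  refine UniformL2Bound.add_of_eq (κ := Unit) (k := ()) (e := fun _ => oscFactor φ)
    (e₁ := fun _ => linFactor Y) (e₂ := fun _ x ξ => linFactor Y x ξ * Φ (x, ξ)) (v₁ := v)
    (v₂ := v) (measurable_linFactor hYs.continuous) hv.1 ?_ (HF v hv) ?_
  · filter_upwards [key.1] with x hx
    have hx' : Integrable fun ξ => linFactor Y x ξ * Φ (x, ξ) * v ξ :=
      hx.congr (ae_of_all _ fun ξ => by ring)
    rw [← integral_add (UniformL2Bound.integrable_mul (measurable_linFactor hYs.continuous)
      (norm_linFactor_le Y) hv x) hx']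
    refine integral_congr_ae (ae_of_all _ fun ξ => ?_)
    by_cases hξ : ξ ∈ closedCone u
    · have h1 : ξ ∈ Metric.closedBall (0 : E n) 1 := by simpa using hξ.2.1
      simp only [oscFactor_of_ne φ x (norm_pos_iff.1 hξ.1), linFactor, Set.indicator_of_mem h1, hΦ]
      rw [← add_mul]
      congr 1
      rw [mul_sub, mul_one, add_sub_cancel, ← Complex.exp_add, ← mul_add]
      congr 2
      rw [← Complex.ofReal_add, phaseRemainder]
      congr 1
      ring
    · simp [hv0 ξ hξ]
  · have h1 := key.2
    rw [eLpNorm_two_eq_lintegral] at h1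
    have h2 := pow_le_pow_left' h1 2
    rw [rpow_half_sq, mul_pow, mul_pow, mul_pow, rpow_half_sq, rpow_half_sq] at h2
    have h3 : ∀ x ξ, linFactor Y x ξ * Φ (x, ξ) * v ξ = linFactor Y x ξ * v ξ * Φ (x, ξ) :=
      fun x ξ => by ring
    simp only [h3]
    refine h2.trans (le_of_eq ?_)
    ring

/-- The 2n cones around ±e_j cover the punctured ball, since |ξ| ≤ n|ξ_j| for a largest coordinate.
The origin contributes nothing because `oscFactor` vanishes there. -/
theorem exists_low_frequency_bound (hn : 1 ≤ n) (B : (Fin n → ℕ) → (Fin n → ℕ) → ℝ) {c : ℝ}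
    (hc : 0 < c) :
    UniformL2Bound (fun φ : {φ : E n → E n → ℝ // IsPhaseWith 2 B φ ∧ SNDWith c φ} =>
      oscFactor φ.1) (Metric.closedBall 0 1) := by
  set e : {φ : E n → E n → ℝ // IsPhaseWith 2 B φ ∧ SNDWith c φ} → E n → E n → ℂ :=
    fun φ => oscFactor φ.1 with he
  have hem : ∀ φ, Measurable (Function.uncurry (e φ)) := fun φ => φ.2.1.measurable_oscFactor
  have heb : ∀ φ x ξ, ‖e φ x ξ‖ ≤ 1 := fun φ => norm_oscFactor_le φ.1
  set dir : Fin n × Bool → E n := fun i => bif i.2 then basisVec i.1 else -basisVec i.1 with hdir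
  have hd : ∀ i, ‖dir i‖ = 1 := by
    rintro ⟨j, β⟩
    cases β <;> simp [hdir]
  have h1 := UniformL2Bound.biUnion hem heb Finset.univ (fun i => measurableSet_closedCone (dir i))
    (fun i _ => exists_cone_bound hn B hc (hd i))
  have h0 : UniformL2Bound e {0} := by
    refine ⟨0, by simp, fun φ v _ hv0 => ?_⟩
    have : ∀ x, ∫ ξ, e φ x ξ * v ξ = 0 := fun x => by
      rw [← integral_zero (E n) ℂ]
      refine integral_congr_ae (ae_of_all _ fun ξ => ?_)
      by_cases hξ : ξ = 0
      · simp [he, oscFactor, hξ]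
      · simp [hv0 ξ hξ]
    simp [this]
  refine (h0.union hem heb (measurableSet_singleton 0) h1).mono fun ξ hξ => ?_
  by_cases hξ0 : ξ = 0
  · exact Or.inl hξ0
  refine Or.inr ?_
  have hne : (Finset.univ : Finset (Fin n)).Nonempty := ⟨⟨0, hn⟩, Finset.mem_univ _⟩
  obtain ⟨j, -, hj⟩ := Finset.exists_max_image Finset.univ (fun j => |ξ j|) hne
  have h2 : ‖ξ‖ ≤ n * |ξ j| := by
    calc ‖ξ‖ ≤ ∑ i, |ξ i| := norm_le_sum_abs ξ
      _ ≤ ∑ _i : Fin n, |ξ j| := Finset.sum_le_sum fun i hi => hj i hi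
      _ = n * |ξ j| := by simp
  have h3 : ‖ξ‖ ≤ 1 := by simpa using hξ
  simp only [Finset.mem_univ, Set.iUnion_true, Set.mem_iUnion]
  rcases le_total 0 (ξ j) with hs | hs
  · refine ⟨(j, true), norm_pos_iff.2 hξ0, h3, ?_⟩
    rw [abs_of_nonneg hs] at h2
    simpa [hdir, basisVec, EuclideanSpace.inner_single_left] using h2
  · refine ⟨(j, false), norm_pos_iff.2 hξ0, h3, ?_⟩
    rw [abs_of_nonpos hs] at h2
    simpa [hdir, basisVec, EuclideanSpace.inner_single_left] using h2

end ConeBound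

/-! ### Summation over dyadic shells -/

section GlobalBound

variable {n : ℕ}

theorem one_le_bracket (ξ : E n) : 1 ≤ bracket ξ :=
  Real.one_le_sqrt.2 (by nlinarith [norm_nonneg ξ])

theorem bracket_pos (ξ : E n) : 0 < bracket ξ := one_pos.trans_le (one_le_bracket ξ)

theorem norm_le_bracket (ξ : E n) : ‖ξ‖ ≤ bracket ξ :=
  Real.le_sqrt_of_sq_le (by linarith)

theorem continuous_bracket : Continuous (bracket : E n → ℝ) := by
  unfold bracket
  fun_prop

theorem tsum_sq_le (s : ℝ≥0∞) (hs0 : s ≠ 0) (hst : s ≠ ⊤) (f : ℕ → ℝ≥0∞) :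
    (∑' j, f j) ^ 2 ≤ (∑' j, ((s ^ 2)⁻¹) ^ j) * ∑' j, (s ^ 2) ^ j * f j ^ 2 := by
  have h := lintegral_mul_sq_le (μ := Measure.count) (f := fun j : ℕ => (s ^ j)⁻¹)
    (g := fun j => s ^ j * f j) (measurable_of_countable _).aemeasurable
    (measurable_of_countable _).aemeasurable
  simp only [lintegral_count] at h
  have h1 : ∀ j, (s ^ j)⁻¹ * (s ^ j * f j) = f j := fun j => by
    rw [← mul_assoc, ENNReal.inv_mul_cancel (pow_ne_zero _ hs0) (ENNReal.pow_ne_top hst), one_mul]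
  have h2 : ∀ j, ((s ^ j)⁻¹) ^ 2 = ((s ^ 2)⁻¹) ^ j := fun j => by
    rw [← ENNReal.inv_pow, ← ENNReal.inv_pow, ← pow_mul, ← pow_mul, mul_comm]
  have h3 : ∀ j, (s ^ j * f j) ^ 2 = (s ^ 2) ^ j * f j ^ 2 := fun j => by
    rw [mul_pow, ← pow_mul, ← pow_mul, mul_comm j]
  simpa only [h1, h2, h3] using h

/-- No orthogonality between shells is used: Cauchy–Schwarz with geometric weights sums them at the
price of ⟨ξ⟩^γ, a loss that the strict inequality for m can afford. -/
theorem exists_global_bound (hn : 1 ≤ n) (B : (Fin n → ℕ) → (Fin n → ℕ) → ℝ) {c : ℝ} (hc : 0 < c)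
    {γ : ℝ} (hγ : 0 < γ) :
    ∃ M : ℝ≥0∞, M < ⊤ ∧ ∀ φ : E n → E n → ℝ, IsPhaseWith 2 B φ → SNDWith c φ → ∀ v : E n → ℂ,
      Integrable v → ∫⁻ x, ‖∫ ξ, oscFactor φ x ξ * v ξ‖ₑ ^ 2 ≤
        M * ∫⁻ ξ, ENNReal.ofReal (bracket ξ ^ γ) * ‖v ξ‖ₑ ^ 2 := by
  obtain ⟨M₀, hM₀, H₀⟩ := exists_low_frequency_bound hn B hc
  obtain ⟨M₁, hM₁, H₁⟩ := exists_shell_bound (n := n) B hc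
  -- s² = 2^γ is the weight gained per shell.
  set s : ℝ≥0∞ := ENNReal.ofReal ((2 : ℝ) ^ (γ / 2)) with hs
  have hs1 : 1 < s := by
    rw [hs, ENNReal.one_lt_ofReal]
    exact Real.one_lt_rpow (by norm_num) (by positivity)
  have hst : s ≠ ⊤ := ENNReal.ofReal_ne_top
  have hs0 : s ≠ 0 := (one_pos.trans hs1).ne'
  set G : ℝ≥0∞ := ∑' j : ℕ, ((s ^ 2)⁻¹) ^ j with hG
  have hGt : G < ⊤ := by
    rw [hG, ENNReal.tsum_geometric, ENNReal.inv_lt_top, tsub_pos_iff_lt, ENNReal.inv_lt_one]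
    exact one_lt_pow₀ hs1 (by norm_num)
  set A : ℕ → Set (E n) := disjointed fun j => Metric.closedBall 0 (2 ^ j) with hA
  have hmono : Monotone fun j : ℕ => Metric.closedBall (0 : E n) (2 ^ j) := fun i j hij =>
    Metric.closedBall_subset_closedBall (pow_le_pow_right₀ (by norm_num) hij)
  have hA0 : A 0 = Metric.closedBall 0 1 := by simp [hA]
  have hAs : ∀ j, ∀ ξ, ξ ∈ A (j + 1) → 2 ^ j < ‖ξ‖ ∧ ‖ξ‖ ≤ 2 * 2 ^ j := by
    intro j ξ hξ
    rw [hA, hmono.disjointed_add_one] at hξ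
    simpa [pow_succ, mul_comm, and_comm] using hξ
  have hAm : ∀ j, MeasurableSet (A j) := fun j =>
    MeasurableSet.disjointed (fun j => Metric.isClosed_closedBall.measurableSet) j
  have hAd : Pairwise (Function.onFun Disjoint A) := disjoint_disjointed _
  have hAU : ⋃ j, A j = Set.univ := by
    rw [hA, iUnion_disjointed, Set.eq_univ_iff_forall]
    intro ξ
    obtain ⟨j, hj⟩ := pow_unbounded_of_one_lt ‖ξ‖ (one_lt_two (α := ℝ))
    exact Set.mem_iUnion.2 ⟨j, by simpa using hj.le⟩
  refine ⟨G * ((M₀ + M₁) * s ^ 2), by finiteness, fun φ hφ hsnd v hv => ?_⟩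
  have hosc := hφ.measurable_oscFactor
  have hpiece : ∀ j, ∫⁻ x, ‖∫ ξ, oscFactor φ x ξ * (A j).indicator v ξ‖ₑ ^ 2 ≤
      (M₀ + M₁) * ∫⁻ ξ in A j, ‖v ξ‖ₑ ^ 2 := by
    intro j
    have h1 : ∫⁻ ξ, ‖(A j).indicator v ξ‖ₑ ^ 2 = ∫⁻ ξ in A j, ‖v ξ‖ₑ ^ 2 := by
      rw [← lintegral_indicator (hAm j)]
      refine lintegral_congr fun ξ => ?_
      by_cases h : ξ ∈ A j <;> simp [h]
    rw [← h1]
    rcases j with - | j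
    · refine (H₀ ⟨φ, hφ, hsnd⟩ _ (hv.indicator (hAm 0)) fun ξ hξ => ?_).trans ?_
      · rw [← hA0] at hξ
        simp [hξ]
      · gcongr
        exact le_self_add
    · refine (H₁ φ hφ hsnd (2 ^ j) (by positivity) _ (hv.indicator (hAm _)) fun ξ hξ => ?_).trans ?_
      · exact Set.indicator_of_notMem (fun h => hξ ⟨(hAs j ξ h).1.le, (hAs j ξ h).2⟩) _
      · gcongr
        exact le_add_self
  -- The extra s² absorbs the index shift: on A (j + 1) one only has |ξ| > 2^j.
  have hweight : ∀ j, ∀ ξ ∈ A j, (s ^ 2) ^ j ≤ s ^ 2 * ENNReal.ofReal (bracket ξ ^ γ) := by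
    intro j ξ hξ
    have hb : 1 ≤ ENNReal.ofReal (bracket ξ ^ γ) := by
      rw [ENNReal.one_le_ofReal]
      exact Real.one_le_rpow (one_le_bracket ξ) hγ.le
    rcases j with - | j
    · rw [pow_zero]
      exact one_le_mul (one_le_pow_of_one_le' hs1.le 2) hb
    · rw [pow_succ']
      gcongr
      have h2 : (0 : ℝ) < 2 ^ (γ / 2) := Real.rpow_pos_of_pos two_pos _
      rw [hs, ← ENNReal.ofReal_pow h2.le, ← ENNReal.ofReal_pow (pow_nonneg h2.le 2)]
      refine ENNReal.ofReal_le_ofReal ?_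
      have h3 : ((2 : ℝ) ^ (γ / 2)) ^ 2 = 2 ^ γ := by
        rw [← Real.rpow_natCast, ← Real.rpow_mul two_pos.le]
        norm_num
      rw [h3, ← Real.rpow_natCast, ← Real.rpow_mul two_pos.le, mul_comm γ,
        Real.rpow_mul two_pos.le, Real.rpow_natCast]
      exact Real.rpow_le_rpow (by positivity) ((hAs j ξ hξ).1.le.trans (norm_le_bracket ξ)) hγ.le
  have hsplit : ∀ x, ‖∫ ξ, oscFactor φ x ξ * v ξ‖ₑ ≤
      ∑' j, ‖∫ ξ, oscFactor φ x ξ * (A j).indicator v ξ‖ₑ := by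
    intro x
    have hi := UniformL2Bound.integrable_mul hosc (norm_oscFactor_le φ) hv x
    have h1 := integral_iUnion hAm hAd (hi.integrableOn (s := ⋃ j, A j))
    rw [hAU, setIntegral_univ] at h1
    rw [h1]
    refine enorm_tsum_le_tsum_enorm.trans (le_of_eq (tsum_congr fun j => ?_))
    rw [← integral_indicator (hAm j)]
    congr 2
    funext ξ
    by_cases h : ξ ∈ A j <;> simp [h]
  have hmeas : ∀ j, AEMeasurable
      (fun x => (s ^ 2) ^ j * ‖∫ ξ, oscFactor φ x ξ * (A j).indicator v ξ‖ₑ ^ 2) volume := fun j =>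
    ((aestronglyMeasurable_integral_mul (hv.indicator (hAm j)).1 hosc).enorm.pow_const 2).const_mul _
  calc ∫⁻ x, ‖∫ ξ, oscFactor φ x ξ * v ξ‖ₑ ^ 2
      ≤ ∫⁻ x, G * ∑' j, (s ^ 2) ^ j * ‖∫ ξ, oscFactor φ x ξ * (A j).indicator v ξ‖ₑ ^ 2 := by
        refine lintegral_mono fun x => ?_
        exact (pow_le_pow_left' (hsplit x) 2).trans (tsum_sq_le s hs0 hst _)
    _ = G * ∑' j, (s ^ 2) ^ j * ∫⁻ x, ‖∫ ξ, oscFactor φ x ξ * (A j).indicator v ξ‖ₑ ^ 2 := by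
        rw [lintegral_const_mul' _ _ hGt.ne, lintegral_tsum hmeas]
        congr 1
        refine tsum_congr fun j => lintegral_const_mul' _ _ ?_
        exact ENNReal.pow_ne_top (ENNReal.pow_ne_top hst)
    _ ≤ G * ∑' j, (M₀ + M₁) * s ^ 2 * ∫⁻ ξ in A j, ENNReal.ofReal (bracket ξ ^ γ) * ‖v ξ‖ₑ ^ 2 := by
        refine mul_le_mul_right (ENNReal.tsum_le_tsum fun j => ?_) G
        calc _ ≤ (s ^ 2) ^ j * ((M₀ + M₁) * ∫⁻ ξ in A j, ‖v ξ‖ₑ ^ 2) := by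
              gcongr
              exact hpiece j
          _ = (M₀ + M₁) * ∫⁻ ξ in A j, (s ^ 2) ^ j * ‖v ξ‖ₑ ^ 2 := by
              rw [lintegral_const_mul' _ _ (ENNReal.pow_ne_top (ENNReal.pow_ne_top hst))]
              ring
          _ ≤ (M₀ + M₁) * ∫⁻ ξ in A j,
                s ^ 2 * (ENNReal.ofReal (bracket ξ ^ γ) * ‖v ξ‖ₑ ^ 2) := by
              refine mul_le_mul_right ?_ _
              refine setLIntegral_mono' (hAm j) fun ξ hξ => ?_
              rw [← mul_assoc]
              gcongr
              exact hweight j ξ hξ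
          _ = _ := by
              rw [lintegral_const_mul' _ _ (ENNReal.pow_ne_top hst)]
              ring
    _ = _ := by
        rw [ENNReal.tsum_mul_left, ← lintegral_iUnion hAm hAd, hAU, setLIntegral_univ]
        ring

end GlobalBound

/-! ### Rough amplitudes: measurability and scaling -/

section AmplitudeClass

variable {n : ℕ}

/-- A ξ-derivative is, for almost every x, the limit of difference quotients, each measurable in x.
-/
theorem aestronglyMeasurable_pderiv {b : E n → E n → ℂ}
    (hm : ∀ ξ, AEStronglyMeasurable (fun x => b x ξ) volume) (hs : ∀ᵐ x, ContDiff ℝ ∞ (b x))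
    (j : Fin n) (ξ : E n) : AEStronglyMeasurable (fun x => pderiv j (b x) ξ) volume := by
  set t : ℕ → ℝ := fun k => ((k : ℝ) + 1)⁻¹ with ht
  have ht0 : Filter.Tendsto t Filter.atTop (nhdsWithin 0 {0}ᶜ) := by
    refine tendsto_nhdsWithin_iff.2 ⟨?_, Filter.Eventually.of_forall fun k => ?_⟩
    · simpa [ht] using tendsto_one_div_add_atTop_nhds_zero_nat (𝕜 := ℝ)
    · simp only [ht, Set.mem_compl_iff, Set.mem_singleton_iff]
      positivity
  refine aestronglyMeasurable_of_tendsto_ae Filter.atTop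
    (f := fun k x => (t k)⁻¹ • (b x (ξ + t k • basisVec j) - b x ξ))
    (fun k => ((hm (ξ + t k • basisVec j)).sub (hm ξ)).const_smul ((t k)⁻¹)) ?_
  filter_upwards [hs] with x hx
  have h1 : HasDerivAt (fun s : ℝ => b x (ξ + s • basisVec j)) (pderiv j (b x) ξ) 0 := by
    have h2 : HasFDerivAt (b x) (fderiv ℝ (b x) ξ) (ξ + (0 : ℝ) • basisVec j) := by
      rw [zero_smul, add_zero]
      exact (hx.differentiable (by simp) ξ).hasFDerivAt
    have h3 : HasDerivAt (fun s : ℝ => ξ + s • (basisVec j : E n)) (basisVec j) 0 := by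
      simpa using ((hasDerivAt_id (0 : ℝ)).smul_const (basisVec j : E n)).const_add ξ
    exact h2.comp_hasDerivAt 0 h3
  have h4 := h1.tendsto_slope_zero.comp ht0
  simpa [Function.comp_def] using h4

theorem ae_contDiff_wderiv {b : E n → E n → ℂ} (hs : ∀ᵐ x, ContDiff ℝ ∞ (b x))
    (l : List (Fin n)) : ∀ᵐ x, ContDiff ℝ ∞ (wderiv l (b x)) := by
  filter_upwards [hs] with x hx
  rw [← contDiffOn_univ]
  exact contDiffOn_wderiv isOpen_univ hx.contDiffOn l

theorem aestronglyMeasurable_wderiv {b : E n → E n → ℂ}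
    (hm : ∀ ξ, AEStronglyMeasurable (fun x => b x ξ) volume) (hs : ∀ᵐ x, ContDiff ℝ ∞ (b x))
    (l : List (Fin n)) (ξ : E n) :
    AEStronglyMeasurable (fun x => wderiv l (b x) ξ) volume := by
  induction l generalizing ξ with
  | nil => exact hm ξ
  | cons j l ih => exact aestronglyMeasurable_pderiv ih (ae_contDiff_wderiv hs l) j ξ

/-- A function that is measurable in `x` for every `ξ` and continuous in `ξ` for almost every `x`
has a jointly measurable version. -/
theorem exists_measurable_version {b : E n → E n → ℂ}
    (hm : ∀ ξ, AEStronglyMeasurable (fun x => b x ξ) volume) (hc : ∀ᵐ x, Continuous (b x)) :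
    ∃ b' : E n → E n → ℂ, Measurable (Function.uncurry b') ∧ ∀ᵐ x, b' x = b x := by
  set q := TopologicalSpace.denseSeq (E n)
  have hgood : ∀ᵐ x, Continuous (b x) ∧ ∀ k, b x (q k) = (hm (q k)).mk _ x :=
    hc.and (ae_all_iff.2 fun k => (hm (q k)).ae_eq_mk)
  -- Zeroing b on this null set leaves a function continuous in ξ for every x and measurable in x on
  -- a dense set of ξ, hence for every ξ, hence jointly.
  set N := toMeasurable volume {x | ¬(Continuous (b x) ∧ ∀ k, b x (q k) = (hm (q k)).mk _ x)}
  have hN : MeasurableSet N := measurableSet_toMeasurable _ _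
  have hN0 : volume N = 0 := (measure_toMeasurable _).trans (ae_iff.1 hgood)
  have hNg : ∀ x ∉ N, Continuous (b x) ∧ ∀ k, b x (q k) = (hm (q k)).mk _ x := fun x hx => by
    by_contra h
    exact hx (subset_toMeasurable _ _ h)
  set b' : E n → E n → ℂ := fun x ξ => Nᶜ.indicator (fun x => b x ξ) x with hb'
  have hcont : ∀ x, Continuous (b' x) := fun x => by
    by_cases hx : x ∈ N
    · simpa [hb', hx] using (continuous_const : Continuous fun _ : E n => (0 : ℂ))
    · simpa [hb', hx] using (hNg x hx).1
  have hq : ∀ k, Measurable fun x => b' x (q k) := fun k => by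
    have h1 : (fun x => b' x (q k)) = Nᶜ.indicator ((hm (q k)).mk _) := by
      funext x
      by_cases hx : x ∈ N
      · simp [hb', hx]
      · simpa [hb', hx] using (hNg x hx).2 k
    rw [h1]
    exact (hm (q k)).stronglyMeasurable_mk.measurable.indicator hN.compl
  have hξ : ∀ ξ, Measurable fun x => b' x ξ := fun ξ => by
    obtain ⟨y, hy, hlim⟩ := mem_closure_iff_seq_limit.1
      (TopologicalSpace.denseRange_denseSeq (E n) ξ)
    choose k hk using hy
    refine measurable_of_tendsto_metrizable (f := fun i x => b' x (q (k i))) (fun i => hq _) ?_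
    rw [tendsto_pi_nhds]
    intro x
    have := ((hcont x).tendsto ξ).comp hlim
    simpa [Function.comp_def, ← hk] using this
  refine ⟨b', ?_, ?_⟩
  · have h1 := measurable_uncurry_of_continuous_of_measurable (u := fun ξ x => b' x ξ) hcont hξ
    exact h1.comp measurable_swap
  · filter_upwards [compl_mem_ae_iff.2 hN0] with x hx
    funext ξ
    exact Set.indicator_of_mem hx _

section

variable {p : ℝ≥0∞} {m ρ : ℝ} {a : E n → E n → ℂ}

theorem IsAmplitude.ampSeminorm_lt_top (h : IsAmplitude p m ρ a) (N : ℕ) :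
    ampSeminorm p m ρ N a < ⊤ := by
  refine ENNReal.sum_lt_top.2 fun k _ => ENNReal.sum_lt_top.2 fun α _ => ?_
  obtain ⟨C, hC⟩ := h.bound α
  refine lt_of_le_of_lt (iSup_le fun ξ => ?_) (ENNReal.ofReal_lt_top (r := C))
  refine (mul_le_mul_right (hC ξ) _).trans ?_
  have hb := bracket_pos ξ
  rw [← ENNReal.ofReal_mul (Real.rpow_nonneg hb.le _), mul_left_comm, ← Real.rpow_add hb]
  simp

theorem eLpNorm_mderiv_le_ampSeminorm (a : E n → E n → ℂ) {α : Fin n → ℕ} {N : ℕ}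
    (hα : order α ≤ N) (ξ : E n) :
    eLpNorm (fun x => mderiv α (a x) ξ) p volume ≤
      ampSeminorm p m ρ N a * ENNReal.ofReal (bracket ξ ^ (m - ρ * (order α : ℝ))) := by
  have hb := bracket_pos ξ
  have h1 : ENNReal.ofReal (bracket ξ ^ (ρ * (order α : ℝ) - m)) *
      eLpNorm (fun x => mderiv α (a x) ξ) p volume ≤ ampSeminorm p m ρ N a := by
    refine (le_iSup (fun ξ : E n => ENNReal.ofReal (bracket ξ ^ (ρ * (order α : ℝ) - m)) *
      eLpNorm (fun x => mderiv α (a x) ξ) p volume) ξ).trans ?_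
    refine le_trans ?_ (Finset.single_le_sum (f := fun k =>
      ∑ α ∈ Finset.piAntidiag (Finset.univ : Finset (Fin n)) k,
        ⨆ ξ : E n, ENNReal.ofReal (bracket ξ ^ (ρ * (order α : ℝ) - m)) *
          eLpNorm (fun x => mderiv α (a x) ξ) p volume) (fun _ _ => zero_le)
      (Finset.mem_range.2 (Nat.lt_succ_of_le hα)))
    exact Finset.single_le_sum (f := fun α =>
      ⨆ ξ : E n, ENNReal.ofReal (bracket ξ ^ (ρ * (order α : ℝ) - m)) *
          eLpNorm (fun x => mderiv α (a x) ξ) p volume) (fun _ _ => zero_le)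
      (by simp [Finset.mem_piAntidiag, order])
  calc eLpNorm (fun x => mderiv α (a x) ξ) p volume
      = ENNReal.ofReal (bracket ξ ^ (m - ρ * (order α : ℝ))) *
        (ENNReal.ofReal (bracket ξ ^ (ρ * (order α : ℝ) - m)) *
          eLpNorm (fun x => mderiv α (a x) ξ) p volume) := by
        rw [← mul_assoc, ← ENNReal.ofReal_mul (Real.rpow_nonneg hb.le _), ← Real.rpow_add hb]
        simp
    _ ≤ _ := by
        rw [mul_comm]
        exact mul_le_mul_left h1 _

end

theorem bracket_le_add (ξ η : E n) : bracket η ≤ bracket ξ + ‖η - ξ‖ := by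
  have h1 : ‖η‖ ≤ ‖ξ‖ + ‖η - ξ‖ := by simpa using norm_add_le ξ (η - ξ)
  have h2 : bracket ξ ^ 2 = 1 + ‖ξ‖ ^ 2 := Real.sq_sqrt (by positivity)
  have h3 := norm_le_bracket ξ
  refine Real.sqrt_le_iff.2 ⟨by have := bracket_pos ξ; positivity, ?_⟩
  nlinarith [norm_nonneg ξ, norm_nonneg η, norm_nonneg (η - ξ),
    mul_le_mul_of_nonneg_right h3 (norm_nonneg (η - ξ))]

/-- As ρ ≤ 1, points of the cube are within ⟨ξ⟩/4 of ξ. -/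
theorem bracket_comparable {ρ : ℝ} (hρ : ρ ≤ 1) (hn : 1 ≤ n) {ξ η : E n}
    (h : η - ξ ∈ cubeSet n (bracket ξ ^ ρ / (4 * n))) :
    bracket ξ / 2 ≤ bracket η ∧ bracket η ≤ 2 * bracket ξ := by
  have hn' : (1 : ℝ) ≤ n := by exact_mod_cast hn
  have h1 : ‖η - ξ‖ ≤ bracket ξ / 4 := by
    refine (norm_le_of_mem_cubeSet h).trans ?_
    rw [show (n : ℝ) * (bracket ξ ^ ρ / (4 * n)) = bracket ξ ^ ρ / 4 by field_simp]
    have h2 : bracket ξ ^ ρ ≤ bracket ξ ^ (1 : ℝ) :=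
      Real.rpow_le_rpow_of_exponent_le (one_le_bracket ξ) hρ
    rw [Real.rpow_one] at h2
    linarith
  have h2 := bracket_le_add ξ η
  have h3 := bracket_le_add η ξ
  rw [norm_sub_rev] at h3
  have h4 := bracket_pos ξ
  constructor <;> linarith

theorem rpow_le_of_comparable {t b : ℝ} (hb : 0 < b) (h1 : b / 2 ≤ t) (h2 : t ≤ 2 * b) (s : ℝ) :
    t ^ s ≤ 2 ^ |s| * b ^ s := by
  have ht : 0 < t := lt_of_lt_of_le (by positivity) h1
  rcases le_total 0 s with hs | hs
  · rw [abs_of_nonneg hs, ← Real.mul_rpow (by norm_num) hb.le]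
    exact Real.rpow_le_rpow ht.le h2 hs
  · rw [abs_of_nonpos hs]
    calc t ^ s ≤ (b / 2) ^ s := Real.rpow_le_rpow_of_nonpos (by positivity) h1 hs
      _ = _ := by
        rw [Real.div_rpow hb.le (by norm_num), Real.rpow_neg (by norm_num)]
        field_simp

theorem bitCount_le {k : ℕ} (α : Fin k → Bool) : bitCount α ≤ k :=
  (List.length_filter_le _ _).trans (by simp)

/-- On the cube ⟨η⟩ ~ ⟨ξ⟩ and the powers ρk cancel, leaving the orders γ + 2m on the left and -(n +
γ) + ρn on the right; `hγ` says exactly that they agree. -/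
theorem bracket_scale_inequality (hn : 1 ≤ n) {m ρ γ : ℝ} (hρ0 : 0 ≤ ρ) (hρ1 : ρ ≤ 1)
    (hγ : 2 * γ = n * (ρ - 1) - 2 * m) {k : ℕ} (hk : k ≤ n) {ξ η : E n}
    (h : η - ξ ∈ cubeSet n (bracket ξ ^ ρ / (4 * n))) :
    bracket ξ ^ γ * ((bracket η ^ (m - ρ * k)) ^ 2 * (bracket ξ ^ ρ / (4 * n)) ^ (2 * k)) ≤
      (2 ^ (2 * |m| + 2 * n) * 2 ^ |(n : ℝ) + γ| * (4 * n) ^ n) *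
        (bracket η ^ (-(n + γ)) * (bracket ξ ^ ρ / (4 * n)) ^ n) := by
  obtain ⟨h1, h2⟩ := bracket_comparable hρ1 hn h
  have hn' : (1 : ℝ) ≤ n := by exact_mod_cast hn
  have hk' : (k : ℝ) ≤ n := by exact_mod_cast hk
  set b := bracket ξ with hb
  set t := bracket η with ht
  have hb0 : 0 < b := bracket_pos ξ
  have ht0 : 0 < t := bracket_pos η
  clear_value b t
  have e1 : (t ^ (m - ρ * k)) ^ 2 = t ^ (2 * (m - ρ * k)) := by
    rw [← Real.rpow_natCast, ← Real.rpow_mul ht0.le, mul_comm]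
    norm_num
  have e2 : ∀ i : ℕ, (b ^ ρ / (4 * n)) ^ i = b ^ (ρ * i) / (4 * n) ^ i := fun i => by
    rw [div_pow, ← Real.rpow_natCast (b ^ ρ), ← Real.rpow_mul hb0.le]
  have i1 : t ^ (2 * (m - ρ * k)) ≤ 2 ^ (2 * |m| + 2 * n) * b ^ (2 * (m - ρ * k)) := by
    refine (rpow_le_of_comparable hb0 h1 h2 _).trans ?_
    gcongr
    · norm_num
    · rw [abs_le]
      have h3 : ρ * k ≤ n := (mul_le_of_le_one_left (by positivity) hρ1).trans hk'
      have h4 : 0 ≤ ρ * k := by positivity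
      constructor <;> linarith [le_abs_self m, neg_abs_le m]
  have i2 : b ^ (-(n + γ)) ≤ 2 ^ |(n : ℝ) + γ| * t ^ (-(n + γ)) := by
    rw [← abs_neg]
    exact rpow_le_of_comparable ht0 (by linarith) (by linarith) _
  have i3 : (1 : ℝ) ≤ (4 * n) ^ (2 * k) := one_le_pow₀ (by linarith)
  calc b ^ γ * ((t ^ (m - ρ * k)) ^ 2 * (b ^ ρ / (4 * n)) ^ (2 * k))
      ≤ b ^ γ * ((2 ^ (2 * |m| + 2 * n) * b ^ (2 * (m - ρ * k))) * b ^ (ρ * (2 * k : ℕ))) := by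
        rw [e1, e2]
        gcongr
        exact div_le_self (by positivity) i3
    _ = 2 ^ (2 * |m| + 2 * n) * (b ^ (-(n + γ)) * b ^ (ρ * n)) := by
        have : b ^ γ * (b ^ (2 * (m - ρ * k)) * b ^ (ρ * (2 * k : ℕ))) =
            b ^ (-(n + γ)) * b ^ (ρ * n) := by
          rw [← Real.rpow_add hb0, ← Real.rpow_add hb0, ← Real.rpow_add hb0]
          congr 1
          push_cast
          linarith
        rw [← this]
        ring
    _ ≤ 2 ^ (2 * |m| + 2 * n) * ((2 ^ |(n : ℝ) + γ| * t ^ (-(n + γ))) * b ^ (ρ * n)) := by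
        gcongr
    _ = _ := by
        rw [e2]
        field_simp

theorem exists_amplitude_bound (hn : 1 ≤ n) {m ρ : ℝ} {p r : ℝ≥0∞} (hρ0 : 0 ≤ ρ) (hρ1 : ρ ≤ 1)
    (hp : 2 ≤ p) (hr : 1 / r = 1 / p + 1 / 2) (hm : m < n * (ρ - 1) / 2)
    (B : (Fin n → ℕ) → (Fin n → ℕ) → ℝ) {c : ℝ} (hc : 0 < c) :
    ∃ C : ℝ≥0∞, C < ⊤ ∧ ∀ φ : E n → E n → ℝ, IsPhaseWith 2 B φ → SNDWith c φ →
      ∀ a : E n → E n → ℂ, IsAmplitude p m ρ a → ∀ v : E n → ℂ, Integrable v → Measurable v →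
        (∀ᵐ x, Integrable fun ξ => oscFactor φ x ξ * v ξ * a x ξ) ∧
        eLpNorm (fun x => ∫ ξ, oscFactor φ x ξ * v ξ * a x ξ) r volume ≤
          C * ampSeminorm p m ρ n a * (∫⁻ ξ, ‖v ξ‖ₑ ^ 2) ^ (1 / 2 : ℝ) := by
  -- γ is the gap n(ρ-1)/2 - m. It is spent twice, as the loss in the L² bound and as the
  -- integrability margin of h.
  obtain ⟨γ, hγ⟩ : ∃ γ : ℝ, 2 * γ = n * (ρ - 1) - 2 * m :=
    ⟨(n * (ρ - 1) - 2 * m) / 2, by ring⟩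
  have hγ0 : 0 < γ := by linarith
  have hn' : (1 : ℝ) ≤ n := by exact_mod_cast hn
  obtain ⟨M, hM, HM⟩ := exists_global_bound hn B hc hγ0
  set h : E n → ℝ≥0 := fun η => (bracket η ^ (-(n + γ))).toNNReal with hh
  set H : ℝ≥0∞ := ∫⁻ η in Set.univ, (h η : ℝ≥0∞) with hH
  have hHt : H < ⊤ := by
    have h1 := (integrable_rpow_neg_one_add_norm_sq (μ := (volume : Measure (E n)))
      (r := n + γ) (by simpa using hγ0)).2
    rw [hH, setLIntegral_univ]
    refine lt_of_le_of_lt (lintegral_mono fun η => ?_) h1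
    rw [Real.enorm_eq_ofReal (by positivity)]
    refine le_of_eq (congrArg ENNReal.ofReal ?_)
    rw [bracket, Real.sqrt_eq_rpow, ← Real.rpow_mul (by positivity)]
    congr 1
    ring
  set Q : ℝ≥0∞ := ENNReal.ofReal (2 ^ (2 * |m| + 2 * n) * 2 ^ |(n : ℝ) + γ| * (4 * n) ^ n) with hQ
  refine ⟨2 ^ n * (H ^ (1 / 2 : ℝ) * (M * Q) ^ (1 / 2 : ℝ)), ?_, fun φ hφ hsnd a ha v hv hvm => ?_⟩
  · have h1 : H ^ (1 / 2 : ℝ) < ⊤ := ENNReal.rpow_lt_top_of_nonneg (by norm_num) hHt.ne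
    have h2 : (M * Q) ^ (1 / 2 : ℝ) < ⊤ := ENNReal.rpow_lt_top_of_nonneg (by norm_num)
      (by finiteness)
    finiteness
  -- Amplitudes are only measurable in x for each fixed ξ; the versions agree with the derivatives
  -- for almost every x, at all ξ simultaneously.
  choose D hDm hD using fun α : Fin n → Bool => exists_measurable_version
    (aestronglyMeasurable_wderiv ha.measurable ha.smooth ((List.finRange n).filter fun j => α j))
    ((ae_contDiff_wderiv ha.smooth ((List.finRange n).filter fun j => α j)).mono
      fun _ hx => hx.continuous)
  have hbr : Measurable (bracket : E n → ℝ) := continuous_bracket.measurable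
  have key := amplitude_bound_of_cube (p := p) (r := r)
    (wt := fun ξ => ENNReal.ofReal (bracket ξ ^ γ)) (A := ampSeminorm p m ρ n a) (Q := Q)
    hφ.measurable_oscFactor (norm_oscFactor_le φ) (hbr.pow_const γ).ennreal_ofReal
    (fun ξ => ENNReal.one_le_ofReal.2 (Real.one_le_rpow (one_le_bracket ξ) hγ0.le))
    (HM φ hφ hsnd) hp hr (ha.ampSeminorm_lt_top n) MeasurableSet.univ MeasurableSet.univ
    (len := fun ξ => bracket ξ ^ ρ / (4 * n)) ((hbr.pow_const ρ).div_const _)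
    (fun ξ _ => div_pos (Real.rpow_pos_of_pos (bracket_pos ξ) _) (by positivity))
    (fun _ _ _ _ => Set.mem_univ _)
    (S := fun α η => bracket η ^ (m - ρ * (bitCount α : ℝ)))
    (fun α => hbr.pow_const _) (fun α η _ => Real.rpow_pos_of_pos (bracket_pos η) _)
    (h := h) (hbr.pow_const _).real_toNNReal
    (fun η _ => Real.toNNReal_pos.2 (Real.rpow_pos_of_pos (bracket_pos η) _)) hHt
    ENNReal.ofReal_lt_top
    (fun α ξ _ η _ hc => by
      have hb := Real.rpow_nonneg (bracket_pos ξ).le γ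
      rw [hQ, ← ENNReal.ofReal_mul hb, ← ENNReal.ofReal_mul (by positivity)]
      refine ENNReal.ofReal_le_ofReal ?_
      have h1 := bracket_scale_inequality hn hρ0 hρ1 hγ (bitCount_le α) hc
      rwa [hh, Real.coe_toNNReal _ (Real.rpow_nonneg (bracket_pos η).le _)])
    (D := D) hDm
    (fun α η _ => by
      have h1 : (fun x => D α x η) =ᵐ[volume] fun x =>
          mderiv (fun i => ((List.finRange n).filter fun j => α j).count i) (a x) η := by
        filter_upwards [hD α, ha.smooth] with x hx hs
        rw [hx]
        exact wderiv_eq_mderiv isOpen_univ hs.contDiffOn _ (Set.mem_univ η)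
      have h2 : order (fun i => ((List.finRange n).filter fun j => α j).count i) = bitCount α :=
        order_count _
      rw [eLpNorm_congr_ae h1, ← h2]
      exact eLpNorm_mderiv_le_ampSeminorm a (h2.trans_le (bitCount_le α)) η)
    (g := a) (by
      filter_upwards [ae_all_iff.2 hD, ha.smooth] with x hx hs ξ _
      rw [eq_sum_integral_cube isOpen_univ hs.contDiffOn
        (div_pos (Real.rpow_pos_of_pos (bracket_pos ξ) ρ) (show (0 : ℝ) < 4 * n by positivity))
        basisVec ξ fun t _ => Set.mem_univ _]
      refine Finset.sum_congr rfl fun α _ => setIntegral_congr_fun measurableSet_Icc fun t ht => ?_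
      simp only [hx α]
      rfl)
    hv hvm (fun ξ hξ => absurd (Set.mem_univ ξ) hξ)
  refine ⟨key.1, key.2.trans (le_of_eq ?_)⟩
  rw [ENNReal.mul_rpow_of_nonneg (M * Q) _ (by norm_num)]
  ring

end AmplitudeClass

/-! ### Plancherel and extension to L² -/

section Extension

variable {n : ℕ}

-- The dilation converts from the kernel e^{-2πi⟨y,ξ⟩} of `𝓕` to e^{-i⟨y,ξ⟩}.
open FourierTransform in
theorem fourierHat_eq (u : 𝓢(E n, ℂ)) (ξ : E n) :
    fourierHat u ξ = (𝓕 u : 𝓢(E n, ℂ)) ((2 * Real.pi)⁻¹ • ξ) := by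
  rw [SchwartzMap.fourier_coe, Real.fourier_eq', fourierHat]
  refine integral_congr_ae (ae_of_all _ fun y => ?_)
  simp only [smul_eq_mul]
  congr 2
  rw [inner_smul_right]
  push_cast
  have : (Real.pi : ℂ) ≠ 0 := Complex.ofReal_ne_zero.2 Real.pi_ne_zero
  field_simp

theorem continuous_fourierHat (u : 𝓢(E n, ℂ)) : Continuous (fourierHat u) := by
  rw [show fourierHat u = _ from funext (fourierHat_eq u)]
  exact (SchwartzMap.continuous _).comp (continuous_const_smul _)

theorem integrable_fourierHat (u : 𝓢(E n, ℂ)) : Integrable (fourierHat u) := by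
  rw [show fourierHat u = _ from funext (fourierHat_eq u)]
  exact (SchwartzMap.integrable _).comp_smul (by positivity)

theorem fourierHat_add (u w : 𝓢(E n, ℂ)) (ξ : E n) :
    fourierHat (u + w : 𝓢(E n, ℂ)) ξ = fourierHat u ξ + fourierHat w ξ := by
  rw [fourierHat_eq, fourierHat_eq, fourierHat_eq, FourierTransform.fourier_add]
  rfl

theorem fourierHat_smul (z : ℂ) (u : 𝓢(E n, ℂ)) (ξ : E n) :
    fourierHat (z • u : 𝓢(E n, ℂ)) ξ = z * fourierHat u ξ := by
  rw [fourierHat_eq, fourierHat_eq, FourierTransform.fourier_smul]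
  rfl

-- Plancherel for `𝓕`; the factor (2π)ⁿ is the Jacobian of the dilation.
open FourierTransform in
theorem lintegral_fourierHat_sq (u : 𝓢(E n, ℂ)) :
    ∫⁻ ξ, ‖fourierHat u ξ‖ₑ ^ 2 =
      ENNReal.ofReal ((2 * Real.pi) ^ n) * eLpNorm u 2 volume ^ 2 := by
  have h1 : eLpNorm (𝓕 u : 𝓢(E n, ℂ)) 2 volume = eLpNorm u 2 volume := by
    have := SchwartzMap.norm_fourier_toL2_eq u
    rw [SchwartzMap.norm_toLp, SchwartzMap.norm_toLp] at this
    exact (ENNReal.toReal_eq_toReal_iff' (SchwartzMap.eLpNorm_lt_top _ _ _).ne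
      (SchwartzMap.eLpNorm_lt_top _ _ _).ne).1 this
  have h2 : Measurable fun ξ => ‖(𝓕 u : 𝓢(E n, ℂ)) ξ‖ₑ ^ 2 :=
    (SchwartzMap.continuous _).measurable.enorm.pow_const 2
  have h3 := lintegral_map (μ := (volume : Measure (E n))) h2
    (measurable_const_smul (2 * Real.pi)⁻¹)
  have hpi : (2 * Real.pi)⁻¹ ≠ 0 := by positivity
  rw [Measure.map_addHaar_smul _ hpi, lintegral_smul_measure] at h3
  simp only [fourierHat_eq]
  rw [← h3, ← h1, eLpNorm_two_eq_lintegral, rpow_half_sq]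
  congr 2
  rw [finrank_euclideanSpace_fin, inv_pow, inv_inv, abs_of_pos (by positivity)]

/-- The two sides can differ only at ξ = 0, a null set because n ≥ 1. -/
theorem ae_fioIntegrand_eq (hn : 1 ≤ n) (φ : E n → E n → ℝ) (a : E n → E n → ℂ) (u : E n → ℂ)
    (x : E n) :
    (fun ξ => oscFactor φ x ξ * fourierHat u ξ * a x ξ) =ᵐ[volume] fioIntegrand φ a u x := by
  have hnt : Nontrivial (E n) :=
    Module.nontrivial_of_finrank_pos (R := ℝ) (by rw [finrank_euclideanSpace_fin]; omega)
  filter_upwards [compl_mem_ae_iff.2 (measure_singleton (μ := (volume : Measure (E n))) 0)]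
    with ξ hξ
  rw [oscFactor_of_ne φ x hξ, fioIntegrand]
  ring

theorem exists_fio_bound (hn : 1 ≤ n) {m ρ : ℝ} {p r : ℝ≥0∞} (hρ0 : 0 ≤ ρ) (hρ1 : ρ ≤ 1)
    (hp : 2 ≤ p) (hr : 1 / r = 1 / p + 1 / 2) (hm : m < n * (ρ - 1) / 2)
    (B : (Fin n → ℕ) → (Fin n → ℕ) → ℝ) {c : ℝ} (hc : 0 < c) :
    ∃ C : ℝ≥0, ∀ φ : E n → E n → ℝ, IsPhaseWith 2 B φ → SNDWith c φ →
      ∀ a : E n → E n → ℂ, IsAmplitude p m ρ a → ∀ u : 𝓢(E n, ℂ),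
        (∀ᵐ x, Integrable (fioIntegrand φ a u x)) ∧
        AEStronglyMeasurable (fio φ a u) volume ∧
        eLpNorm (fio φ a u) r volume ≤ C * ampSeminorm p m ρ n a * eLpNorm u 2 volume := by
  obtain ⟨C, hC, H⟩ := exists_amplitude_bound hn hρ0 hρ1 hp hr hm B hc
  set K : ℂ := (((2 * Real.pi) ^ n : ℝ) : ℂ)⁻¹ with hK
  set C' : ℝ≥0∞ := ‖K‖ₑ * C * ENNReal.ofReal ((2 * Real.pi) ^ n) ^ (1 / 2 : ℝ) with hC'
  have hC't : C' ≠ ⊤ := by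
    have h1 : ENNReal.ofReal ((2 * Real.pi) ^ n) ^ (1 / 2 : ℝ) < ⊤ :=
      ENNReal.rpow_lt_top_of_nonneg (by norm_num) ENNReal.ofReal_ne_top
    exact (ENNReal.mul_lt_top (ENNReal.mul_lt_top enorm_lt_top hC) h1).ne
  refine ⟨C'.toNNReal, fun φ hφ hsnd a ha u => ?_⟩
  obtain ⟨h1, h2⟩ := H φ hφ hsnd a ha _ (integrable_fourierHat u)
    (continuous_fourierHat u).measurable
  have hae := ae_fioIntegrand_eq hn φ a u
  have hfio : fio φ a u =
      K • fun x => ∫ ξ, oscFactor φ x ξ * fourierHat u ξ * a x ξ := by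
    funext x
    simp only [fio, Pi.smul_apply, smul_eq_mul]
    rw [integral_congr_ae (hae x)]
  refine ⟨?_, ?_, ?_⟩
  · filter_upwards [h1] with x hx
    exact hx.congr (hae x)
  · rw [hfio]
    refine AEStronglyMeasurable.const_smul ?_ K
    obtain ⟨a', ha'm, ha'⟩ := exists_measurable_version ha.measurable
      (ha.smooth.mono fun x hx => hx.continuous)
    have h3 : Measurable fun z : E n × E n =>
        oscFactor φ z.1 z.2 * fourierHat u z.2 * a' z.1 z.2 :=
      (hφ.measurable_oscFactor.mul ((continuous_fourierHat u).measurable.comp measurable_snd)).mul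
        ha'm
    refine (h3.stronglyMeasurable.integral_prod_right'
      (ν := (volume : Measure (E n)))).aestronglyMeasurable.congr ?_
    filter_upwards [ha'] with x hx
    simp only [hx]
  · rw [ENNReal.coe_toNNReal hC't, hfio, eLpNorm_const_smul]
    refine (mul_le_mul_right h2 _).trans (le_of_eq ?_)
    rw [lintegral_fourierHat_sq, ENNReal.mul_rpow_of_nonneg _ _ (by norm_num),
      ← ENNReal.rpow_natCast (eLpNorm u 2 volume), ← ENNReal.rpow_mul]
    norm_num [hC']
    ring

theorem exists_extension {r : ℝ≥0∞} (hr1 : 1 ≤ r) {φ : E n → E n → ℝ}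
    {a : E n → E n → ℂ} {S : ℝ≥0∞} (hS : S < ⊤)
    (hint : ∀ u : 𝓢(E n, ℂ), ∀ᵐ x, Integrable (fioIntegrand φ a u x))
    (hmeas : ∀ u : 𝓢(E n, ℂ), AEStronglyMeasurable (fio φ a u) volume)
    (hle : ∀ u : 𝓢(E n, ℂ), eLpNorm (fio φ a u) r volume ≤ S * eLpNorm u 2 volume) :
    ∃ T : Lp ℂ 2 (volume : Measure (E n)) →ₗ[ℂ] Lp ℂ r (volume : Measure (E n)),
      (∀ f, eLpNorm (T f) r volume ≤ S * eLpNorm f 2 volume) ∧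
      ∀ u : 𝓢(E n, ℂ), T (u.toLp 2 volume) =ᵐ[volume] fio φ a u := by
  have hfact : Fact (1 ≤ r) := ⟨hr1⟩
  have hmem : ∀ u : 𝓢(E n, ℂ), MemLp (fio φ a u) r volume := fun u =>
    ⟨hmeas u, (hle u).trans_lt (ENNReal.mul_lt_top hS (u.eLpNorm_lt_top 2 volume))⟩
  -- Additivity needs both integrals to converge, so it holds for almost every x; homogeneity below
  -- holds at every x.
  have hadd : ∀ u w : 𝓢(E n, ℂ),
      fio φ a (u + w : 𝓢(E n, ℂ)) =ᵐ[volume] fio φ a u + fio φ a w := fun u w => by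
    filter_upwards [hint u, hint w] with x hu hw
    simp only [fio, Pi.add_apply]
    rw [← mul_add, ← integral_add hu hw]
    congr 2
    funext ξ
    simp only [fioIntegrand, fourierHat_add]
    ring
  have hsmul : ∀ (z : ℂ) (u : 𝓢(E n, ℂ)),
      fio φ a (z • u : 𝓢(E n, ℂ)) = z • fio φ a u := fun z u => by
    funext x
    simp only [fio, Pi.smul_apply, smul_eq_mul]
    rw [mul_left_comm z, ← integral_const_mul z]
    congr 2
    funext ξ
    simp only [fioIntegrand, fourierHat_smul]
    ring
  let T₀ : 𝓢(E n, ℂ) →ₗ[ℂ] Lp ℂ r (volume : Measure (E n)) :=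
    { toFun := fun u => (hmem u).toLp
      map_add' := fun u w => by
        rw [← MemLp.toLp_add]
        exact (MemLp.toLp_eq_toLp_iff _ _).2 (hadd u w)
      map_smul' := fun z u => by
        rw [RingHom.id_apply, ← MemLp.toLp_const_smul]
        exact (MemLp.toLp_eq_toLp_iff _ _).2 (Filter.EventuallyEq.of_eq (hsmul z u)) }
  let e : 𝓢(E n, ℂ) →ₗ[ℂ] Lp ℂ 2 (volume : Measure (E n)) :=
    (SchwartzMap.toLpCLM ℂ ℂ 2 volume).toLinearMap
  have hdense : DenseRange e := SchwartzMap.denseRange_toLpCLM (p := 2) ENNReal.ofNat_ne_top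
  have hbound : ∀ u, ‖T₀ u‖ ≤ S.toReal * ‖e u‖ := fun u => by
    have h1 : ‖T₀ u‖ = (eLpNorm (fio φ a u) r volume).toReal := Lp.norm_toLp _ (hmem u)
    have h2 : ‖e u‖ = (eLpNorm u 2 volume).toReal := SchwartzMap.norm_toLp
    rw [h1, h2, ← ENNReal.toReal_mul]
    exact ENNReal.toReal_mono (ENNReal.mul_lt_top hS (u.eLpNorm_lt_top 2 volume)).ne (hle u)
  refine ⟨(T₀.extendOfNorm e).toLinearMap, fun f => ?_, fun u => ?_⟩
  · have h1 := LinearMap.norm_extendOfNorm_apply_le hdense S.toReal hbound f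
    rw [Lp.norm_def, Lp.norm_def, ← ENNReal.toReal_mul] at h1
    exact (ENNReal.toReal_le_toReal (Lp.eLpNorm_ne_top _)
      (ENNReal.mul_lt_top hS (Lp.eLpNorm_lt_top f)).ne).1 h1
  · have h1 : T₀.extendOfNorm e (e u) = T₀ u := LinearMap.extendOfNorm_eq hdense ⟨_, hbound⟩ u
    have h2 := (hmem u).coeFn_toLp
    have h3 : T₀.extendOfNorm e (u.toLp 2 volume) = (hmem u).toLp := h1
    rw [ContinuousLinearMap.coe_coe, h3]
    exact h2

end Extension

end RoughFIO

end

/-- For an amplitude in `L^p S^m_ρ` and a strongly non-degenerate phase in `Φ²`, the integral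
defining `T_a u(x)` converges absolutely for Schwartz `u` and almost every `x`, and `T_a` extends
from the Schwartz space to a bounded linear operator `L² → L^r`. The norm is controlled by a
constant, depending only on `n, m, ρ, p` and the phase constants `B, c`, times a seminorm of the
amplitude of finite order `N = N(n, m, ρ, p)`. -/
theorem theorem4p5 (n : ℕ) (hn : 1 ≤ n) (m ρ : ℝ) (p r : ℝ≥0∞)
    (hρ0 : 0 ≤ ρ) (hρ1 : ρ ≤ 1) (hp : 2 ≤ p) (hr : 1 / r = 1 / p + 1 / 2)
    (hm : m < (n : ℝ) * (ρ - 1) / 2) :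
    ∃ N : ℕ, ∀ (B : (Fin n → ℕ) → (Fin n → ℕ) → ℝ) (c : ℝ), 0 < c →
      ∃ C : ℝ≥0, ∀ (φ : RoughFIO.E n → RoughFIO.E n → ℝ),
        RoughFIO.IsPhaseWith 2 B φ → RoughFIO.SNDWith c φ →
        ∀ a : RoughFIO.E n → RoughFIO.E n → ℂ, RoughFIO.IsAmplitude p m ρ a →
          RoughFIO.ampSeminorm p m ρ N a < ⊤ ∧
          ∃ T : Lp ℂ 2 (volume : Measure (RoughFIO.E n)) →ₗ[ℂ]
              Lp ℂ r (volume : Measure (RoughFIO.E n)),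
            (∀ f, eLpNorm (T f) r volume
              ≤ (C : ℝ≥0∞) * RoughFIO.ampSeminorm p m ρ N a * eLpNorm f 2 volume) ∧
            ∀ u : 𝓢(RoughFIO.E n, ℂ),
              (∀ᵐ x, Integrable (RoughFIO.fioIntegrand φ a u x) volume) ∧
              T (u.toLp 2 volume) =ᵐ[volume] RoughFIO.fio φ a u := by
  -- Only the derivatives ∂_ξ^α with α ∈ {0,1}ⁿ enter, so order n suffices.
  refine ⟨n, fun B c hc => ?_⟩
  obtain ⟨C, hC⟩ := RoughFIO.exists_fio_bound hn hρ0 hρ1 hp hr hm B hc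
  refine ⟨C, fun φ hφ hsnd a ha => ⟨ha.ampSeminorm_lt_top n, ?_⟩⟩
  obtain ⟨T, hT, hTu⟩ := RoughFIO.exists_extension (RoughFIO.one_le_of_holder hp hr)
    (ENNReal.mul_lt_top ENNReal.coe_lt_top (ha.ampSeminorm_lt_top n))
    (fun u => (hC φ hφ hsnd a ha u).1) (fun u => (hC φ hφ hsnd a ha u).2.1)
    (fun u => (hC φ hφ hsnd a ha u).2.2)
  exact ⟨T, hT, fun u => ⟨(hC φ hφ hsnd a ha u).1, hTu u⟩⟩
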